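/- For a finite graph $G$ let $g(G)$ denote its genus, i.e. the smallest $g\ge 0$ such that $G$ embeds in the sphere with $g$ handles. Let $G(n_1,n_2,p)$ be the binomial random bipartite graph: its partition classes have sizes $n_1$ and $n_2$, and each of the $n_1n_2$ possible edges between them is present independently with probability $p$. For $x>1$ put $$\mu(x)=\frac12-\frac1x+\frac1{x^2}\sum_{k=1}^{\infty}\left(xe^{-x}\right)^k\frac{k^{k-2}}{k!}.$$ **Theorem.** Let $d>1$ be a constant, and let $n_1=n_1(n)$ and $n_2=n_2(n)$ be sequences of natural numbers with $n_1\to\infty$ and $n_1=o(n_2)$ as $n\to\infty$. Let $p=p(n)=\dfrac{d}{\sqrt{n_1n_2}}$ (which lies in $[0,1]$ for all large $n$). Then with high probability $$g\bigl(G(n_1,n_2,p)\bigr)=(1+o(1))\,\mu(d^2)\,\frac{d^2n_1}{2},$$ that is, for every $\varepsilon>0$, $$\lim_{n\to\infty}\mathbb P\left(\left|g\bigl(G(n_1,n_2,p)\bigr)-\mu(d^2)\frac{d^2n_1}{2}\right|\le\varepsilon\,\mu(d^2)\frac{d^2n_1}{2}\right)=1 .$$ -/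

import Mathlib

open MeasureTheory ProbabilityTheory Filter Topology Asymptotics

/-- A finite cell decomposition of a closed oriented surface into vertices, edges and open disc
faces, encoded as usual by its set `D` of darts (edges with a direction). `σ` sends a dart to the
next dart around its initial vertex, in the positive sense, and `α` reverses a dart. -/
structure CombinatorialMap (D : Type) where
  /-- rotation about the initial vertex of a dart -/
  σ : Equiv.Perm D
  /-- reversal of darts -/
  α : Equiv.Perm D
  α_α : ∀ x, α (α x) = x
  α_ne : ∀ x, α x ≠ x

namespace CombinatorialMap

variable {D : Type}

/-- The cycles (orbits) of a permutation, fixed points included. -/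
abbrev Cycles (π : Equiv.Perm D) : Type := Quotient (Equiv.Perm.SameCycle.setoid π)

/-- The vertices of the cell decomposition: the cycles of `σ`. -/
abbrev Vertex (M : CombinatorialMap D) : Type := Cycles M.σ

/-- The edges of the cell decomposition: the cycles of `α`. -/
abbrev Edge (M : CombinatorialMap D) : Type := Cycles M.α

/-- The faces of the cell decomposition: the cycles of `σ ∘ α`, which trace the boundary walks. -/
abbrev Face (M : CombinatorialMap D) : Type := Cycles (M.σ * M.α)

/-- The initial vertex of a dart. -/
def source (M : CombinatorialMap D) (x : D) : M.Vertex :=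
  Quotient.mk (Equiv.Perm.SameCycle.setoid M.σ) x

/-- The surface is connected (and non-empty). -/
def IsConnected (M : CombinatorialMap D) : Prop :=
  Nonempty D ∧ ∀ x y : D, ∃ π ∈ Subgroup.closure {M.σ, M.α}, π x = y

/-- The Euler characteristic of the surface. -/
noncomputable def eulerChar (M : CombinatorialMap D) : ℤ :=
  (Nat.card M.Vertex : ℤ) - Nat.card M.Edge + Nat.card M.Face

/-- The surface is the sphere with `g` handles, i.e. the connected closed orientable surface of
Euler characteristic `2 - 2 g`. -/
def IsSphereWithHandles (M : CombinatorialMap D) (g : ℕ) : Prop :=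
  M.IsConnected ∧ M.eulerChar = 2 - 2 * (g : ℤ)

/-- The graph `G` is drawn without crossings on the surface, as part of the 1-skeleton of the cell
decomposition: distinct vertices go to distinct vertices and distinct edges to distinct edges. The
complementary regions of `G` itself need not be discs, and `G` need not be connected. -/
def Carries {V : Type*} (M : CombinatorialMap D) (G : SimpleGraph V) : Prop :=
  ∃ (v : V → M.Vertex) (e : G.Dart → D), Function.Injective v ∧ Function.Injective e ∧
    (∀ a : G.Dart, M.source (e a) = v a.fst) ∧ (∀ a : G.Dart, e a.symm = M.α (e a))

end CombinatorialMap

namespace SimpleGraph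

/-- `G` can be embedded on the sphere with `g` handles. -/
def EmbedsInGenus {V : Type*} (G : SimpleGraph V) (g : ℕ) : Prop :=
  ∃ (D : Type) (_ : Finite D) (M : CombinatorialMap D), M.IsSphereWithHandles g ∧ M.Carries G

/-- The (orientable) genus of a finite graph. -/
noncomputable def genus {V : Type*} [Finite V] (G : SimpleGraph V) : ℕ :=
  sInf {g : ℕ | G.EmbedsInGenus g}

/-- The law of the binomial random bipartite graph with partition classes of sizes `n₁` and `n₂`:
each edge of the complete bipartite graph is present independently with probability `p`. -/
noncomputable def bipartiteRandom (n₁ n₂ : ℕ) (p : unitInterval) :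
    Measure (SimpleGraph (Fin n₁ ⊕ Fin n₂)) :=
  (setBernoulli (completeBipartiteGraph (Fin n₁) (Fin n₂)).edgeSet p).map fromEdgeSet

end SimpleGraph

/-- The function
`μ(x) = 1/2 - 1/x + x⁻² ∑_{k ≥ 1} (x e^{-x})^k k^{k-2} / k!`,
with the summation index shifted by one. -/
noncomputable def genusMu (x : ℝ) : ℝ :=
  1 / 2 - 1 / x + 1 / x ^ 2 *
    ∑' k : ℕ, (x * Real.exp (-x)) ^ (k + 1) *
      (((k : ℝ) + 1) ^ ((k : ℤ) - 1) / (Nat.factorial (k + 1) : ℝ))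

/-! The genus is controlled by the cyclomatic number `betti F`, the dimension of the cycle space of
the graph. A connected graph drawn by an arbitrary rotation system has at least one face, so Euler's
formula gives 2g ≤ betti (`two_mul_genus_le`). Conversely, for a graph drawn on the sphere with g
handles, betti is at most 2g plus the number of regions of its complement. If there are several
regions, the boundary of each contains a non-empty set of edges without vertices of degree one, and
each edge borders at most two regions. Regions whose set has at most L edges are therefore at most
twice the small core sets, and the others number at most 2/(L+1) times the edges whose right
endpoint has degree at least two (`finrank_circulations_le_of_embedsInGenus`).

In the random graph the expected number of core sets with at most L edges is bounded in terms of d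
and L, while the expected number of edges with right endpoint of degree at least two is at most
d²n₁. Letting n₁ tend to infinity for fixed L, and then taking L large, gives betti − 2g = o(n₁) in
mean. Efron–Stein bounds the variance of betti by d²n₁, so only its mean remains.

Counting vertices, edges and components gives betti = ∑_b (deg b − 1)⁺ − n₁ + c, where c is the
number of components of the projection to the left class, in which two left vertices are joined when
they have a common neighbour (`finrank_circulations`). Up to o(n₁) the first sum has mean d²n₁/2.
The projection is a union of n₂ independent random cliques. Since n₁p → 0, each can be replaced by
independent pairs of probability p² with total error o(n₁)
(`abs_subsetExp_comps_projection_sub_le`), which turns the projection into a binomial random graph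
with edge probability asymptotic to d²/n₁. Its components of each fixed size are counted by an
exploration recursion whose leading coefficient is Cayley's number of trees, and few components are
large (`tendsto_sum_expectedComps_div`). The three terms add up to d²μ(d²)n₁.

Since μ(d²) > 0 (`genusMu_pos`), the resulting mean estimate of 2g with error o(n₁) is a relative
one, and Markov's inequality finishes the proof. -/

namespace CombinatorialMap

/-! ### Homology of cell decompositions and Euler's inequality -/

section Homology

variable {D : Type} (M : CombinatorialMap D)

theorem IsConnected.eq_of_invariant {M : CombinatorialMap D} (hM : M.IsConnected) {X : Type*}
    (f : D → X) (hσ : ∀ x, f (M.σ x) = f x) (hα : ∀ x, f (M.α x) = f x) (x y : D) :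
    f x = f y := by
  obtain ⟨π, hπ, rfl⟩ := hM.2 x y
  have key : ∀ π ∈ Subgroup.closure {M.σ, M.α}, ∀ x, f (π x) = f x := by
    intro π hπ
    induction hπ using Subgroup.closure_induction with
    | mem π h => rcases h with rfl | rfl <;> assumption
    | one => simp
    | mul a b _ _ ha hb => intro x; simp [ha, hb]
    | inv a _ ha => intro x; rw [← ha (a⁻¹ x)]; simp
  exact (key π hπ x).symm

/-- The boundary walk through a dart. -/
def face (x : D) : M.Face := Quotient.mk (Equiv.Perm.SameCycle.setoid _) x

theorem face_eq (x : D) : M.face (M.σ (M.α x)) = M.face x := by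
  apply Quotient.sound
  change Equiv.Perm.SameCycle _ _ _
  exact Equiv.Perm.sameCycle_apply_left.2 (Equiv.Perm.SameCycle.refl _ _)

theorem face_α (x : D) : M.face (M.α x) = M.face (M.σ x) := by
  rw [← M.face_eq (M.α x), M.α_α]

theorem source_σ (x : D) : M.source (M.σ x) = M.source x := by
  apply Quotient.sound
  change Equiv.Perm.SameCycle _ _ _
  exact Equiv.Perm.sameCycle_apply_left.2 (Equiv.Perm.SameCycle.refl _ _)

/-- The coboundary of a function of a label `q x` of the darts. -/
def coboundary {Q : Type} (q : D → Q) : (Q → ℚ) →ₗ[ℚ] (D → ℚ) where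
  toFun f x := f (q x) - f (q (M.α x))
  map_add' f g := by ext x; simp; ring
  map_smul' c f := by ext x; simp; ring

@[simp] theorem coboundary_apply {Q : Type} (q : D → Q) (f : Q → ℚ) (x : D) :
    M.coboundary q f x = f (q x) - f (q (M.α x)) := rfl

/-- The kernel consists of labels invariant under `α`, hence under `σ` by `hinv`, hence constant by
connectedness. Rank–nullity does the rest. It serves both for vertices and for faces. -/
theorem card_le_finrank_range_coboundary_add_one {M : CombinatorialMap D} (hM : M.IsConnected)
    {Q : Type} [Finite Q]
    (q : D → Q) (hq : Function.Surjective q)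
    (hinv : ∀ f : Q → ℚ, (∀ x, f (q (M.α x)) = f (q x)) → ∀ x, f (q (M.σ x)) = f (q x)) :
    Nat.card Q ≤ Module.finrank ℚ (LinearMap.range (M.coboundary q)) + 1 := by
  have := Fintype.ofFinite Q
  have h1 := LinearMap.finrank_range_add_finrank_ker (M.coboundary q)
  have h2 : Module.finrank ℚ (LinearMap.ker (M.coboundary q)) ≤ 1 := by
    have hle : LinearMap.ker (M.coboundary q) ≤ Submodule.span ℚ {fun _ => 1} := by
      intro f hf
      rw [Submodule.mem_span_singleton]
      obtain ⟨x₀⟩ := hM.1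
      have hα : ∀ x, f (q (M.α x)) = f (q x) := fun x => by
        have := congrFun (LinearMap.mem_ker.1 hf) x
        simp at this
        linarith
      refine ⟨f (q x₀), ?_⟩
      ext y
      obtain ⟨x, rfl⟩ := hq y
      simpa using hM.eq_of_invariant (fun x => f (q x)) (hinv f hα) hα x₀ x
    exact (Submodule.finrank_mono hle).trans ((finrank_span_le_card _).trans (by simp))
  rw [Module.finrank_fintype_fun_eq_card] at h1
  rw [Nat.card_eq_fintype_card]
  omega

/-- Functions changing sign when a dart is reversed. -/
def antisymm : Submodule ℚ (D → ℚ) where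
  carrier := {h | ∀ x, h (M.α x) = - h x}
  add_mem' ha hb x := by simp [ha x, hb x]; ring
  zero_mem' x := by simp
  smul_mem' c h hh x := by simp [hh x]

theorem α_mul_self : M.α * M.α = 1 := by ext x; simp [M.α_α]

theorem sameCycle_α_iff (x y : D) : M.α.SameCycle x y ↔ y = x ∨ y = M.α x := by
  constructor
  · rintro ⟨i, rfl⟩
    rcases Int.even_or_odd' i with ⟨k, rfl | rfl⟩
    · left; rw [zpow_mul, zpow_two, α_mul_self, one_zpow]; rfl
    · right; rw [zpow_add, zpow_mul, zpow_two, α_mul_self, one_zpow]; simp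
  · rintro (rfl | rfl)
    · exact Equiv.Perm.SameCycle.refl _ _
    · exact Equiv.Perm.sameCycle_apply_right.2 (Equiv.Perm.SameCycle.refl _ _)

theorem finrank_antisymm_le [Finite D] : Module.finrank ℚ M.antisymm ≤ Nat.card M.Edge := by
  have := Fintype.ofFinite M.Edge
  let φ : M.antisymm →ₗ[ℚ] (M.Edge → ℚ) :=
    { toFun := fun h e => h.1 e.out
      map_add' := fun _ _ => rfl
      map_smul' := fun _ _ => rfl }
  have hφ : Function.Injective φ := by
    rw [← LinearMap.ker_eq_bot, LinearMap.ker_eq_bot']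
    intro h hh
    ext x
    let e : M.Edge := Quotient.mk (Equiv.Perm.SameCycle.setoid _) x
    have h0 : h.1 e.out = 0 := congrFun hh e
    have h1 : M.α.SameCycle e.out x := Quotient.exact (Quotient.out_eq e)
    rcases (M.sameCycle_α_iff _ _).1 h1 with h2 | h2
    · rw [h2]; exact h0
    · rw [h2, h.2, h0]; simp
  have := LinearMap.finrank_le_finrank_of_injective hφ
  rwa [Module.finrank_fintype_fun_eq_card, ← Nat.card_eq_fintype_card] at this

/-- The cycle space of the 1-skeleton. -/
def cycles [Fintype D] : Submodule ℚ (D → ℚ) where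
  carrier := {h | h ∈ M.antisymm ∧ ∀ g : M.Vertex → ℚ, ∑ x, h x * g (M.source x) = 0}
  add_mem' ha hb := ⟨add_mem ha.1 hb.1, fun g => by
    simp [add_mul, Finset.sum_add_distrib, ha.2 g, hb.2 g]⟩
  zero_mem' := ⟨zero_mem _, fun g => by simp⟩
  smul_mem' c h hh := ⟨Submodule.smul_mem _ _ hh.1, fun g => by
    simp [mul_assoc, ← Finset.mul_sum, hh.2 g]⟩

theorem coboundary_mem_antisymm {Q : Type} (q : D → Q) (f : Q → ℚ) :
    M.coboundary q f ∈ M.antisymm := fun x => by simp [M.α_α]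

/-- The value at `x` is f(q x) − f(q(σ x)), which telescopes around each vertex. Both faces and
regions satisfy `hq`. -/
theorem coboundary_mem_cycles [Fintype D] {Q : Type} (q : D → Q)
    (hq : ∀ x, q (M.α x) = q (M.σ x)) (f : Q → ℚ) : M.coboundary q f ∈ M.cycles := by
  refine ⟨M.coboundary_mem_antisymm q f, fun g => ?_⟩
  have h := Equiv.sum_comp M.σ (fun x => f (q x) * g (M.source x))
  simp only [source_σ] at h
  simp [hq, sub_mul, h]

/-- Cycles and vertex coboundaries are orthogonal subspaces of the antisymmetric functions. The
latter have dimension at most the number of edges, and the vertex coboundaries have dimension at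
least V − 1. -/
theorem finrank_cycles_add_card_vertex_le [Fintype D] {M : CombinatorialMap D}
    (hM : M.IsConnected) :
    Module.finrank ℚ M.cycles + Nat.card M.Vertex ≤ Nat.card M.Edge + 1 := by
  have h1 := card_le_finrank_range_coboundary_add_one hM M.source Quotient.mk_surjective
    (fun f _ x => by rw [source_σ])
  have h2 := M.finrank_antisymm_le
  have h3 : M.cycles ⊓ LinearMap.range (M.coboundary M.source) = ⊥ := by
    rw [eq_bot_iff]
    rintro h ⟨⟨ha, hz⟩, g, rfl⟩
    set h := M.coboundary M.source g with hh
    have e1 : ∑ x, h x * g (M.source (M.α x)) = 0 := by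
      rw [← Equiv.sum_comp M.α]
      simp_rw [M.α_α, ha _, neg_mul, Finset.sum_neg_distrib, hz g, neg_zero]
    have e2 : ∑ x, h x * h x = 0 := by
      have : ∀ x, h x * h x = h x * g (M.source x) - h x * g (M.source (M.α x)) := by
        intro x; rw [hh, coboundary_apply]; ring
      simp_rw [this, Finset.sum_sub_distrib, hz g, e1, sub_zero]
    rw [Finset.sum_eq_zero_iff_of_nonneg (fun x _ => mul_self_nonneg _)] at e2
    simp only [Submodule.mem_bot]
    ext x
    simpa using e2 x (Finset.mem_univ _)
  have h4 := Submodule.finrank_sup_add_finrank_inf_eq M.cycles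
    (LinearMap.range (M.coboundary M.source))
  rw [h3, finrank_bot] at h4
  have h5 : M.cycles ⊔ LinearMap.range (M.coboundary M.source) ≤ M.antisymm := by
    refine sup_le (fun h hh => hh.1) ?_
    rintro _ ⟨f, rfl⟩
    exact M.coboundary_mem_antisymm _ f
  have h6 := Submodule.finrank_mono h5
  omega

theorem card_face_le [Finite D] {M : CombinatorialMap D} (hM : M.IsConnected) :
    Nat.card M.Face ≤ Module.finrank ℚ (LinearMap.range (M.coboundary M.face)) + 1 :=
  card_le_finrank_range_coboundary_add_one hM M.face Quotient.mk_surjective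
    (fun f h x => by rw [← face_α, h])

theorem range_coboundary_face_le [Fintype D] :
    LinearMap.range (M.coboundary M.face) ≤ M.cycles := by
  rintro _ ⟨f, rfl⟩
  exact M.coboundary_mem_cycles _ M.face_α f

/-- Face boundaries are cycles, so F − 1 ≤ dim cycles ≤ E − V + 1. -/
theorem eulerChar_le_two [Finite D] {M : CombinatorialMap D} (hM : M.IsConnected) :
    M.eulerChar ≤ 2 := by
  have := Fintype.ofFinite D
  have h1 := finrank_cycles_add_card_vertex_le hM
  have h2 := card_face_le hM
  have h3 := Submodule.finrank_mono M.range_coboundary_face_le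
  unfold eulerChar
  omega

/-- The regions into which a set `P` of darts cuts the surface. -/
def Region (P : Set D) : Type :=
  Quot fun x y : D => y = M.σ (M.α x) ∨ (x ∉ P ∧ y = M.α x)

/-- The region to the side of a dart. -/
def region (P : Set D) (x : D) : M.Region P := Quot.mk _ x

instance [Finite D] (P : Set D) : Finite (M.Region P) := Quot.finite _

theorem region_α (P : Set D) (x : D) : M.region P (M.α x) = M.region P (M.σ x) := by
  have : M.region P (M.α x) = M.region P (M.σ (M.α (M.α x))) := Quot.sound (Or.inl rfl)
  rwa [M.α_α] at this

theorem region_α_of_notMem {P : Set D} {x : D} (hx : x ∉ P) :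
    M.region P (M.α x) = M.region P x := by
  have : M.region P x = M.region P (M.α x) := Quot.sound (Or.inr ⟨hx, rfl⟩)
  exact this.symm

/-- Functions on darts vanishing outside `P`. -/
def supportedOn (P : Set D) : Submodule ℚ (D → ℚ) where
  carrier := {h | ∀ x, x ∉ P → h x = 0}
  add_mem' ha hb x hx := by simp [ha x hx, hb x hx]
  zero_mem' x _ := rfl
  smul_mem' c h hh x hx := by simp [hh x hx]

/-- Modulo the face boundaries B the cycle space has dimension at most (E − V + 1) − (F − 1) = 2g.
This bounds the part of W that survives modulo B, and W ∩ B is bounded by the number of regions. -/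
theorem finrank_cycles_inf_supportedOn_le [Fintype D] {M : CombinatorialMap D} {g : ℕ}
    (hM : M.IsSphereWithHandles g) (P : Set D) :
    Module.finrank ℚ ↥(M.cycles ⊓ supportedOn P) ≤ 2 * g + Nat.card (M.Region P) := by
  obtain ⟨hc, hχ⟩ := hM
  have h1 := finrank_cycles_add_card_vertex_le hc
  have h2 := card_face_le hc
  set W := M.cycles ⊓ supportedOn P
  set B := LinearMap.range (M.coboundary M.face)
  have h3 := Submodule.finrank_sup_add_finrank_inf_eq W B
  have h4 : Module.finrank ℚ ↥(W ⊔ B) ≤ Module.finrank ℚ M.cycles :=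
    Submodule.finrank_mono (sup_le inf_le_left M.range_coboundary_face_le)
  -- If the coboundary of a function on faces vanishes off `P`, then the function agrees on the two
  -- sides of each dart outside `P`, so it descends to regions.
  have h5 : W ⊓ B ≤ LinearMap.range (M.coboundary (M.region P)) := by
    rintro _ ⟨⟨-, hP⟩, f, rfl⟩
    refine ⟨Quot.lift (fun x => f (M.face x)) ?_, ?_⟩
    · rintro x y (rfl | ⟨hx, rfl⟩)
      · rw [face_eq]
      · have := hP x hx
        rw [coboundary_apply] at this
        linarith
    · ext x; rfl
  have h6 := Submodule.finrank_mono h5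
  have h7 := LinearMap.finrank_range_le (M.coboundary (M.region P))
  have := Fintype.ofFinite (M.Region P)
  rw [Module.finrank_fintype_fun_eq_card, ← Nat.card_eq_fintype_card] at h7
  unfold eulerChar at hχ
  omega

end Homology

end CombinatorialMap

/-! ### Lower bound for the genus: regions and core sets -/

section Bipartite

variable {α β : Type}

/-- The bipartite graph with a given set of edges. -/
def bipGraph (F : Finset (α × β)) : SimpleGraph (α ⊕ β) :=
  SimpleGraph.fromEdgeSet ((fun i : α × β => s(Sum.inl i.1, Sum.inr i.2)) '' F)

@[simp] theorem bipGraph_adj_inl_inr (F : Finset (α × β)) (a : α) (b : β) :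
    (bipGraph F).Adj (Sum.inl a) (Sum.inr b) ↔ (a, b) ∈ F := by
  simp [bipGraph]

@[simp] theorem bipGraph_adj_inr_inl (F : Finset (α × β)) (a : α) (b : β) :
    (bipGraph F).Adj (Sum.inr b) (Sum.inl a) ↔ (a, b) ∈ F := by
  rw [SimpleGraph.adj_comm, bipGraph_adj_inl_inr]

@[simp] theorem not_bipGraph_adj_inl_inl (F : Finset (α × β)) (a b : α) :
    ¬ (bipGraph F).Adj (Sum.inl a) (Sum.inl b) := by
  simp [bipGraph]

@[simp] theorem not_bipGraph_adj_inr_inr (F : Finset (α × β)) (a b : β) :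
    ¬ (bipGraph F).Adj (Sum.inr a) (Sum.inr b) := by
  simp [bipGraph]

/-- Every endpoint of an edge of `A` lies on a second edge of `A`. -/
def IsCoreSet (A : Finset (α × β)) : Prop :=
  ∀ i ∈ A, (∃ j ∈ A, j ≠ i ∧ j.1 = i.1) ∧ ∃ j ∈ A, j ≠ i ∧ j.2 = i.2

/-- The edges whose right endpoint lies on a second edge. -/
noncomputable def multiEdges (F : Finset (α × β)) : Finset (α × β) := by
  classical exact F.filter fun i => ∃ j ∈ F, j ≠ i ∧ j.2 = i.2

/-- The non-empty core sets of at most `L` edges of `F`. -/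
noncomputable def smallCores (F : Finset (α × β)) (L : ℕ) : Finset (Finset (α × β)) := by
  classical exact F.powerset.filter fun A => A.Nonempty ∧ A.card ≤ L ∧ IsCoreSet A

/-- `A r` stands for the boundary of the region `r`, and `hmul` says that an edge has two sides.
Regions with at most `L` boundary edges are charged to small core sets, the others to their more
than `L` edges. -/
theorem card_le_of_coreSets {R : Type} [Fintype R] (F : Finset (α × β)) (A : R → Finset (α × β))
    (hne : ∀ r, (A r).Nonempty) (hsub : ∀ r, A r ⊆ F) (hcore : ∀ r, IsCoreSet (A r))
    (hmul : ∀ i, ∃ r₁ r₂, ∀ r, i ∈ A r → r = r₁ ∨ r = r₂) (L : ℕ) :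
    (L + 1) * Fintype.card R ≤ (L + 1) * (2 * (smallCores F L).card)
      + 2 * (multiEdges F).card := by
  classical
  have hcard : ∀ i, (Finset.univ.filter fun r => i ∈ A r).card ≤ 2 := by
    intro i
    obtain ⟨r₁, r₂, h⟩ := hmul i
    refine (Finset.card_le_card (t := {r₁, r₂}) ?_).trans Finset.card_le_two
    intro r hr
    simpa using h r (by simpa using hr)
  set S := Finset.univ.filter fun r => (A r).card ≤ L
  set T := Finset.univ.filter fun r => ¬ (A r).card ≤ L
  have hST : S.card + T.card = Fintype.card R := by
    simpa only [Finset.card_univ] using Finset.card_filter_add_card_filter_not (s := Finset.univ)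
      (fun r => (A r).card ≤ L)
  -- All regions with a given boundary contain one fixed edge of it, so at most two regions share a
  -- boundary.
  have hS : S.card ≤ 2 * (smallCores F L).card := by
    refine Finset.card_le_mul_card_image_of_maps_to (f := A) ?_ 2 ?_
    · intro r hr
      simp only [S, Finset.mem_filter, Finset.mem_univ, true_and] at hr
      simp [smallCores, hsub r, hne r, hr, hcore r]
    · intro B hB
      simp only [smallCores, Finset.mem_filter] at hB
      obtain ⟨i, hi⟩ := hB.2.1
      refine (Finset.card_le_card ?_).trans (hcard i)
      intro r hr
      simp only [Finset.mem_filter, Finset.mem_univ, true_and] at hr ⊢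
      rw [hr.2]; exact hi
  have hT : (L + 1) * T.card ≤ 2 * (multiEdges F).card := by
    calc (L + 1) * T.card = ∑ r ∈ T, (L + 1) := by simp [mul_comm]
      _ ≤ ∑ r ∈ T, (A r).card := Finset.sum_le_sum fun r hr => by
          simp only [T, Finset.mem_filter] at hr; omega
      _ ≤ ∑ r, (A r).card := Finset.sum_le_sum_of_subset (Finset.subset_univ _)
      _ = ∑ r, ∑ i ∈ multiEdges F, if i ∈ A r then 1 else 0 := by
          refine Finset.sum_congr rfl fun r _ => ?_
          rw [← Finset.card_filter]
          congr 1
          ext i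
          simp only [Finset.mem_filter, multiEdges]
          refine ⟨fun hi => ⟨⟨hsub r hi, ?_⟩, hi⟩, fun hi => hi.2⟩
          obtain ⟨j, hj, h⟩ := (hcore r i hi).2
          exact ⟨j, hsub r hj, h⟩
      _ = ∑ i ∈ multiEdges F, (Finset.univ.filter fun r => i ∈ A r).card := by
          rw [Finset.sum_comm]
          exact Finset.sum_congr rfl fun i _ => (Finset.card_filter _ _).symm
      _ ≤ ∑ i ∈ multiEdges F, 2 := Finset.sum_le_sum fun i _ => hcard i
      _ = 2 * (multiEdges F).card := by simp [mul_comm]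
  rw [← hST, mul_add]
  exact add_le_add (Nat.mul_le_mul_left _ hS) hT

variable [Fintype α] [Fintype β]

/-- The cycle space of the bipartite graph with edge set `F`. -/
def circulations (F : Finset (α × β)) : Submodule ℚ (α × β → ℚ) where
  carrier := {w | (∀ i, i ∉ F → w i = 0) ∧ (∀ a, ∑ b, w (a, b) = 0) ∧ ∀ b, ∑ a, w (a, b) = 0}
  add_mem' hv hw := ⟨fun i hi => by simp [hv.1 i hi, hw.1 i hi],
    fun a => by simp [Finset.sum_add_distrib, hv.2.1 a, hw.2.1 a],
    fun b => by simp [Finset.sum_add_distrib, hv.2.2 b, hw.2.2 b]⟩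
  zero_mem' := by simp
  smul_mem' c w hw := ⟨fun i hi => by simp [hw.1 i hi],
    fun a => by simp [← Finset.mul_sum, hw.2.1 a],
    fun b => by simp [← Finset.mul_sum, hw.2.2 b]⟩

namespace CombinatorialMap

variable {D : Type} {M : CombinatorialMap D} {F : Finset (α × β)}

/-- The darts of the edges of `F`, for a choice `ρ` of their left-to-right darts. -/
def dartsOf (M : CombinatorialMap D) (ρ : F → D) : Set D :=
  {x | ∃ i, x = ρ i ∨ x = M.α (ρ i)}

/-- A circulation is carried to the surface by placing `w i` on the dart `ρ i` and `-w i` on its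
reverse. The hypotheses `hρ` and `hne` keep these darts distinct, whence injectivity. -/
theorem finrank_circulations_le [Fintype D] (ρ : F → D) (hρ : Function.Injective ρ)
    (hne : ∀ i j, ρ i ≠ M.α (ρ j)) (v : α ⊕ β → M.Vertex)
    (hs : ∀ i, M.source (ρ i) = v (Sum.inl i.1.1))
    (ht : ∀ i, M.source (M.α (ρ i)) = v (Sum.inr i.1.2)) :
    Module.finrank ℚ (circulations F) ≤
      Module.finrank ℚ ↥(M.cycles ⊓ supportedOn (M.dartsOf ρ)) := by
  classical
  let φ : (α × β → ℚ) →ₗ[ℚ] (D → ℚ) :=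
    { toFun := fun w x => ∑ i : F, w i *
        ((if ρ i = x then 1 else 0) - (if M.α (ρ i) = x then 1 else 0))
      map_add' := fun w w' => by ext x; simp [add_mul, Finset.sum_add_distrib]
      map_smul' := fun c w => by ext x; simp [mul_assoc, Finset.mul_sum] }
  have hval : ∀ w (j : F), φ w (ρ j) = w j := by
    intro w j
    change ∑ i : F, w i * _ = _
    simp [hρ.eq_iff, fun i => (hne j i).symm]
  have hmem : ∀ w : circulations F, φ w.1 ∈ M.cycles ⊓ supportedOn (M.dartsOf ρ) := by
    rintro ⟨w, hw0, hw1, hw2⟩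
    refine ⟨⟨?_, ?_⟩, ?_⟩
    · intro x
      change ∑ i : F, w i * _ = - ∑ i : F, w i * _
      rw [← Finset.sum_neg_distrib]
      refine Finset.sum_congr rfl fun i _ => ?_
      have h1 : ρ i = M.α x ↔ M.α (ρ i) = x :=
        ⟨fun h => by rw [h, M.α_α], fun h => by rw [← h, M.α_α]⟩
      have h2 : M.α (ρ i) = M.α x ↔ ρ i = x := M.α.injective.eq_iff
      rw [h1, h2]
      ring
    · intro g
      change ∑ x, (∑ i : F, w i * _) * _ = 0
      simp_rw [Finset.sum_mul]
      rw [Finset.sum_comm]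
      have e1 : ∀ i : F, ∑ x, w i * ((if ρ i = x then (1 : ℚ) else 0)
          - (if M.α (ρ i) = x then 1 else 0)) * g (M.source x)
          = w i * (g (v (Sum.inl i.1.1)) - g (v (Sum.inr i.1.2))) := by
        intro i
        simp_rw [mul_assoc, ← Finset.mul_sum, sub_mul, Finset.sum_sub_distrib, ite_mul, one_mul,
          zero_mul]
        simp [hs, ht]
      simp_rw [e1]
      rw [Finset.sum_coe_sort F
        (fun i => w i * (g (v (Sum.inl i.1)) - g (v (Sum.inr i.2))))]
      rw [Finset.sum_subset (Finset.subset_univ F) (fun i _ hi => by rw [hw0 i hi, zero_mul])]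
      simp_rw [mul_sub, Finset.sum_sub_distrib]
      rw [Fintype.sum_prod_type, Fintype.sum_prod_type_right]
      simp [← Finset.sum_mul, hw1, hw2]
    · intro x hx
      refine Finset.sum_eq_zero fun i _ => ?_
      have h1 : ρ i ≠ x := fun h => hx ⟨i, Or.inl h.symm⟩
      have h2 : M.α (ρ i) ≠ x := fun h => hx ⟨i, Or.inr h.symm⟩
      simp [h1, h2]
  let ψ : circulations F →ₗ[ℚ] ↥(M.cycles ⊓ supportedOn (M.dartsOf ρ)) :=
    (φ.comp (circulations F).subtype).codRestrict _ hmem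
  refine LinearMap.finrank_le_finrank_of_injective (f := ψ) ?_
  rw [← LinearMap.ker_eq_bot, LinearMap.ker_eq_bot']
  rintro ⟨w, hw⟩ h0
  have h1 : φ w = 0 := congrArg Subtype.val h0
  ext i
  by_cases hi : i ∈ F
  · have := hval w ⟨i, hi⟩
    rw [h1] at this
    exact this.symm
  · exact hw.1 i hi

theorem card_region_le [Fintype D] (hM : M.IsConnected) (ρ : F → D)
    (v : α ⊕ β → M.Vertex) (hv : Function.Injective v)
    (hs : ∀ i, M.source (ρ i) = v (Sum.inl i.1.1))
    (ht : ∀ i, M.source (M.α (ρ i)) = v (Sum.inr i.1.2)) (L : ℕ) :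
    (L + 1) * Nat.card (M.Region (M.dartsOf ρ)) ≤
      (L + 1) * (1 + 2 * (smallCores F L).card) + 2 * (multiEdges F).card := by
  classical
  set P := M.dartsOf ρ
  have := Fintype.ofFinite (M.Region P)
  -- A single region has zero boundary, so the argument below gives nothing for it. The summand 1 in
  -- the bound covers this case.
  by_cases h1 : Nat.card (M.Region P) ≤ 1
  · calc _ ≤ (L + 1) * 1 := Nat.mul_le_mul_left _ h1
      _ ≤ _ := by rw [mul_add]; omega
  -- The oriented boundary of the region `r`: a cycle carried by `P`.
  set h : M.Region P → D → ℚ := fun r => M.coboundary (M.region P) (Pi.single r 1)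
  have hcyc : ∀ r, h r ∈ M.cycles := fun r => M.coboundary_mem_cycles _ (M.region_α P) _
  have hα : ∀ r x, h r (M.α x) ≠ 0 ↔ h r x ≠ 0 := fun r x => by rw [(hcyc r).1 x]; simp
  have hsupp : ∀ r x, h r x ≠ 0 → x ∈ P := by
    intro r x hx
    by_contra hxP
    apply hx
    simp [h, M.region_α_of_notMem hxP]
  -- Were the boundary zero, the indicator of `r` would be invariant under `σ` and `α`, so constant,
  -- and `r` would be the only region.
  have hne0 : ∀ r, ∃ x, h r x ≠ 0 := by
    intro r
    by_contra! hr
    have hα' : ∀ x, (Pi.single r 1 : M.Region P → ℚ) (M.region P (M.α x)) =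
        (Pi.single r 1 : M.Region P → ℚ) (M.region P x) := fun x => by
      have := hr x
      simp only [h, coboundary_apply] at this
      linarith
    have hconst := hM.eq_of_invariant
      (fun x => (Pi.single r 1 : M.Region P → ℚ) (M.region P x))
      (fun x => by rw [← M.region_α P, hα']) hα'
    apply h1
    rw [Nat.card_eq_fintype_card, Fintype.card_le_one_iff]
    have : ∀ r', r' = r := by
      intro r'
      obtain ⟨x, rfl⟩ := Quot.exists_rep r
      obtain ⟨y, rfl⟩ := Quot.exists_rep r'
      have h2 := hconst x y
      change (Pi.single (M.region P x) 1 : M.Region P → ℚ) (M.region P x) =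
        (Pi.single (M.region P x) 1 : M.Region P → ℚ) (M.region P y) at h2
      by_contra hxy
      change M.region P y ≠ M.region P x at hxy
      rw [Pi.single_eq_same, Pi.single_eq_of_ne hxy] at h2
      exact one_ne_zero h2
    intro a b
    rw [this a, this b]
  have key := card_le_of_coreSets (R := M.Region P) F
    (fun r => (Finset.univ.filter fun i : F => h r (ρ i) ≠ 0).image Subtype.val)
    ?_ ?_ ?_ ?_ L
  · rw [Nat.card_eq_fintype_card]
    refine key.trans ?_
    gcongr
    omega
  · intro r
    obtain ⟨x, hx⟩ := hne0 r
    obtain ⟨i, rfl | rfl⟩ := hsupp r x hx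
    · exact ⟨i, by simp [hx]⟩
    · exact ⟨i, by simp [(hα r _).1 hx]⟩
  · intro r i hi
    simp only [Finset.mem_image] at hi
    obtain ⟨j, -, rfl⟩ := hi
    exact j.2
  -- The values of a cycle on the darts leaving a vertex sum to zero, so they cannot be non-zero on
  -- exactly one dart. This makes the boundary a core set.
  · have aux : ∀ r x, h r x ≠ 0 → ∃ y, y ≠ x ∧ h r y ≠ 0 ∧ M.source y = M.source x := by
      intro r x hx
      by_contra! hcon
      have h0 := (hcyc r).2 (Pi.single (M.source x) 1)
      rw [Finset.sum_eq_single x] at h0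
      · simp at h0; exact hx h0
      · intro y _ hyx
        by_cases hy : h r y = 0
        · rw [hy, zero_mul]
        · rw [Pi.single_eq_of_ne (hcon y hyx hy), mul_zero]
      · simp
    intro r i hi
    simp only [Finset.mem_image, Finset.mem_filter, Finset.mem_univ, true_and] at hi
    obtain ⟨i, hi, rfl⟩ := hi
    constructor
    · obtain ⟨y, hyx, hy0, hsy⟩ := aux r _ hi
      obtain ⟨j, rfl | rfl⟩ := hsupp r y hy0
      · refine ⟨j, by simp [hy0], fun hji => hyx (by rw [Subtype.ext hji]), ?_⟩
        rw [hs, hs] at hsy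
        simpa using hv hsy
      · rw [ht, hs] at hsy
        simpa using hv hsy
    · obtain ⟨y, hyx, hy0, hsy⟩ := aux r _ ((hα r _).2 hi)
      obtain ⟨j, rfl | rfl⟩ := hsupp r y hy0
      · rw [ht, hs] at hsy
        simpa using hv hsy
      · refine ⟨j, by simp [(hα r _).1 hy0], fun hji => hyx (by rw [Subtype.ext hji]), ?_⟩
        rw [ht, ht] at hsy
        simpa using hv hsy
  · intro i
    by_cases hi : i ∈ F
    -- The two candidates are the regions on the two sides of the edge.
    · refine ⟨M.region P (ρ ⟨i, hi⟩), M.region P (M.α (ρ ⟨i, hi⟩)), fun r hr => ?_⟩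
      simp only [Finset.mem_image, Finset.mem_filter, Finset.mem_univ, true_and] at hr
      obtain ⟨j, hj, rfl⟩ := hr
      by_contra! hcon
      apply hj
      simp [h, Pi.single_eq_of_ne hcon.1.symm, Pi.single_eq_of_ne hcon.2.symm]
    · obtain ⟨x₀⟩ := hM.1
      refine ⟨M.region P x₀, M.region P x₀, fun r hr => ?_⟩
      simp only [Finset.mem_image] at hr
      obtain ⟨j, -, rfl⟩ := hr
      exact absurd j.2 hi

end CombinatorialMap

theorem finrank_circulations_le_of_embedsInGenus (F : Finset (α × β)) {g : ℕ}
    (h : (bipGraph F).EmbedsInGenus g) (L : ℕ) :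
    (L + 1) * Module.finrank ℚ (circulations F) ≤
      (L + 1) * (2 * g + 1 + 2 * (smallCores F L).card) + 2 * (multiEdges F).card := by
  obtain ⟨D, hD, M, hM, v, e, hv, he, hsrc, hsymm⟩ := h
  have := Fintype.ofFinite D
  let d : F → (bipGraph F).Dart := fun i =>
    ⟨(Sum.inl i.1.1, Sum.inr i.1.2), (bipGraph_adj_inl_inr F _ _).2 i.2⟩
  have hd : Function.Injective d := by
    intro i j hij
    have := congrArg (fun x : (bipGraph F).Dart => x.toProd) hij
    simp only [d, Prod.mk.injEq, Sum.inl.injEq, Sum.inr.injEq] at this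
    exact Subtype.ext (Prod.ext this.1 this.2)
  have hs : ∀ i, M.source (e (d i)) = v (Sum.inl i.1.1) := fun i => hsrc _
  have ht : ∀ i, M.source (M.α (e (d i))) = v (Sum.inr i.1.2) := fun i => by
    rw [← hsymm, hsrc]; rfl
  have hne : ∀ i j, e (d i) ≠ M.α (e (d j)) := by
    intro i j hij
    have := congrArg M.source hij
    rw [hs, ht] at this
    simpa using hv this
  have h1 := CombinatorialMap.finrank_circulations_le (fun i => e (d i)) (he.comp hd) hne v hs ht
  have h2 := CombinatorialMap.finrank_cycles_inf_supportedOn_le hM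
    (M.dartsOf fun i => e (d i))
  have h3 := CombinatorialMap.card_region_le hM.1 (fun i => e (d i)) v hv hs ht L
  have h4 := Nat.mul_le_mul_left (L + 1) (h1.trans h2)
  nlinarith [h3, h4]

end Bipartite

/-! ### Upper bound for the genus: parity of the Euler characteristic and rotation systems -/

theorem Equiv.Perm.card_cycles_add_card_support {D : Type} [Fintype D] [DecidableEq D]
    (π : Equiv.Perm D) :
    Nat.card (CombinatorialMap.Cycles π) + π.support.card =
      Multiset.card π.cycleType + Fintype.card D := by
  classical
  have hfin : Finite (CombinatorialMap.Cycles π) := Quotient.finite _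
  have := Fintype.ofFinite (CombinatorialMap.Cycles π)
  let mk : D → CombinatorialMap.Cycles π := Quotient.mk (Equiv.Perm.SameCycle.setoid π)
  have hmk : ∀ x y, mk x = mk y ↔ π.SameCycle x y := fun x y => Quotient.eq
  let f : CombinatorialMap.Cycles π → Equiv.Perm D :=
    Quotient.lift π.cycleOf fun x y (h : π.SameCycle x y) => h.cycleOf_eq
  have hf : ∀ x, f (mk x) = π.cycleOf x := fun x => rfl
  have h1 : (Finset.univ.filter fun q => f q ≠ 1).card = Multiset.card π.cycleType := by
    rw [Equiv.Perm.cycleType_def, Multiset.card_map, Finset.card_val]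
    refine Finset.card_bij (fun q _ => f q) ?_ ?_ ?_
    · intro q hq
      obtain ⟨x, rfl⟩ := Quotient.exists_rep q
      have hx : π.cycleOf x ≠ 1 := (Finset.mem_filter.1 hq).2
      change π.cycleOf x ∈ _
      rw [Equiv.Perm.cycleOf_mem_cycleFactorsFinset_iff, Equiv.Perm.mem_support]
      rwa [Ne, Equiv.Perm.cycleOf_eq_one_iff] at hx
    · intro q hq q' hq' h
      obtain ⟨x, rfl⟩ := Quotient.exists_rep q
      obtain ⟨y, rfl⟩ := Quotient.exists_rep q'
      have hx : π.cycleOf x ≠ 1 := (Finset.mem_filter.1 hq).2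
      have h' : π.cycleOf x = π.cycleOf y := h
      refine (hmk x y).2 ?_
      rw [Ne, Equiv.Perm.cycleOf_eq_one_iff] at hx
      have : x ∈ (π.cycleOf y).support := by
        rw [← h', Equiv.Perm.mem_support, Equiv.Perm.cycleOf_apply_self]
        exact hx
      exact (Equiv.Perm.mem_support_cycleOf_iff.1 this).1.symm
    · intro c hc
      obtain ⟨x, hx⟩ := (Equiv.Perm.mem_cycleFactorsFinset_iff.1 hc).1.nonempty_support
      have hcx := Equiv.Perm.cycle_is_cycleOf hx hc
      refine ⟨mk x, ?_, (hf x).trans hcx.symm⟩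
      rw [Finset.mem_filter, hf, ← hcx]
      exact ⟨Finset.mem_univ _, (Equiv.Perm.mem_cycleFactorsFinset_iff.1 hc).1.ne_one⟩
  have h2 : (Finset.univ.filter fun q => ¬ f q ≠ 1).card = (π.supportᶜ).card := by
    symm
    refine Finset.card_bij (fun x _ => mk x) ?_ ?_ ?_
    · intro x hx
      simp only [Finset.mem_compl, Equiv.Perm.mem_support, not_not] at hx
      simp [hf, Equiv.Perm.cycleOf_eq_one_iff, hx]
    · intro x hx y _ h
      simp only [Finset.mem_compl, Equiv.Perm.mem_support, not_not] at hx
      exact ((hmk x y).1 h).eq_of_left hx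
    · intro q hq
      obtain ⟨x, rfl⟩ := Quotient.exists_rep q
      have hx : ¬ π.cycleOf x ≠ 1 := (Finset.mem_filter.1 hq).2
      rw [not_not, Equiv.Perm.cycleOf_eq_one_iff] at hx
      exact ⟨x, by simpa using hx, rfl⟩
  have h3 := Finset.card_filter_add_card_filter_not (s := Finset.univ) (fun q => f q ≠ 1)
  rw [Finset.card_compl] at h2
  have h4 := Finset.card_le_univ π.support
  rw [Finset.card_univ] at h3
  rw [Nat.card_eq_fintype_card]
  omega

theorem Equiv.Perm.neg_one_pow_card_cycles {D : Type} [Fintype D] [DecidableEq D]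
    (π : Equiv.Perm D) :
    (-1 : ℤˣ) ^ Nat.card (CombinatorialMap.Cycles π) =
      Equiv.Perm.sign π * (-1) ^ Fintype.card D := by
  rw [Equiv.Perm.sign_of_cycleType, π.sum_cycleType, ← pow_add, add_assoc,
    ← π.card_cycles_add_card_support]
  rw [show π.support.card + (Nat.card (CombinatorialMap.Cycles π) + π.support.card) =
    Nat.card (CombinatorialMap.Cycles π) + 2 * π.support.card by ring, pow_add, pow_mul]
  simp

/-- Applied to the darts of a graph with `f` the initial vertex, this supplies a rotation system:
each fibre gets a cyclic order. -/
theorem Finite.exists_perm_sameCycle_iff {D V : Type} [Finite D] (f : D → V) :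
    ∃ σ : Equiv.Perm D, ∀ x y, σ.SameCycle x y ↔ f x = f y := by
  classical
  have := Fintype.ofFinite D
  choose c hc using fun v => (Finset.univ.filter fun x => f x = v).exists_cycleOn
  have hmaps : ∀ v (i : ℤ) x, f x = v → f ((c v ^ i) x) = v := by
    intro v i x hx
    have h1 : (c v ^ i) x ∈ ((Finset.univ.filter fun x => f x = v : Finset D) : Set D) :=
      ((hc v).1.1.perm_zpow i).mapsTo (by simpa using hx)
    simpa using h1
  let σ : Equiv.Perm D :=
    { toFun := fun x => c (f x) x
      invFun := fun x => (c (f x))⁻¹ x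
      left_inv := fun x => by
        have h := hmaps (f x) 1 x rfl
        rw [zpow_one] at h
        simp [h]
      right_inv := fun x => by
        have h := hmaps (f x) (-1) x rfl
        rw [zpow_neg_one] at h
        change c (f ((c (f x))⁻¹ x)) ((c (f x))⁻¹ x) = x
        rw [h]
        exact (c (f x)).apply_symm_apply x }
  have hσ : ∀ x, f (σ x) = f x := fun x => by
    have h := hmaps (f x) 1 x rfl
    rwa [zpow_one] at h
  have hpow : ∀ (n : ℕ) x, f ((σ ^ n) x) = f x ∧ (σ ^ n) x = (c (f x) ^ n) x := by
    intro n x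
    induction n with
    | zero => simp
    | succ n ih =>
      rw [pow_succ', pow_succ', Equiv.Perm.mul_apply, Equiv.Perm.mul_apply, hσ]
      refine ⟨ih.1, ?_⟩
      rw [← ih.2]
      change c (f ((σ ^ n) x)) _ = _
      rw [ih.1]
  refine ⟨σ, fun x y => ⟨fun h => ?_, fun h => ?_⟩⟩
  · obtain ⟨n, -, rfl⟩ := h.exists_pow_eq'
    exact (hpow n x).1.symm
  · obtain ⟨n, -, hn⟩ := ((hc (f y)).1.2 (x := x) (by simpa using h)
      (y := y) (by simp)).exists_pow_eq'
    refine ⟨n, ?_⟩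
    rw [zpow_natCast, (hpow n x).2, h, hn]

/-- The sign of a permutation is the parity of |D| minus its number of cycles. Since |D| is even,
multiplicativity of the sign on σ, α and σα makes V + E + F even. -/
theorem CombinatorialMap.even_eulerChar {D : Type} [Finite D] (M : CombinatorialMap D) :
    Even M.eulerChar := by
  classical
  have := Fintype.ofFinite D
  have h1 := M.σ.neg_one_pow_card_cycles
  have h2 := M.α.neg_one_pow_card_cycles
  have h3 := (M.σ * M.α).neg_one_pow_card_cycles
  -- `α` is an involution without fixed points.
  have hD : Even (Fintype.card D) := by
    have h := Equiv.Perm.card_compl_support_modEq (σ := M.α) (p := 2) (n := 1)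
      (by rw [pow_one, pow_two, M.α_mul_self])
    have h0 : M.α.supportᶜ = ∅ := by ext x; simp [M.α_ne]
    rw [h0, Finset.card_empty] at h
    exact even_iff_two_dvd.2 ((Nat.modEq_zero_iff_dvd).1 h.symm)
  rw [hD.neg_one_pow, mul_one] at h1 h2 h3
  have h4 : (-1 : ℤˣ) ^ (Nat.card M.Vertex + Nat.card M.Edge + Nat.card M.Face) = 1 := by
    rw [pow_add, pow_add]
    change (-1 : ℤˣ) ^ Nat.card (Cycles M.σ) * (-1 : ℤˣ) ^ Nat.card (Cycles M.α) *
      (-1 : ℤˣ) ^ Nat.card (Cycles (M.σ * M.α)) = 1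
    rw [h1, h2, h3, Equiv.Perm.sign_mul]
    exact Int.units_mul_self _
  have h5 : Even (Nat.card M.Vertex + Nat.card M.Edge + Nat.card M.Face) := by
    by_contra hodd
    rw [Nat.not_even_iff_odd] at hodd
    rw [hodd.neg_one_pow] at h4
    exact absurd h4 (by decide)
  unfold eulerChar
  obtain ⟨k, hk⟩ := h5
  exact ⟨k - Nat.card M.Edge, by omega⟩

namespace SimpleGraph

variable {V : Type}

theorem EmbedsInGenus.mono {G G' : SimpleGraph V} (h : G ≤ G') {g : ℕ}
    (hG : G'.EmbedsInGenus g) : G.EmbedsInGenus g := by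
  obtain ⟨D, hD, M, hM, v, e, hv, he, hs, hα⟩ := hG
  let d : G.Dart → G'.Dart := fun a => ⟨a.toProd, h a.adj⟩
  have hd : Function.Injective d := fun a b hab => by
    ext1
    exact congrArg (fun x : G'.Dart => x.toProd) hab
  exact ⟨D, hD, M, hM, v, fun a => e (d a), hv, he.comp hd, fun a => hs _, fun a => hα (d a)⟩

/-- Any rotation system will do: with at least one face, 2 − 2g ≥ V − E + 1. Nontriviality of `V`
gives every vertex a dart, so no vertex of the graph is missing from the map. -/
theorem Connected.exists_embedsInGenus [Finite V] [Nontrivial V] {G : SimpleGraph V}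
    (hG : G.Connected) :
    ∃ g : ℕ, G.EmbedsInGenus g ∧ 2 * g + Nat.card V ≤ Nat.card G.edgeSet + 1 := by
  classical
  have := Fintype.ofFinite V
  obtain ⟨σ, hσ⟩ := Finite.exists_perm_sameCycle_iff (fun a : G.Dart => a.fst)
  obtain ⟨M, hσ, hα⟩ : ∃ M : CombinatorialMap G.Dart,
      (∀ a b, M.σ.SameCycle a b ↔ a.fst = b.fst) ∧ ∀ a, M.α a = a.symm :=
    ⟨{  σ := σ
        α := ⟨Dart.symm, Dart.symm, Dart.symm_symm, Dart.symm_symm⟩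
        α_α := Dart.symm_symm
        α_ne := Dart.symm_ne }, hσ, fun _ => rfl⟩
  have hsrc : ∀ a b, M.source a = M.source b ↔ a.fst = b.fst := fun a b => by
    rw [← hσ]; exact Quotient.eq
  have hout : ∀ u, ∃ a : G.Dart, a.fst = u := fun u => by
    obtain ⟨w, hw⟩ := hG.preconnected.exists_adj_of_nontrivial u
    exact ⟨⟨(u, w), hw⟩, rfl⟩
  choose dart hdart using hout
  have hne : Nonempty G.Dart := ⟨dart hG.nonempty.some⟩
  have hconn : M.IsConnected := by
    refine ⟨hne, fun x y => ?_⟩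
    have hσ' : M.σ ∈ Subgroup.closure {M.σ, M.α} := Subgroup.subset_closure (by simp)
    have hα' : M.α ∈ Subgroup.closure {M.σ, M.α} := Subgroup.subset_closure (by simp)
    have hrot : ∀ a b : G.Dart, a.fst = b.fst →
        (∃ π ∈ Subgroup.closure {M.σ, M.α}, π x = a) →
        ∃ π ∈ Subgroup.closure {M.σ, M.α}, π x = b := by
      rintro a b hab ⟨π, hπ, rfl⟩
      obtain ⟨i, hi⟩ := (hσ _ _).2 hab
      exact ⟨M.σ ^ i * π, mul_mem (Subgroup.zpow_mem _ hσ' i) hπ, hi⟩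
    have key : ∀ w, G.Reachable x.fst w →
        ∃ π ∈ Subgroup.closure {M.σ, M.α}, (π x).fst = w := by
      intro w hw
      rw [reachable_iff_reflTransGen] at hw
      induction hw with
      | refl => exact ⟨1, one_mem _, rfl⟩
      | @tail u w _ huw ih =>
        obtain ⟨π, hπ, hu⟩ := ih
        obtain ⟨π', hπ', h'⟩ := hrot (π x) ⟨(u, w), huw⟩ hu ⟨π, hπ, rfl⟩
        refine ⟨M.α * π', mul_mem hα' hπ', ?_⟩
        rw [Equiv.Perm.mul_apply, h', hα]
        rfl
    obtain ⟨π, hπ, h⟩ := key y.fst (hG.preconnected _ _)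
    exact hrot _ _ h ⟨π, hπ, rfl⟩
  have hV : Nat.card M.Vertex = Nat.card V := by
    refine Nat.card_congr (Equiv.ofBijective
      (Quotient.lift (fun a : G.Dart => a.fst) fun a b h => (hσ a b).1 h) ⟨?_, ?_⟩)
    · intro p q h
      obtain ⟨a, rfl⟩ := Quotient.exists_rep p
      obtain ⟨b, rfl⟩ := Quotient.exists_rep q
      exact (hsrc a b).2 h
    · intro u
      exact ⟨M.source (dart u), hdart u⟩
  have hE : Nat.card M.Edge = Nat.card G.edgeSet := by
    have hsc : ∀ a b, M.α.SameCycle a b ↔ a.edge = b.edge := fun a b => by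
      rw [M.sameCycle_α_iff, hα, dart_edge_eq_iff]
      constructor
      · rintro (rfl | rfl) <;> simp
      · rintro (rfl | rfl) <;> simp
    refine Nat.card_congr (Equiv.ofBijective
      (Quotient.lift (fun a : G.Dart => (⟨a.edge, a.edge_mem⟩ : G.edgeSet))
        fun a b h => Subtype.ext ((hsc a b).1 h)) ⟨?_, ?_⟩)
    · intro p q h
      obtain ⟨a, rfl⟩ := Quotient.exists_rep p
      obtain ⟨b, rfl⟩ := Quotient.exists_rep q
      exact Quotient.sound ((hsc a b).2 (congrArg Subtype.val h))
    · rintro ⟨e, he⟩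
      induction e using Sym2.ind with
      | _ u w =>
        exact ⟨Quotient.mk (Equiv.Perm.SameCycle.setoid M.α) ⟨(u, w), he⟩, rfl⟩
  have hF : 1 ≤ Nat.card M.Face := by
    have : Nonempty M.Face := hne.map M.face
    exact Nat.card_pos
  have h2 := CombinatorialMap.eulerChar_le_two hconn
  obtain ⟨k, hk⟩ := M.even_eulerChar
  -- The Euler characteristic is 2k ≤ 2, so 1 − k is non-negative and `toNat` loses nothing.
  refine ⟨(1 - k).toNat, ⟨G.Dart, inferInstance, M, ⟨hconn, ?_⟩, ?_⟩, ?_⟩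
  · omega
  · refine ⟨fun u => M.source (dart u), id, fun u w h => ?_, Function.injective_id,
      fun a => ?_, fun a => (hα a).symm⟩
    · simpa [hdart] using (hsrc _ _).1 h
    · exact (hsrc _ _).2 (hdart _).symm
  · unfold CombinatorialMap.eulerChar at hk h2
    omega

/-- One new edge from a fixed vertex to a representative of every other component suffices. -/
theorem exists_connected_ge [Finite V] [Nonempty V] (G : SimpleGraph V) :
    ∃ G' : SimpleGraph V, G ≤ G' ∧ G'.Connected ∧
      Nat.card G'.edgeSet + 1 ≤ Nat.card G.edgeSet + Nat.card G.ConnectedComponent := by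
  classical
  have := Fintype.ofFinite V
  have hr : Nonempty V := inferInstance
  obtain ⟨r⟩ := hr
  let S : Set (Sym2 V) := (fun c : G.ConnectedComponent => s(r, c.out)) ''
    {c | c ≠ G.connectedComponentMk r}
  refine ⟨G ⊔ fromEdgeSet S, le_sup_left, ?_, ?_⟩
  · have hreach : ∀ u, (G ⊔ fromEdgeSet S).Reachable r u := by
      intro u
      set c := G.connectedComponentMk u with hc
      have h1 : (G ⊔ fromEdgeSet S).Reachable c.out u := by
        have : G.Reachable c.out u := ConnectedComponent.exact (Quot.out_eq c)
        exact this.mono le_sup_left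
      by_cases hcr : c = G.connectedComponentMk r
      · have : G.Reachable r u := ConnectedComponent.exact hcr.symm
        exact this.mono le_sup_left
      · refine Reachable.trans ?_ h1
        by_cases h : r = c.out
        · rw [← h]
        · refine Adj.reachable (Or.inr ?_)
          rw [fromEdgeSet_adj]
          exact ⟨⟨c, hcr, rfl⟩, h⟩
    exact { preconnected := fun u w => (hreach u).symm.trans (hreach w), nonempty := ⟨r⟩ }
  · have h1 : (G ⊔ fromEdgeSet S).edgeSet ⊆ G.edgeSet ∪ S := by
      rw [edgeSet_sup, edgeSet_fromEdgeSet]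
      exact Set.union_subset_union_right _ Set.sdiff_subset
    have h2 : S.ncard + 1 ≤ Nat.card G.ConnectedComponent := by
      have h3 : S.ncard ≤ {c | c ≠ G.connectedComponentMk r}.ncard :=
        Set.ncard_image_le (Set.toFinite _)
      have h4 := Set.ncard_add_ncard_compl {c | c ≠ G.connectedComponentMk r}
      have h5 : {c | c ≠ G.connectedComponentMk r}ᶜ = {G.connectedComponentMk r} := by
        ext; simp
      rw [h5, Set.ncard_singleton] at h4
      omega
    have h6 := Set.ncard_le_ncard h1 (Set.toFinite _)
    have h7 := Set.ncard_union_le G.edgeSet S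
    rw [Nat.card_coe_set_eq, Nat.card_coe_set_eq]
    omega

theorem exists_embedsInGenus [Finite V] [Nontrivial V] (G : SimpleGraph V) :
    ∃ g : ℕ, G.EmbedsInGenus g ∧
      2 * g + Nat.card V ≤ Nat.card G.edgeSet + Nat.card G.ConnectedComponent := by
  obtain ⟨G', hle, hconn, hcard⟩ := G.exists_connected_ge
  obtain ⟨g, hg, h⟩ := hconn.exists_embedsInGenus
  exact ⟨g, hg.mono hle, by omega⟩

/-- Existence of some embedding matters here: the infimum of the empty set would be 0 without being
attained. -/
theorem embedsInGenus_genus [Finite V] [Nontrivial V] (G : SimpleGraph V) :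
    G.EmbedsInGenus G.genus := by
  obtain ⟨g, hg, -⟩ := G.exists_embedsInGenus
  exact Nat.sInf_mem (s := {g | G.EmbedsInGenus g}) ⟨g, hg⟩

theorem two_mul_genus_add_card_le [Finite V] [Nontrivial V] (G : SimpleGraph V) :
    2 * G.genus + Nat.card V ≤ Nat.card G.edgeSet + Nat.card G.ConnectedComponent := by
  obtain ⟨g, hg, h⟩ := G.exists_embedsInGenus
  have : G.genus ≤ g := Nat.sInf_le hg
  omega

end SimpleGraph

/-! ### The cyclomatic number and the components of the projection -/

namespace SimpleGraph

variable {V : Type}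

/-- The functions on the vertices that are constant along edges. -/
def locallyConstant (G : SimpleGraph V) : Submodule ℚ (V → ℚ) where
  carrier := {g | ∀ u w, G.Adj u w → g u = g w}
  add_mem' hf hg u w h := by simp [hf u w h, hg u w h]
  zero_mem' := by simp
  smul_mem' c f hf u w h := by simp [hf u w h]

theorem finrank_locallyConstant [Finite V] (G : SimpleGraph V) :
    Module.finrank ℚ G.locallyConstant = Nat.card G.ConnectedComponent := by
  have := Fintype.ofFinite G.ConnectedComponent
  have hconst : ∀ g ∈ G.locallyConstant, ∀ u w, G.Reachable u w → g u = g w := by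
    intro g hg u w h
    rw [reachable_iff_reflTransGen] at h
    induction h with
    | refl => rfl
    | tail _ h ih => exact ih.trans (hg _ _ h)
  let φ : (G.ConnectedComponent → ℚ) ≃ₗ[ℚ] G.locallyConstant :=
    { toFun := fun f => ⟨fun u => f (G.connectedComponentMk u), fun u w h => by
        exact congrArg f (ConnectedComponent.sound h.reachable)⟩
      map_add' := fun _ _ => rfl
      map_smul' := fun _ _ => rfl
      invFun := fun g => Quot.lift g.1 (hconst g.1 g.2)
      left_inv := fun f => by
        ext c
        obtain ⟨u, rfl⟩ := Quot.exists_rep c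
        rfl
      right_inv := fun g => rfl }
  rw [← φ.finrank_eq, Module.finrank_fintype_fun_eq_card, Nat.card_eq_fintype_card]

end SimpleGraph

section Pairs

variable {α : Type}

/-- The two-element subsets of a finite set. -/
noncomputable def pairs (I : Finset α) : Finset (Sym2 α) := by
  classical exact I.sym2.filter fun e => ¬ e.IsDiag

@[simp] theorem mk_mem_pairs {I : Finset α} {a b : α} :
    s(a, b) ∈ pairs I ↔ (a ∈ I ∧ b ∈ I) ∧ a ≠ b := by
  simp [pairs]

/-- The number of connected components of the graph with edge set `A`. -/
noncomputable def comps (A : Finset (Sym2 α)) : ℕ :=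
  Nat.card (SimpleGraph.fromEdgeSet (A : Set (Sym2 α))).ConnectedComponent

end Pairs

section Bipartite

variable {α β : Type} [Fintype α]

/-- The left neighbours of a right vertex. -/
noncomputable def leftNbrs (F : Finset (α × β)) (b : β) : Finset α := by
  classical exact Finset.univ.filter fun a => (a, b) ∈ F

@[simp] theorem mem_leftNbrs {F : Finset (α × β)} {b : β} {a : α} :
    a ∈ leftNbrs F b ↔ (a, b) ∈ F := by
  simp [leftNbrs]

variable [Fintype β]

theorem sum_card_leftNbrs (F : Finset (α × β)) : ∑ b, (leftNbrs F b).card = F.card := by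
  classical
  have h : F.card = ∑ b, (F.filter fun i => i.2 = b).card :=
    Finset.card_eq_sum_card_fiberwise (f := Prod.snd) (t := Finset.univ) (fun _ _ => by simp)
  rw [h]
  refine Finset.sum_congr rfl fun b _ => ?_
  refine Finset.card_bij (fun a _ => (a, b)) ?_ ?_ ?_
  · intro a ha; simpa using ha
  · intro a _ a' _ h; simpa using h
  · rintro ⟨a, b'⟩ h
    obtain ⟨h, rfl⟩ : (a, b') ∈ F ∧ b' = b := by simpa using h
    exact ⟨a, by simpa using h, rfl⟩

/-- The pairs of left vertices with a common neighbour. -/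
noncomputable def projection (F : Finset (α × β)) : Finset (Sym2 α) := by
  classical exact Finset.univ.biUnion fun b => pairs (leftNbrs F b)

/-- Row rank equals column rank for the signed incidence matrix: one kernel is the space of locally
constant functions, the other the cycle space. -/
theorem finrank_circulations_add_card (F : Finset (α × β)) :
    Module.finrank ℚ (circulations F) + (Fintype.card α + Fintype.card β) =
      F.card + Module.finrank ℚ (bipGraph F).locallyConstant := by
  classical
  let N : Matrix F (α ⊕ β) ℚ := fun i v =>
    (if Sum.inl i.1.1 = v then 1 else 0) - (if Sum.inr i.1.2 = v then 1 else 0)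
  have h1 := LinearMap.finrank_range_add_finrank_ker N.mulVecLin
  have h2 := LinearMap.finrank_range_add_finrank_ker N.transpose.mulVecLin
  have h3 : Module.finrank ℚ (LinearMap.range N.transpose.mulVecLin) =
      Module.finrank ℚ (LinearMap.range N.mulVecLin) := Matrix.rank_transpose N
  rw [Module.finrank_fintype_fun_eq_card] at h1 h2
  have h4 : LinearMap.ker N.mulVecLin = (bipGraph F).locallyConstant := by
    ext g
    rw [LinearMap.mem_ker]
    have hval : ∀ i, N.mulVecLin g i = g (Sum.inl i.1.1) - g (Sum.inr i.1.2) := by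
      intro i
      change ∑ v, ((if Sum.inl i.1.1 = v then (1 : ℚ) else 0) -
        (if Sum.inr i.1.2 = v then 1 else 0)) * g v = _
      simp only [sub_mul, Finset.sum_sub_distrib, ite_mul, one_mul, zero_mul,
        Finset.sum_ite_eq, Finset.mem_univ, if_true]
    constructor
    · intro h
      have hg : ∀ a b, (a, b) ∈ F → g (Sum.inl a) = g (Sum.inr b) := fun a b hab => by
        have := congrFun h ⟨(a, b), hab⟩
        rw [hval] at this
        exact sub_eq_zero.1 this
      rintro (a | b) (a' | b') hadj
      · simp at hadj
      · exact hg _ _ (by simpa using hadj)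
      · exact (hg _ _ (by simpa using hadj)).symm
      · simp at hadj
    · intro h
      ext i
      rw [hval, Pi.zero_apply, sub_eq_zero]
      exact h _ _ (by simp)
  have hval : ∀ (w : F → ℚ) v, N.transpose.mulVecLin w v =
      ∑ i : F, ((if Sum.inl i.1.1 = v then 1 else 0) -
        (if Sum.inr i.1.2 = v then 1 else 0)) * w i := by
    intro w v
    rfl
  have hext : ∀ (w : α × β → ℚ), (∀ i, i ∉ F → w i = 0) → ∀ v,
      N.transpose.mulVecLin (fun i => w i) v =
      ∑ i : α × β, ((if Sum.inl i.1 = v then 1 else 0) -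
        (if Sum.inr i.2 = v then 1 else 0)) * w i := by
    intro w hw v
    rw [hval, Finset.sum_coe_sort F (fun i : α × β => ((if Sum.inl i.1 = v then (1 : ℚ) else 0) -
        (if Sum.inr i.2 = v then 1 else 0)) * w i)]
    exact Finset.sum_subset (Finset.subset_univ F) fun i _ hi => by rw [hw i hi, mul_zero]
  have hinl : ∀ (w : α × β → ℚ) a, ∑ i : α × β, ((if Sum.inl i.1 = (Sum.inl a : α ⊕ β) then
      (1 : ℚ) else 0) - (if Sum.inr i.2 = (Sum.inl a : α ⊕ β) then 1 else 0)) * w i =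
      ∑ b, w (a, b) := by
    intro w a
    rw [Fintype.sum_prod_type_right]
    simp
  have hinr : ∀ (w : α × β → ℚ) b, ∑ i : α × β, ((if Sum.inl i.1 = (Sum.inr b : α ⊕ β) then
      (1 : ℚ) else 0) - (if Sum.inr i.2 = (Sum.inr b : α ⊕ β) then 1 else 0)) * w i =
      - ∑ a, w (a, b) := by
    intro w b
    rw [Fintype.sum_prod_type]
    simp
  let φ : circulations F ≃ₗ[ℚ] LinearMap.ker N.transpose.mulVecLin :=
    { toFun := fun w => ⟨fun i => w.1 i, by
        obtain ⟨w, hw0, hw1, hw2⟩ := w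
        rw [LinearMap.mem_ker]
        ext v
        rw [hext w hw0]
        rcases v with a | b
        · rw [hinl, hw1]; rfl
        · rw [hinr, hw2]; simp⟩
      map_add' := fun _ _ => rfl
      map_smul' := fun _ _ => rfl
      invFun := fun w => ⟨fun i => if h : i ∈ F then w.1 ⟨i, h⟩ else 0, by
        obtain ⟨w, hw⟩ := w
        rw [LinearMap.mem_ker] at hw
        set w' : α × β → ℚ := fun i => if h : i ∈ F then w ⟨i, h⟩ else 0 with hw'
        have h0 : ∀ i, i ∉ F → w' i = 0 := fun i hi => by simp [hw', hi]
        have h1 : (fun i : F => w' i) = w := by ext i; simp [hw']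
        refine ⟨h0, fun a => ?_, fun b => ?_⟩
        · have := hext w' h0 (Sum.inl a)
          rw [h1, hw, hinl] at this
          exact this.symm
        · have := hext w' h0 (Sum.inr b)
          rw [h1, hw, hinr] at this
          exact neg_eq_zero.1 this.symm⟩
      left_inv := fun w => by
        ext i
        by_cases hi : i ∈ F
        · simp [hi]
        · simp [hi, w.2.1 i hi]
      right_inv := fun w => by
        ext i
        simp }
  rw [φ.finrank_eq, ← h4]
  rw [Fintype.card_coe] at h2
  rw [Fintype.card_sum] at h1
  omega

/-- A locally constant function is determined by its values on the left class, where it is locally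
constant on the projection, and by free values at the isolated right vertices. -/
theorem finrank_locallyConstant_bipGraph (F : Finset (α × β)) :
    Module.finrank ℚ (bipGraph F).locallyConstant =
      comps (projection F) + Nat.card {b : β // leftNbrs F b = ∅} := by
  classical
  rw [comps, ← SimpleGraph.finrank_locallyConstant]
  set K := SimpleGraph.fromEdgeSet (projection F : Set (Sym2 α)) with hK
  have hadj : ∀ b, ∀ a ∈ leftNbrs F b, ∀ a' ∈ leftNbrs F b, ∀ g ∈ K.locallyConstant,
      g a = g a' := by
    intro b a ha a' ha' g hg
    by_cases h : a = a'
    · rw [h]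
    · apply hg
      rw [hK, SimpleGraph.fromEdgeSet_adj]
      refine ⟨?_, h⟩
      simp only [projection, Finset.coe_biUnion, Set.mem_iUnion]
      exact ⟨b, by simp, by simpa [h] using ⟨by simpa using ha, by simpa using ha'⟩⟩
  -- A right vertex that is not isolated copies the value of some left neighbour; the choice is
  -- harmless because its neighbours form a clique in the projection.
  let ext : (α → ℚ) → ({b : β // leftNbrs F b = ∅} → ℚ) → α ⊕ β → ℚ := fun g f =>
    Sum.elim g fun b => if h : leftNbrs F b = ∅ then f ⟨b, h⟩
      else g (Finset.nonempty_iff_ne_empty.2 h).choose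
  have hext : ∀ g ∈ K.locallyConstant, ∀ f, ext g f ∈ (bipGraph F).locallyConstant := by
    intro g hg f
    have key : ∀ a b, (a, b) ∈ F → ext g f (Sum.inl a) = ext g f (Sum.inr b) := by
      intro a b hab
      have hab' : a ∈ leftNbrs F b := by simpa using hab
      have hne : leftNbrs F b ≠ ∅ := Finset.ne_empty_of_mem hab'
      simp only [ext, Sum.elim_inl, Sum.elim_inr, hne, dite_false]
      exact hadj b _ hab' _ (Finset.nonempty_iff_ne_empty.2 hne).choose_spec g hg
    rintro (a | b) (a' | b') h
    · simp at h
    · exact key _ _ (by simpa using h)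
    · exact (key _ _ (by simpa using h)).symm
    · simp at h
  let φ : (bipGraph F).locallyConstant ≃ₗ[ℚ]
      K.locallyConstant × ({b : β // leftNbrs F b = ∅} → ℚ) :=
    { toFun := fun g => (⟨fun a => g.1 (Sum.inl a), by
        intro a a' h
        rw [hK, SimpleGraph.fromEdgeSet_adj] at h
        simp only [projection, Finset.coe_biUnion, Set.mem_iUnion] at h
        obtain ⟨⟨b, -, hb⟩, -⟩ := h
        rw [Finset.mem_coe, mk_mem_pairs, mem_leftNbrs, mem_leftNbrs] at hb
        change g.1 _ = g.1 _
        rw [g.2 (Sum.inl a) (Sum.inr b) (by simpa using hb.1.1),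
          g.2 (Sum.inl a') (Sum.inr b) (by simpa using hb.1.2)]⟩, fun b => g.1 (Sum.inr b.1))
      map_add' := fun _ _ => rfl
      map_smul' := fun _ _ => rfl
      invFun := fun p => ⟨ext p.1.1 p.2, hext _ p.1.2 _⟩
      left_inv := fun g => by
        ext v
        rcases v with a | b
        · rfl
        · simp only [ext, Sum.elim_inr]
          split_ifs with h
          · rfl
          · refine g.2 _ _ ?_
            have := (Finset.nonempty_iff_ne_empty.2 h).choose_spec
            simpa using this
      right_inv := fun p => by
        ext x
        · rfl
        · simp [ext, x.2] }
  rw [φ.finrank_eq, Module.finrank_prod, Module.finrank_fintype_fun_eq_card,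
    Nat.card_eq_fintype_card]

theorem finrank_circulations (F : Finset (α × β)) :
    Module.finrank ℚ (circulations F) + Fintype.card α =
      ∑ b, ((leftNbrs F b).card - 1) + comps (projection F) := by
  classical
  have h1 := finrank_circulations_add_card F
  rw [finrank_locallyConstant_bipGraph] at h1
  -- Truncated subtraction gives 0 instead of −1 at isolated right vertices, and the last term
  -- compensates.
  have h2 : ∑ b, ((leftNbrs F b).card - 1) + Fintype.card β =
      F.card + Nat.card {b : β // leftNbrs F b = ∅} := by
    rw [← sum_card_leftNbrs, Nat.card_eq_fintype_card, Fintype.card_subtype, Finset.card_filter,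
      ← Finset.sum_add_distrib, ← Finset.card_univ, Finset.card_eq_sum_ones,
      ← Finset.sum_add_distrib]
    refine Finset.sum_congr rfl fun b _ => ?_
    by_cases h : leftNbrs F b = ∅
    · simp [h]
    · have := Finset.card_pos.2 (Finset.nonempty_iff_ne_empty.2 h)
      simp [h]
      omega
  omega

theorem two_mul_genus_le (F : Finset (α × β)) [Nontrivial (α ⊕ β)] :
    2 * (bipGraph F).genus ≤ Module.finrank ℚ (circulations F) := by
  classical
  have h1 := finrank_circulations_add_card F
  have h2 := (bipGraph F).two_mul_genus_add_card_le
  rw [SimpleGraph.finrank_locallyConstant] at h1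
  have h3 : Nat.card (bipGraph F).edgeSet = F.card := by
    rw [bipGraph, SimpleGraph.edgeSet_fromEdgeSet, sdiff_eq_left.2, Nat.card_coe_set_eq,
      Set.ncard_image_of_injective, Set.ncard_coe_finset]
    · rintro ⟨a, b⟩ ⟨a', b'⟩ h
      simpa using h
    · rw [Set.disjoint_left]
      rintro _ ⟨i, -, rfl⟩
      simp
  rw [Nat.card_sum, Nat.card_eq_fintype_card, Nat.card_eq_fintype_card] at h2
  omega

theorem circulations_mono {F F' : Finset (α × β)} (h : F ⊆ F') :
    circulations F ≤ circulations F' :=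
  fun _ hw => ⟨fun i hi => hw.1 i fun hi' => hi (h hi'), hw.2⟩

variable [DecidableEq α] [DecidableEq β]

theorem finrank_circulations_insert_le (F : Finset (α × β)) (i : α × β) :
    Module.finrank ℚ (circulations (insert i F)) ≤ Module.finrank ℚ (circulations F) + 1 := by
  let ev : circulations (insert i F) →ₗ[ℚ] ℚ :=
    (LinearMap.proj i).comp (circulations (insert i F)).subtype
  have h1 := LinearMap.finrank_range_add_finrank_ker ev
  have h2 : Module.finrank ℚ (LinearMap.range ev) ≤ 1 :=
    (Submodule.finrank_le _).trans (Module.finrank_self ℚ).le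
  let ι : LinearMap.ker ev →ₗ[ℚ] circulations F :=
    ((circulations (insert i F)).subtype.comp (LinearMap.ker ev).subtype).codRestrict _ (by
      rintro ⟨⟨w, hw⟩, h0⟩
      refine ⟨fun j hj => ?_, hw.2⟩
      by_cases hji : j = i
      · rw [hji]; exact h0
      · exact hw.1 j (by simp [hji, hj]))
  have hι : Function.Injective ι := fun w w' h =>
    Subtype.ext (Subtype.ext (congrArg (fun x : circulations F => x.1) h))
  have h3 := LinearMap.finrank_le_finrank_of_injective hι
  omega

/-- The edge `i` is the only one at its right endpoint, so conservation there forces `w i = 0`. This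
keeps the variance of `betti` down to order n₁. -/
theorem circulations_insert_eq (F : Finset (α × β)) (i : α × β) (h : ∀ j ∈ F, j.2 ≠ i.2) :
    circulations (insert i F) = circulations F := by
  refine le_antisymm (fun w hw => ⟨fun j hj => ?_, hw.2⟩)
    (circulations_mono (Finset.subset_insert _ _))
  by_cases hji : j = i
  · subst hji
    have h1 := hw.2.2 j.2
    rwa [Finset.sum_eq_single j.1] at h1
    · intro a _ ha
      refine hw.1 _ fun hmem => ?_
      rcases Finset.mem_insert.1 hmem with h2 | h2
      · exact ha (congrArg Prod.fst h2)
      · exact h _ h2 rfl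
    · simp
  · exact hw.1 j (by simp [hji, hj])

end Bipartite

/-! ### Expectations over binomial random subsets -/

section Expectation

variable {ι κ : Type*}

/-- The expectation of `f A` for a random subset `A` of `E` that contains each element
independently with probability `p`. -/
noncomputable def subsetExp (p : ℝ) (E : Finset ι) (f : Finset ι → ℝ) : ℝ :=
  ∑ A ∈ E.powerset, p ^ A.card * (1 - p) ^ (E.card - A.card) * f A

variable {p : ℝ} {E : Finset ι} {f g : Finset ι → ℝ}

@[simp] theorem subsetExp_empty : subsetExp p ∅ f = f ∅ := by simp [subsetExp]

theorem subsetExp_congr (h : ∀ A ⊆ E, f A = g A) : subsetExp p E f = subsetExp p E g :=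
  Finset.sum_congr rfl fun A hA => by rw [h A (Finset.mem_powerset.1 hA)]

theorem subsetExp_mono (h0 : 0 ≤ p) (h1 : p ≤ 1) (h : ∀ A ⊆ E, f A ≤ g A) :
    subsetExp p E f ≤ subsetExp p E g :=
  Finset.sum_le_sum fun A hA => mul_le_mul_of_nonneg_left (h A (Finset.mem_powerset.1 hA))
    (mul_nonneg (pow_nonneg h0 _) (pow_nonneg (by linarith) _))

theorem subsetExp_add :
    subsetExp p E (fun A => f A + g A) = subsetExp p E f + subsetExp p E g := by
  simp [subsetExp, mul_add, Finset.sum_add_distrib]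

theorem subsetExp_sub :
    subsetExp p E (fun A => f A - g A) = subsetExp p E f - subsetExp p E g := by
  simp [subsetExp, mul_sub, Finset.sum_sub_distrib]

theorem subsetExp_const_mul (c : ℝ) :
    subsetExp p E (fun A => c * f A) = c * subsetExp p E f := by
  simp only [subsetExp, Finset.mul_sum]
  exact Finset.sum_congr rfl fun A _ => by ring

theorem subsetExp_sum {s : Finset κ} {f : κ → Finset ι → ℝ} :
    subsetExp p E (fun A => ∑ k ∈ s, f k A) = ∑ k ∈ s, subsetExp p E (f k) := by
  simp only [subsetExp, Finset.mul_sum]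
  exact Finset.sum_comm

theorem subsetExp_insert [DecidableEq ι] {e : ι} (he : e ∉ E) :
    subsetExp p (insert e E) f =
      (1 - p) * subsetExp p E f + p * subsetExp p E fun A => f (insert e A) := by
  rw [subsetExp, Finset.sum_powerset_insert he, ← subsetExp_const_mul, ← subsetExp_const_mul]
  congr 1
  · refine Finset.sum_congr rfl fun A hA => ?_
    have h := Finset.card_le_card (Finset.mem_powerset.1 hA)
    rw [Finset.card_insert_of_notMem he, Nat.succ_sub h, pow_succ]
    ring
  · refine Finset.sum_congr rfl fun A hA => ?_
    have h : e ∉ A := fun h' => he (Finset.mem_powerset.1 hA h')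
    rw [Finset.card_insert_of_notMem he, Finset.card_insert_of_notMem h, Nat.add_sub_add_right]
    ring

@[simp] theorem subsetExp_const (c : ℝ) : subsetExp p E (fun _ => c) = c := by
  classical
  induction E using Finset.induction_on with
  | empty => simp
  | insert e E he ih => rw [subsetExp_insert he, ih]; ring

theorem subsetExp_nonneg (h0 : 0 ≤ p) (h1 : p ≤ 1) (h : ∀ A ⊆ E, 0 ≤ f A) :
    0 ≤ subsetExp p E f := by
  have := subsetExp_mono h0 h1 h
  rwa [subsetExp_const] at this

theorem abs_subsetExp_le (h0 : 0 ≤ p) (h1 : p ≤ 1) (h : ∀ A ⊆ E, |f A| ≤ g A) :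
    |subsetExp p E f| ≤ subsetExp p E g := by
  rw [abs_le]
  constructor
  · have := subsetExp_mono h0 h1 (E := E) (f := fun A => (-1) * g A) (g := f)
      fun A hA => by linarith [(abs_le.1 (h A hA)).1]
    rw [subsetExp_const_mul] at this
    linarith
  · exact subsetExp_mono h0 h1 fun A hA => (abs_le.1 (h A hA)).2

theorem sq_subsetExp_le (h0 : 0 ≤ p) (h1 : p ≤ 1) :
    subsetExp p E f ^ 2 ≤ subsetExp p E fun A => f A ^ 2 := by
  set m := subsetExp p E f
  have h := subsetExp_nonneg h0 h1 (E := E) (f := fun A => f A ^ 2 - (2 * m) * f A + m ^ 2)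
    fun A _ => by nlinarith [sq_nonneg (f A - m)]
  rw [subsetExp_add, subsetExp_sub, subsetExp_const_mul, subsetExp_const] at h
  nlinarith

theorem subsetExp_union [DecidableEq ι] {E' : Finset ι} (h : Disjoint E E') :
    subsetExp p (E ∪ E') f = subsetExp p E fun A => subsetExp p E' fun B => f (A ∪ B) := by
  induction E using Finset.induction_on generalizing f with
  | empty => simp
  | insert e E he ih =>
    rw [Finset.disjoint_insert_left] at h
    rw [Finset.insert_union, subsetExp_insert (by simp [he, h.1]), subsetExp_insert he,
      ih h.2, ih h.2]
    simp only [Finset.insert_union]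

theorem subsetExp_image [DecidableEq κ] {φ : ι → κ} (hφ : Function.Injective φ)
    {f : Finset κ → ℝ} :
    subsetExp p (E.image φ) f = subsetExp p E fun A => f (A.image φ) := by
  classical
  induction E using Finset.induction_on generalizing f with
  | empty => simp
  | insert e E he ih =>
    rw [Finset.image_insert, subsetExp_insert, subsetExp_insert he, ih, ih]
    · simp only [Finset.image_insert]
    · simpa [hφ.eq_iff] using he

theorem subsetExp_subset_indicator [DecidableEq ι] {B : Finset ι} (hB : B ⊆ E) :
    subsetExp p E (fun A => if B ⊆ A then 1 else 0) = p ^ B.card := by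
  induction E using Finset.induction_on generalizing B with
  | empty => simp [Finset.subset_empty.1 hB]
  | insert e E he ih =>
    rw [subsetExp_insert he]
    by_cases heB : e ∈ B
    · have h1 : subsetExp p E (fun A => if B ⊆ A then (1 : ℝ) else 0) = 0 :=
        (subsetExp_congr fun A hA => if_neg fun (h : B ⊆ A) => he (hA (h heB))).trans
          (subsetExp_const 0)
      have h2 : ∀ A : Finset ι, B ⊆ insert e A ↔ B.erase e ⊆ A := fun A =>
        Finset.subset_insert_iff
      simp only [h1, h2]
      rw [ih (Finset.subset_insert_iff.1 hB), mul_zero, zero_add, ← pow_succ',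
        Finset.card_erase_add_one heB]
    · have h2 : ∀ A : Finset ι, B ⊆ insert e A ↔ B ⊆ A := fun A =>
        Finset.subset_insert_iff_of_notMem heB
      simp only [h2]
      rw [ih ((Finset.subset_insert_iff_of_notMem heB).1 hB)]
      ring

theorem subsetExp_sum_subset [DecidableEq ι] (S : Finset (Finset ι)) (hS : ∀ B ∈ S, B ⊆ E)
    (c : Finset ι → ℝ) :
    subsetExp p E (fun A => ∑ B ∈ S with B ⊆ A, c B) = ∑ B ∈ S, c B * p ^ B.card := by
  simp_rw [Finset.sum_filter]
  rw [subsetExp_sum]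
  refine Finset.sum_congr rfl fun B hB => ?_
  rw [← subsetExp_subset_indicator (p := p) (hS B hB), ← subsetExp_const_mul]
  simp

theorem subsetExp_sum_mem (c : ι → ℝ) :
    subsetExp p E (fun A => ∑ e ∈ A, c e) = p * ∑ e ∈ E, c e := by
  classical
  induction E using Finset.induction_on with
  | empty => simp
  | insert e E he ih =>
    have h1 : subsetExp p E (fun A => ∑ e' ∈ insert e A, c e') =
        subsetExp p E (fun A => c e + ∑ e' ∈ A, c e') :=
      subsetExp_congr fun A hA => Finset.sum_insert fun h => he (hA h)
    rw [subsetExp_insert he, h1, subsetExp_add, subsetExp_const, ih, Finset.sum_insert he]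
    ring

theorem subsetExp_choose (k : ℕ) :
    subsetExp p E (fun A => (A.card.choose k : ℝ)) = E.card.choose k * p ^ k := by
  classical
  have h := subsetExp_sum_subset (p := p) (E := E) (E.powersetCard k)
    (fun B hB => (Finset.mem_powersetCard.1 hB).1) (fun _ => 1)
  have h2 : ∀ A ⊆ E, (A.card.choose k : ℝ) = ∑ B ∈ E.powersetCard k with B ⊆ A, (1 : ℝ) := by
    intro A hA
    rw [Finset.sum_const, nsmul_eq_mul, mul_one, ← Finset.card_powersetCard]
    congr 2
    ext B
    simp only [Finset.mem_powersetCard, Finset.mem_filter]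
    exact ⟨fun h => ⟨⟨h.1.trans hA, h.2⟩, h.1⟩, fun h => ⟨h.2, h.1.2⟩⟩
  rw [subsetExp_congr h2, h, Finset.sum_congr rfl
    (fun B hB => by rw [one_mul, (Finset.mem_powersetCard.1 hB).2])]
  simp

theorem subsetExp_isEmpty_indicator [DecidableEq ι] :
    subsetExp p E (fun A => if A = ∅ then 1 else 0) = (1 - p) ^ E.card := by
  rw [subsetExp, Finset.sum_eq_single ∅]
  · simp
  · intro A _ hA; simp [hA]
  · simp

/-- The Efron–Stein (Poincaré) inequality for random subsets. -/
theorem subsetExp_variance_le [DecidableEq ι] (h0 : 0 ≤ p) (h1 : p ≤ 1) :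
    subsetExp p E (fun A => f A ^ 2) - subsetExp p E f ^ 2 ≤
      p * ∑ e ∈ E, subsetExp p E fun A => (f (insert e A) - f A) ^ 2 := by
  induction E using Finset.induction_on generalizing f with
  | empty => simp
  | insert e E he ih =>
    have i0 := ih (f := f)
    have i1 := ih (f := fun A => f (insert e A))
    -- Conditioning on `e` adds p(1 − p) times the squared difference of the conditional means to
    -- the averaged conditional variance; Jensen bounds this by the summand of `e`.
    have hJ := sq_subsetExp_le h0 h1 (E := E) (f := fun A => f (insert e A) - f A)
    rw [subsetExp_sub] at hJ
    rw [Finset.sum_insert he]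
    simp only [subsetExp_insert he, Finset.insert_idem, sub_self, ne_eq, OfNat.ofNat_ne_zero,
      not_false_eq_true, zero_pow, subsetExp_const, mul_zero, add_zero]
    rw [Finset.sum_add_distrib, ← Finset.mul_sum, ← Finset.mul_sum]
    have hcomm : ∑ e' ∈ E, subsetExp p E
        (fun A => (f (insert e' (insert e A)) - f (insert e A)) ^ 2) =
        ∑ e' ∈ E, subsetExp p E
        (fun A => (f (insert e (insert e' A)) - f (insert e A)) ^ 2) :=
      Finset.sum_congr rfl fun e' _ => by simp_rw [Finset.insert_comm e e']
    rw [hcomm]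
    have j0 := mul_le_mul_of_nonneg_left i0 (sub_nonneg.2 h1)
    have j1 := mul_le_mul_of_nonneg_left i1 h0
    have j2 := mul_le_mul_of_nonneg_left hJ (mul_nonneg h0 (sub_nonneg.2 h1))
    nlinarith

theorem subsetExp_subsetExp_union [DecidableEq ι] (r s : ℝ) :
    subsetExp r E (fun A => subsetExp s E fun B => f (A ∪ B)) =
      subsetExp (1 - (1 - r) * (1 - s)) E f := by
  induction E using Finset.induction_on generalizing f with
  | empty => simp
  | insert e E he ih =>
    have hi := fun f => ih (f := f)
    have hi' := ih (f := fun A => f (insert e A))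
    simp only [subsetExp_insert he, Finset.insert_union, Finset.union_insert, Finset.insert_idem,
      subsetExp_add, subsetExp_const_mul, hi, hi']
    ring

end Expectation

/-! ### Replacing random cliques by independent pairs -/

section Replacement

variable {α β : Type} [DecidableEq α]

/-- Adding elements decreases `g`, and each by at most one. -/
structure IsEdgeLipschitz {ι : Type*} [DecidableEq ι] (g : Finset ι → ℝ) : Prop where
  anti : ∀ A e, g (insert e A) ≤ g A
  step : ∀ A e, g A ≤ g (insert e A) + 1

namespace IsEdgeLipschitz

variable {ι : Type*} [DecidableEq ι] {g : Finset ι → ℝ}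

theorem union_le (hg : IsEdgeLipschitz g) (A X : Finset ι) : g (A ∪ X) ≤ g A := by
  induction X using Finset.induction_on with
  | empty => simp
  | insert e X _ ih => rw [Finset.union_insert]; exact (hg.anti _ _).trans ih

theorem le_union_add (hg : IsEdgeLipschitz g) (A X : Finset ι) : g A ≤ g (A ∪ X) + X.card := by
  induction X using Finset.induction_on with
  | empty => simp
  | insert e X he ih =>
    rw [Finset.union_insert, Finset.card_insert_of_notMem he, Nat.cast_add, Nat.cast_one]
    linarith [hg.step (A ∪ X) e]

theorem union_right (hg : IsEdgeLipschitz g) (X : Finset ι) : IsEdgeLipschitz fun A => g (A ∪ X) :=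
  ⟨fun A e => by simpa only [Finset.insert_union] using hg.anti (A ∪ X) e,
    fun A e => by simpa only [Finset.insert_union] using hg.step (A ∪ X) e⟩

end IsEdgeLipschitz

theorem IsEdgeLipschitz.subsetExp {ι κ : Type*} [DecidableEq ι] {p : ℝ} (h0 : 0 ≤ p)
    (h1 : p ≤ 1) {E : Finset κ} {g : Finset κ → Finset ι → ℝ}
    (hg : ∀ X, IsEdgeLipschitz (g X)) :
    IsEdgeLipschitz fun A => subsetExp p E fun X => g X A := by
  refine ⟨fun A e => subsetExp_mono h0 h1 fun X _ => (hg X).anti A e, fun A e => ?_⟩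
  have h := subsetExp_mono h0 h1 (E := E) (f := fun X => g X A)
    (g := fun X => g X (insert e A) + 1) fun X _ => (hg X).step A e
  rwa [subsetExp_add, subsetExp_const] at h

/-- Linearization of an edge-Lipschitz function. -/
theorem IsEdgeLipschitz.abs_sub_le {ι : Type*} [DecidableEq ι] {g : Finset ι → ℝ}
    (hg : IsEdgeLipschitz g) (A X : Finset ι) :
    |g (A ∪ X) - (g A - ∑ e ∈ X, (g A - g (insert e A)))| ≤ X.card := by
  have h1 := hg.union_le A X
  have h2 := hg.le_union_add A X
  have h3 : 0 ≤ ∑ e ∈ X, (g A - g (insert e A)) :=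
    Finset.sum_nonneg fun e _ => sub_nonneg.2 (hg.anti A e)
  have h4 : ∑ e ∈ X, (g A - g (insert e A)) ≤ X.card := by
    have := Finset.sum_le_sum (s := X) (f := fun e => g A - g (insert e A)) (g := fun _ => 1)
      fun e _ => by linarith [hg.step A e]
    simpa using this
  rw [abs_le]
  constructor <;> linarith

/-- The linearization is exact unless at least two pairs are added, so its expected error is of
higher order in the probability. -/
theorem IsEdgeLipschitz.linear_of_card_le_one {ι : Type*} [DecidableEq ι] {g : Finset ι → ℝ}
    (A X : Finset ι) (hX : X.card ≤ 1) :
    g (A ∪ X) - (g A - ∑ e ∈ X, (g A - g (insert e A))) = 0 := by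
  by_cases hne : X = ∅
  · simp [hne]
  · obtain ⟨e, rfl⟩ := Finset.card_eq_one.1
      (le_antisymm hX (Finset.card_pos.2 (Finset.nonempty_iff_ne_empty.2 hne)))
    rw [Finset.union_comm, ← Finset.insert_eq]
    simp

theorem card_pairs (I : Finset α) : (pairs I).card = I.card.choose 2 := by
  rw [pairs]
  have h := Finset.card_filter_add_card_filter_not (s := I.sym2) (fun e => e.IsDiag)
  rw [Finset.card_sym2] at h
  have h2 : (I.sym2.filter fun e => e.IsDiag).card = I.card := by
    symm
    refine Finset.card_bij (fun a _ => s(a, a)) ?_ ?_ ?_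
    · intro a ha; simpa using ha
    · intro a _ b _ h; simpa using h
    · intro e he
      induction e using Sym2.ind with
      | _ a b =>
        simp only [Finset.mem_filter, Finset.mk_mem_sym2_iff, Sym2.mk_isDiag_iff] at he
        obtain ⟨⟨ha, -⟩, rfl⟩ := he
        exact ⟨a, ha, rfl⟩
  rw [h2] at h
  have h3 : (I.card + 1).choose 2 = I.card + I.card.choose 2 := by
    rw [Nat.choose_succ_succ' I.card 1, Nat.choose_one_right]
  have h4 : (I.sym2.filter fun e => ¬ e.IsDiag).card = I.card.choose 2 := by omega
  convert h4

theorem Nat.choose_two_le_three_mul_choose_three {n : ℕ} (hn : 3 ≤ n) :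
    n.choose 2 ≤ 3 * n.choose 3 := by
  have h := Nat.choose_succ_right_eq n 2
  have : 1 ≤ n - 2 := by omega
  nlinarith [Nat.zero_le (n.choose 2)]

variable [Fintype α]

/-- Average of `g` after adding a clique on a random set of vertices. -/
noncomputable def cliqueStep (p : ℝ) (g : Finset (Sym2 α) → ℝ) (A : Finset (Sym2 α)) : ℝ :=
  subsetExp p (Finset.univ : Finset α) fun I => g (A ∪ pairs I)

/-- Average of `g` after adding each pair independently. -/
noncomputable def edgeStep (r : ℝ) (g : Finset (Sym2 α) → ℝ) (A : Finset (Sym2 α)) : ℝ :=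
  subsetExp r (pairs (Finset.univ : Finset α)) fun X => g (A ∪ X)

theorem IsEdgeLipschitz.edgeStep {p : ℝ} (h0 : 0 ≤ p) (h1 : p ≤ 1)
    {g : Finset (Sym2 α) → ℝ} (hg : IsEdgeLipschitz g) : IsEdgeLipschitz (edgeStep p g) :=
  IsEdgeLipschitz.subsetExp (g := fun I A => g (A ∪ I)) h0 h1 fun _ => hg.union_right _

theorem subsetExp_sum_pairs (p : ℝ) (c : Sym2 α → ℝ) :
    subsetExp p (Finset.univ : Finset α) (fun I => ∑ e ∈ pairs I, c e) =
      p ^ 2 * ∑ e ∈ pairs (Finset.univ : Finset α), c e := by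
  have h1 : ∀ I : Finset α, ∑ e ∈ pairs I, c e =
      ∑ e ∈ pairs (Finset.univ : Finset α), c e * (if e.toFinset ⊆ I then 1 else 0) := by
    intro I
    simp only [mul_ite, mul_one, mul_zero]
    rw [← Finset.sum_filter]
    refine Finset.sum_congr ?_ fun _ _ => rfl
    ext e
    induction e using Sym2.ind with
    | _ a b =>
      simp [Sym2.toFinset_mk_eq, Finset.insert_subset_iff, and_comm]
  rw [subsetExp_congr fun I _ => h1 I, subsetExp_sum, Finset.mul_sum]
  refine Finset.sum_congr rfl fun e he => ?_
  have hcard : e.toFinset.card = 2 := by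
    refine Sym2.card_toFinset_of_not_isDiag e ?_
    induction e using Sym2.ind with
    | _ a b => simpa using he
  rw [subsetExp_const_mul, subsetExp_subset_indicator (B := e.toFinset) (Finset.subset_univ _),
    hcard, mul_comm]

/-- The error made when a random clique is replaced by a random set of pairs. -/
noncomputable def replacementError (n : ℕ) (p : ℝ) : ℝ :=
  3 * (n.choose 3 * p ^ 3) + 2 * ((n.choose 2).choose 2 * (p ^ 2) ^ 2)

/-- Every pair lies in the random clique with probability p², so both steps have the same linear
part. The clique step errs only when at least three vertices are chosen, the edge step only when at
least two pairs are. -/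
theorem abs_cliqueStep_sub_edgeStep_le {p : ℝ} (h0 : 0 ≤ p) (h1 : p ≤ 1)
    {g : Finset (Sym2 α) → ℝ} (hg : IsEdgeLipschitz g) (A : Finset (Sym2 α)) :
    |cliqueStep p g A - edgeStep (p ^ 2) g A| ≤ replacementError (Fintype.card α) p := by
  set c : Sym2 α → ℝ := fun e => g A - g (insert e A)
  have e1 : |cliqueStep p g A - (g A - p ^ 2 * ∑ e ∈ pairs (Finset.univ : Finset α), c e)| ≤
      3 * ((Fintype.card α).choose 3 * p ^ 3) := by
    have h := abs_subsetExp_le h0 h1 (E := (Finset.univ : Finset α))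
      (f := fun I => g (A ∪ pairs I) - (g A - ∑ e ∈ pairs I, c e))
      (g := fun I => 3 * (I.card.choose 3 : ℝ)) fun I _ => by
        by_cases hI : I.card ≤ 2
        · rw [IsEdgeLipschitz.linear_of_card_le_one]
          · simp
          · rw [card_pairs]
            exact (Nat.choose_le_choose 2 hI).trans (by simp)
        · refine (hg.abs_sub_le A (pairs I)).trans ?_
          rw [card_pairs]
          exact_mod_cast Nat.choose_two_le_three_mul_choose_three (by omega)
    rw [subsetExp_sub, subsetExp_sub, subsetExp_const, subsetExp_sum_pairs, subsetExp_const_mul,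
      subsetExp_choose, Finset.card_univ] at h
    exact h
  have e2 : |edgeStep (p ^ 2) g A -
      (g A - p ^ 2 * ∑ e ∈ pairs (Finset.univ : Finset α), c e)| ≤
      2 * (((Fintype.card α).choose 2).choose 2 * (p ^ 2) ^ 2) := by
    have h := abs_subsetExp_le (p := p ^ 2) (by positivity) (pow_le_one₀ h0 h1)
      (E := pairs (Finset.univ : Finset α))
      (f := fun X => g (A ∪ X) - (g A - ∑ e ∈ X, c e))
      (g := fun X => 2 * (X.card.choose 2 : ℝ)) fun X _ => by
        by_cases hX : X.card ≤ 1
        · rw [IsEdgeLipschitz.linear_of_card_le_one _ _ hX]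
          simp
        · refine (hg.abs_sub_le A X).trans ?_
          have h2 : X.card ≤ 2 * X.card.choose 2 := by
            rw [Nat.choose_two_right, Nat.mul_div_cancel' (Nat.even_mul_pred_self _).two_dvd]
            exact Nat.le_mul_of_pos_right _ (by omega)
          exact_mod_cast h2
    rw [subsetExp_sub, subsetExp_sub, subsetExp_const, subsetExp_sum_mem, subsetExp_const_mul,
      subsetExp_choose, card_pairs, Finset.card_univ] at h
    exact h
  rw [replacementError]
  rw [abs_le] at *
  constructor <;> linarith [e1.1, e1.2, e2.1, e2.2]

/-- Lindeberg's replacement, one clique at a time: averaging does not increase the error already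
made, and the edge steps keep the function edge-Lipschitz, so the one-step bound applies again. -/
theorem abs_cliqueStep_iterate_sub_le {p : ℝ} (h0 : 0 ≤ p) (h1 : p ≤ 1)
    {g : Finset (Sym2 α) → ℝ} (hg : IsEdgeLipschitz g) (m : ℕ) (A : Finset (Sym2 α)) :
    |(cliqueStep p)^[m] g A - (edgeStep (p ^ 2))^[m] g A| ≤
      m * replacementError (Fintype.card α) p := by
  have hL : ∀ m, IsEdgeLipschitz ((edgeStep (p ^ 2))^[m] g) := by
    intro m
    induction m with
    | zero => exact hg
    | succ m ih =>
      rw [Function.iterate_succ_apply']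
      exact ih.edgeStep (by positivity) (pow_le_one₀ h0 h1)
  induction m generalizing A with
  | zero => simp
  | succ m ih =>
    rw [Function.iterate_succ_apply', Function.iterate_succ_apply']
    have e1 := abs_cliqueStep_sub_edgeStep_le h0 h1 (hL m) A
    have e2 : |cliqueStep p ((cliqueStep p)^[m] g) A -
        cliqueStep p ((edgeStep (p ^ 2))^[m] g) A| ≤
        m * replacementError (Fintype.card α) p := by
      rw [cliqueStep, cliqueStep, ← subsetExp_sub]
      refine (abs_subsetExp_le h0 h1 fun I _ => ih _).trans ?_
      rw [subsetExp_const]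
    push_cast
    rw [abs_le] at *
    constructor <;> linarith [e1.1, e1.2, e2.1, e2.2]

theorem edgeStep_iterate (r : ℝ) (g : Finset (Sym2 α) → ℝ) (m : ℕ) :
    (edgeStep r)^[m] g = edgeStep (1 - (1 - r) ^ m) g := by
  induction m with
  | zero =>
    ext A
    simp only [Function.iterate_zero, id_eq, pow_zero, sub_self, edgeStep, subsetExp]
    rw [Finset.sum_eq_single ∅]
    · simp
    · intro X _ hX
      simp [hX]
    · simp
  | succ m ih =>
    rw [Function.iterate_succ_apply', ih]
    ext A
    simp only [edgeStep]
    have := subsetExp_subsetExp_union (E := pairs (Finset.univ : Finset α))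
      (f := fun X => g (A ∪ X)) r (1 - (1 - r) ^ m)
    simp only [← Finset.union_assoc] at this
    rw [this]
    congr 1
    ring

theorem mk_mem_projection [Fintype β] {F : Finset (α × β)} {a a' : α} :
    s(a, a') ∈ projection F ↔ (∃ b, (a, b) ∈ F ∧ (a', b) ∈ F) ∧ a ≠ a' := by
  simp [projection]

/-- The neighbourhoods of the right vertices are independent random subsets of `α`, and the
projection is the union of the cliques on them. -/
theorem subsetExp_projection [Fintype β] [DecidableEq β] (p : ℝ) (g : Finset (Sym2 α) → ℝ) :
    subsetExp p (Finset.univ : Finset (α × β)) (fun F => g (projection F)) =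
      (cliqueStep p)^[Fintype.card β] g ∅ := by
  have key : ∀ (S : Finset β) (A : Finset (Sym2 α)),
      subsetExp p ((Finset.univ : Finset α) ×ˢ S) (fun F => g (A ∪ projection F)) =
        (cliqueStep p)^[S.card] g A := by
    intro S
    induction S using Finset.induction_on with
    | empty =>
      intro A
      have : projection (∅ : Finset (α × β)) = ∅ := by
        ext e
        induction e using Sym2.ind with
        | _ a a' => simp [mk_mem_projection]
      simp [this]
    | insert b S hb ih =>
      intro A
      have hsplit : (Finset.univ : Finset α) ×ˢ insert b S =
          (Finset.univ.image fun a : α => (a, b)) ∪ Finset.univ ×ˢ S := by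
        ext ⟨a, b'⟩
        simp [eq_comm]
      have hdisj : Disjoint (Finset.univ.image fun a : α => (a, b))
          ((Finset.univ : Finset α) ×ˢ S) := by
        rw [Finset.disjoint_left]
        rintro ⟨a, b'⟩ h1 h2
        simp only [Finset.mem_image, Finset.mem_univ, true_and, Prod.mk.injEq,
          Finset.mem_product] at h1 h2
        obtain ⟨-, -, rfl⟩ := h1
        exact hb h2
      rw [hsplit, subsetExp_union hdisj, subsetExp_image (fun a a' h => congrArg Prod.fst h),
        Finset.card_insert_of_notMem hb, Function.iterate_succ_apply', cliqueStep]
      refine subsetExp_congr fun I _ => ?_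
      rw [← ih]
      refine subsetExp_congr fun Y hY => ?_
      have hYb : ∀ a, (a, b) ∉ Y := fun a h => hb (Finset.mem_product.1 (hY h)).2
      rw [Finset.union_assoc]
      congr 2
      ext e
      induction e using Sym2.ind with
      | _ a a' =>
        rw [Finset.mem_union, mk_mem_projection, mk_mem_projection, mk_mem_pairs]
        simp only [Finset.mem_union, Finset.mem_image, Prod.mk.injEq]
        constructor
        · rintro ⟨⟨b', h1, h2⟩, hne⟩
          by_cases hbb : b = b'
          · subst hbb
            simp only [hYb, or_false] at h1 h2
            obtain ⟨x, hx, rfl, -⟩ := h1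
            obtain ⟨y, hy, rfl, -⟩ := h2
            exact Or.inl ⟨⟨hx, hy⟩, hne⟩
          · simp only [hbb, and_false, exists_false, false_or] at h1 h2
            exact Or.inr ⟨⟨b', h1, h2⟩, hne⟩
        · rintro (⟨⟨h1, h2⟩, hne⟩ | ⟨⟨b', h1, h2⟩, hne⟩)
          · exact ⟨⟨b, Or.inl ⟨a, h1, rfl, rfl⟩, Or.inl ⟨a', h2, rfl, rfl⟩⟩, hne⟩
          · exact ⟨⟨b', Or.inr h1, Or.inr h2⟩, hne⟩
  have h := key Finset.univ ∅
  simpa only [Finset.univ_product_univ, Finset.empty_union, Finset.card_univ] using h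

/-- Components are counted by the dimension of the locally constant functions, on which a new pair
imposes one linear equation. -/
theorem isEdgeLipschitz_comps : IsEdgeLipschitz fun A : Finset (Sym2 α) => (comps A : ℝ) := by
  have hmono : ∀ A B : Finset (Sym2 α), A ⊆ B →
      (SimpleGraph.fromEdgeSet (B : Set (Sym2 α))).locallyConstant ≤
        (SimpleGraph.fromEdgeSet (A : Set (Sym2 α))).locallyConstant := fun A B h g hg u w huw =>
    hg u w (SimpleGraph.fromEdgeSet_mono (Finset.coe_subset.2 h) huw)
  constructor
  · intro A e
    rw [Nat.cast_le, comps, comps, ← SimpleGraph.finrank_locallyConstant,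
      ← SimpleGraph.finrank_locallyConstant]
    exact Submodule.finrank_mono (hmono _ _ (Finset.subset_insert e A))
  · intro A e
    rw [← Nat.cast_add_one, Nat.cast_le, comps, comps, ← SimpleGraph.finrank_locallyConstant,
      ← SimpleGraph.finrank_locallyConstant]
    induction e using Sym2.ind with
    | _ a b =>
      set LA := (SimpleGraph.fromEdgeSet (A : Set (Sym2 α))).locallyConstant
      let ev : LA →ₗ[ℚ] ℚ :=
        (LinearMap.proj (R := ℚ) (φ := fun _ : α => ℚ) a - LinearMap.proj b).comp LA.subtype
      have h1 := LinearMap.finrank_range_add_finrank_ker ev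
      have h2 : Module.finrank ℚ (LinearMap.range ev) ≤ 1 :=
        (Submodule.finrank_le _).trans (Module.finrank_self ℚ).le
      let ι : LinearMap.ker ev →ₗ[ℚ] (SimpleGraph.fromEdgeSet
          (insert s(a, b) A : Finset (Sym2 α)) : SimpleGraph α).locallyConstant :=
        (LA.subtype.comp (LinearMap.ker ev).subtype).codRestrict _ (by
          rintro ⟨⟨g, hg⟩, h0⟩ u w huw
          have hab : g a = g b := sub_eq_zero.1 (LinearMap.mem_ker.1 h0)
          change g u = g w
          rw [SimpleGraph.fromEdgeSet_adj, Finset.mem_coe, Finset.mem_insert] at huw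
          obtain ⟨h | h, hne⟩ := huw
          · rcases Sym2.eq_iff.1 h with ⟨rfl, rfl⟩ | ⟨rfl, rfl⟩
            · exact hab
            · exact hab.symm
          · exact hg u w ((SimpleGraph.fromEdgeSet_adj _).2 ⟨h, hne⟩))
      have hι : Function.Injective ι := fun w w' h =>
        Subtype.ext (Subtype.ext (congrArg (fun x => x.1) h))
      have h3 := LinearMap.finrank_le_finrank_of_injective hι
      omega

/-- Expected number of components of the projection, against the binomial random graph. -/
theorem abs_subsetExp_comps_projection_sub_le [Fintype β] [DecidableEq β] {p : ℝ} (h0 : 0 ≤ p)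
    (h1 : p ≤ 1) :
    |subsetExp p (Finset.univ : Finset (α × β)) (fun F => (comps (projection F) : ℝ)) -
      subsetExp (1 - (1 - p ^ 2) ^ Fintype.card β) (pairs (Finset.univ : Finset α))
        (fun X => (comps X : ℝ))| ≤
      Fintype.card β * replacementError (Fintype.card α) p := by
  have h := abs_cliqueStep_iterate_sub_le h0 h1 (isEdgeLipschitz_comps (α := α))
    (Fintype.card β) ∅
  rw [← subsetExp_projection, edgeStep_iterate, edgeStep] at h
  simpa only [Finset.empty_union] using h

end Replacement

/-! ### Exact expected numbers of components of the binomial random graph -/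

section Exploration

variable {α : Type}

/-- Every vertex of `S` can be reached from `R` along pairs of `A` inside `S`. -/
def Spans (A : Finset (Sym2 α)) (R S : Finset α) : Prop :=
  ∀ T, R ⊆ T → T ⊆ S → T ≠ S → ∃ a ∈ T, ∃ b ∈ S, b ∉ T ∧ s(a, b) ∈ A

/-- The probability that `k` roots reach a set of `m` vertices, by exploring one root at a time. -/
noncomputable def spanProb (p : ℝ) : ℕ → ℕ → ℝ
  | 0, _ => 1
  | _ + 1, 0 => 0
  | m + 1, k + 1 => ∑ j ∈ Finset.range (m - k + 1),
      (m - k).choose j * (p ^ j * (1 - p) ^ (m - k - j) * spanProb p m (k + j))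

/-- `S` is the vertex set of a connected component. -/
def IsComponent (A : Finset (Sym2 α)) (S : Finset α) : Prop :=
  ∃ c : (SimpleGraph.fromEdgeSet (A : Set (Sym2 α))).ConnectedComponent,
    ∀ a, a ∈ S ↔ SimpleGraph.connectedComponentMk _ a = c

theorem IsComponent.nonempty {A : Finset (Sym2 α)} {S : Finset α} (h : IsComponent A S) :
    S.Nonempty := by
  obtain ⟨c, hc⟩ := h
  obtain ⟨a, rfl⟩ := c.exists_rep
  exact ⟨a, (hc a).2 rfl⟩

theorem subsetExp_card {ι : Type*} (p : ℝ) (E : Finset ι) (h : ℕ → ℝ) :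
    subsetExp p E (fun A => h A.card) = ∑ j ∈ Finset.range (E.card + 1),
      E.card.choose j * (p ^ j * (1 - p) ^ (E.card - j) * h j) := by
  rw [subsetExp, Finset.sum_powerset_apply_card
    (fun j => p ^ j * (1 - p) ^ (E.card - j) * h j)]
  simp

variable [DecidableEq α]

theorem pairs_insert (r : α) (S : Finset α) :
    pairs (insert r S) = ((S.erase r).image fun b => s(r, b)) ∪ pairs S := by
  ext e
  induction e using Sym2.ind with
  | _ a b =>
    simp only [mk_mem_pairs, Finset.mem_union, Finset.mem_image, Finset.mem_insert, Sym2.eq_iff,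
      Finset.mem_erase]
    constructor
    · rintro ⟨⟨rfl | ha, rfl | hb⟩, hab⟩
      · exact absurd rfl hab
      · exact Or.inl ⟨b, ⟨hab.symm, hb⟩, Or.inl ⟨rfl, rfl⟩⟩
      · exact Or.inl ⟨a, ⟨hab, ha⟩, Or.inr ⟨rfl, rfl⟩⟩
      · exact Or.inr ⟨⟨ha, hb⟩, hab⟩
    · rintro (⟨x, ⟨hx, hxS⟩, ⟨rfl, rfl⟩ | ⟨rfl, rfl⟩⟩ | ⟨⟨ha, hb⟩, hab⟩)
      · exact ⟨⟨Or.inl rfl, Or.inr hxS⟩, hx.symm⟩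
      · exact ⟨⟨Or.inr hxS, Or.inl rfl⟩, hx⟩
      · exact ⟨⟨Or.inr ha, Or.inr hb⟩, hab⟩

/-- One exploration step: once the root `r` is processed it is deleted, and its neighbours `X`
become roots. -/
theorem spans_insert_iff {r : α} {S X R : Finset α} {B : Finset (Sym2 α)} (hr : r ∉ S)
    (hR : R ⊆ S) (hX : X ⊆ S) (hB : B ⊆ pairs S) :
    Spans (X.image (fun b => s(r, b)) ∪ B) (insert r R) (insert r S) ↔ Spans B (R ∪ X) S := by
  have hBr : ∀ b, s(r, b) ∉ B := fun b h => hr (mk_mem_pairs.1 (hB h)).1.1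
  have hBr' : ∀ b, s(b, r) ∉ B := fun b h => hr (mk_mem_pairs.1 (hB h)).1.2
  constructor
  · intro h T hT hTS hne
    have hrT : r ∉ T := fun h' => hr (hTS h')
    obtain ⟨a, ha, b, hb, hbT, hab⟩ := h (insert r T)
      (Finset.insert_subset_insert _ (Finset.union_subset_left hT))
      (Finset.insert_subset_insert _ hTS) fun heq => hne (by
        rw [← Finset.erase_insert hrT, heq, Finset.erase_insert hr])
    rw [Finset.mem_insert, not_or] at hbT
    have hbS : b ∈ S := (Finset.mem_insert.1 hb).resolve_left hbT.1
    rcases Finset.mem_insert.1 ha with rfl | haT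
    · rcases Finset.mem_union.1 hab with h1 | h1
      · obtain ⟨x, hx, hxe⟩ := Finset.mem_image.1 h1
        have : x = b := Sym2.congr_right.1 hxe
        subst this
        exact absurd (hT (Finset.mem_union_right _ hx)) hbT.2
      · exact absurd h1 (hBr b)
    · refine ⟨a, haT, b, hbS, hbT.2, ?_⟩
      rcases Finset.mem_union.1 hab with h1 | h1
      · obtain ⟨x, hx, hxe⟩ := Finset.mem_image.1 h1
        rcases Sym2.eq_iff.1 hxe with ⟨rfl, -⟩ | ⟨rfl, -⟩
        · exact absurd haT hrT
        · exact absurd rfl hbT.1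
      · exact h1
  · intro h T hT hTS hne
    have hrT : r ∈ T := hT (Finset.mem_insert_self _ _)
    by_cases hXT : X ⊆ T
    · obtain ⟨a, ha, b, hb, hbT, hab⟩ := h (T.erase r) (Finset.union_subset
        (fun x hx => Finset.mem_erase.2 ⟨fun h' => hr (h' ▸ hR hx),
          hT (Finset.mem_insert_of_mem hx)⟩)
        (fun x hx => Finset.mem_erase.2 ⟨fun h' => hr (h' ▸ hX hx), hXT hx⟩))
        (by rw [← Finset.erase_insert hr]; exact Finset.erase_subset_erase _ hTS)
        (fun heq => hne (by rw [← heq, Finset.insert_erase hrT]))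
      refine ⟨a, Finset.mem_of_mem_erase ha, b, Finset.mem_insert_of_mem hb, fun hbT' => ?_,
        Finset.mem_union_right _ hab⟩
      exact hbT (Finset.mem_erase.2 ⟨fun h' => hr (h' ▸ hb), hbT'⟩)
    · obtain ⟨b, hbX, hbT⟩ := Finset.not_subset.1 hXT
      exact ⟨r, hrT, b, Finset.mem_insert_of_mem (hX hbX), hbT,
        Finset.mem_union_left _ (Finset.mem_image_of_mem _ hbX)⟩

-- Exploring from a root reproduces the recursion of `spanProb`, since the pairs at the root are
-- independent of those in the rest of `S`.
open scoped Classical in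
theorem subsetExp_spans (p : ℝ) (m : ℕ) (R S : Finset α) (hS : S.card = m) (hR : R ⊆ S) :
    subsetExp p (pairs S) (fun A => if Spans A R S then 1 else 0) = spanProb p m R.card := by
  induction m generalizing R S with
  | zero =>
    obtain rfl := Finset.card_eq_zero.1 hS
    have h : ∀ A : Finset (Sym2 α), Spans A R ∅ := fun A T _ hT hne =>
      absurd (Finset.subset_empty.1 hT) hne
    simp [h, spanProb]
  | succ m ih =>
    rcases R.eq_empty_or_nonempty with rfl | ⟨r, hr⟩
    · have h : ∀ A : Finset (Sym2 α), ¬ Spans A ∅ S := fun A hA => by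
        obtain ⟨a, ha, -⟩ := hA ∅ subset_rfl (Finset.empty_subset _)
          (fun h => by rw [← h] at hS; simp at hS)
        simp at ha
      simp [h, spanProb]
    obtain ⟨R, hrR, rfl⟩ : ∃ R', r ∉ R' ∧ R = insert r R' :=
      ⟨R.erase r, Finset.notMem_erase _ _, (Finset.insert_erase hr).symm⟩
    obtain ⟨S, hrS, rfl⟩ : ∃ S', r ∉ S' ∧ S = insert r S' :=
      ⟨S.erase r, Finset.notMem_erase _ _, (Finset.insert_erase (hR hr)).symm⟩
    rw [Finset.card_insert_of_notMem hrS, Nat.add_right_cancel_iff] at hS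
    have hRS : R ⊆ S := fun x hx => (Finset.mem_insert.1
      (hR (Finset.mem_insert_of_mem hx))).resolve_left fun h => hrR (h ▸ hx)
    have hdisj : Disjoint (S.image fun b => s(r, b)) (pairs S) := by
      rw [Finset.disjoint_left]
      rintro _ he h2
      obtain ⟨b, -, rfl⟩ := Finset.mem_image.1 he
      exact hrS (mk_mem_pairs.1 h2).1.1
    rw [pairs_insert, Finset.erase_eq_of_notMem hrS, subsetExp_union hdisj,
      subsetExp_image (fun a b h => Sym2.congr_right.1 h)]
    have e1 : subsetExp p S (fun X => subsetExp p (pairs S) fun B =>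
        if Spans (X.image (fun b => s(r, b)) ∪ B) (insert r R) (insert r S) then (1 : ℝ) else 0) =
        subsetExp p S (fun X => spanProb p m (R ∪ X).card) := by
      refine subsetExp_congr fun X hX => ?_
      rw [← ih (R ∪ X) S hS (Finset.union_subset hRS hX)]
      refine subsetExp_congr fun B hB => ?_
      simp only [spans_insert_iff hrS hRS hX hB]
    rw [e1]
    -- Pairs from `r` to vertices that are already roots have no influence and are averaged out.
    have e2 : subsetExp p (R ∪ S \ R) (fun X => spanProb p m (R ∪ X).card) =
        subsetExp p (S \ R) (fun X => spanProb p m (R.card + X.card)) := by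
      rw [subsetExp_union Finset.disjoint_sdiff]
      have : ∀ X ⊆ R, subsetExp p (S \ R) (fun Y => spanProb p m (R ∪ (X ∪ Y)).card) =
          subsetExp p (S \ R) (fun X => spanProb p m (R.card + X.card)) := by
        intro X hX
        refine subsetExp_congr fun Y hY => ?_
        rw [← Finset.union_assoc, Finset.union_eq_left.2 hX, Finset.card_union_of_disjoint]
        exact Finset.disjoint_of_subset_right hY Finset.disjoint_sdiff
      rw [subsetExp_congr this, subsetExp_const]
    rw [Finset.union_sdiff_of_subset hRS] at e2
    rw [e2, subsetExp_card p (S \ R) (fun j => spanProb p m (R.card + j)),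
      Finset.card_sdiff_of_subset hRS, hS, Finset.card_insert_of_notMem hrR, spanProb]

variable [Fintype α]

theorem isComponent_iff (A : Finset (Sym2 α)) (S : Finset α) {v : α} (hv : v ∈ S) :
    IsComponent A S ↔ Spans A {v} S ∧ ∀ a ∈ S, ∀ b ∉ S, s(a, b) ∉ A := by
  classical
  set G := SimpleGraph.fromEdgeSet (A : Set (Sym2 α))
  have hadj : ∀ a b, s(a, b) ∈ A → a ≠ b → G.Adj a b := fun a b h hne =>
    (SimpleGraph.fromEdgeSet_adj _).2 ⟨h, hne⟩
  constructor
  · rintro ⟨c, hc⟩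
    constructor
    · intro T hvT hTS hne
      by_contra! hcon
      have key : ∀ w, G.Reachable v w → w ∈ T := by
        intro w hw
        rw [SimpleGraph.reachable_iff_reflTransGen] at hw
        induction hw with
        | refl => exact hvT (Finset.mem_singleton_self _)
        | @tail a b hva hab ih =>
          by_contra hbT
          have hbS : b ∈ S := by
            rw [hc, ← (hc a).1 (hTS ih)]
            exact (SimpleGraph.ConnectedComponent.sound hab.reachable).symm
          exact hcon a ih b hbS hbT ((SimpleGraph.fromEdgeSet_adj _).1 hab).1
      refine hne (Finset.Subset.antisymm hTS fun w hw => key w ?_)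
      exact SimpleGraph.ConnectedComponent.exact (((hc v).1 hv).trans ((hc w).1 hw).symm)
    · intro a ha b hb hab
      have hne : a ≠ b := fun h => hb (h ▸ ha)
      apply hb
      rw [hc, ← (hc a).1 ha]
      exact (SimpleGraph.ConnectedComponent.sound (hadj a b hab hne).reachable).symm
  · rintro ⟨hspan, hcross⟩
    refine ⟨G.connectedComponentMk v, fun w => ?_⟩
    rw [SimpleGraph.ConnectedComponent.eq]
    constructor
    · intro hw
      by_contra hvw
      obtain ⟨a, ha, b, hb, hbT, hab⟩ := hspan (S.filter fun u => G.Reachable v u)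
        (by simpa using hv) (Finset.filter_subset _ _)
        (fun h => hvw ((Finset.mem_filter.1 (h ▸ hw)).2.symm))
      rw [Finset.mem_filter] at ha
      have hne : a ≠ b := fun h => hbT (Finset.mem_filter.2 (h ▸ ha))
      exact hbT (Finset.mem_filter.2 ⟨hb, ha.2.trans (hadj a b hab hne).reachable⟩)
    · intro hw
      have hw := hw.symm
      rw [SimpleGraph.reachable_iff_reflTransGen] at hw
      induction hw with
      | refl => exact hv
      | @tail a b hva hab ih =>
        by_contra hbS
        exact hcross a (ih (SimpleGraph.reachable_iff_reflTransGen _ _ |>.2 hva).symm) b hbS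
          ((SimpleGraph.fromEdgeSet_adj _).1 hab).1

open scoped Classical in
theorem comps_eq_sum (A : Finset (Sym2 α)) :
    (comps A : ℝ) = ∑ S : Finset α, if IsComponent A S then 1 else 0 := by
  rw [Finset.sum_boole, Nat.cast_inj, comps, Nat.card_eq_fintype_card, ← Finset.card_univ]
  refine Finset.card_bij (fun c _ => Finset.univ.filter fun a =>
    SimpleGraph.connectedComponentMk _ a = c) ?_ ?_ ?_
  · intro c _
    exact Finset.mem_filter.2 ⟨Finset.mem_univ _, c, fun a => by simp⟩
  · intro c _ c' _ h
    obtain ⟨a, rfl⟩ := c.exists_rep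
    have : a ∈ Finset.univ.filter fun a => SimpleGraph.connectedComponentMk _ a = c' := by
      rw [← h]; exact Finset.mem_filter.2 ⟨Finset.mem_univ _, rfl⟩
    exact (Finset.mem_filter.1 this).2
  · intro S hS
    obtain ⟨-, c, hc⟩ := Finset.mem_filter.1 hS
    exact ⟨c, Finset.mem_univ _, by ext a; simp [hc]⟩

open scoped Classical in
theorem sum_card_components (A : Finset (Sym2 α)) :
    ∑ S : Finset α, (if IsComponent A S then (S.card : ℝ) else 0) = Fintype.card α := by
  have h : ∀ a : α, ∑ S : Finset α, (if IsComponent A S ∧ a ∈ S then (1 : ℝ) else 0) = 1 := by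
    intro a
    rw [Finset.sum_eq_single (Finset.univ.filter fun b =>
      (SimpleGraph.fromEdgeSet (A : Set (Sym2 α))).connectedComponentMk b =
        SimpleGraph.connectedComponentMk _ a)]
    · exact if_pos ⟨⟨SimpleGraph.connectedComponentMk _ a, fun b => by simp⟩, by simp⟩
    · rintro S - hS
      refine if_neg ?_
      rintro ⟨⟨c, hc⟩, ha⟩
      apply hS
      ext b
      rw [hc, ← (hc a).1 ha]
      simp
    · simp
  calc _ = ∑ S : Finset α, ∑ a : α, (if IsComponent A S ∧ a ∈ S then (1 : ℝ) else 0) := by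
        refine Finset.sum_congr rfl fun S _ => ?_
        by_cases hS : IsComponent A S <;> simp [hS]
    _ = _ := by rw [Finset.sum_comm, Finset.sum_congr rfl fun a _ => h a]; simp

-- The pairs inside `S`, across its boundary and outside `S` are independent: the first must span,
-- the second must be absent, and the third are unconstrained.
open scoped Classical in
theorem subsetExp_isComponent (p : ℝ) (S : Finset α) (hS : S.Nonempty) :
    subsetExp p (pairs (Finset.univ : Finset α)) (fun A => if IsComponent A S then 1 else 0) =
      spanProb p S.card 1 * (1 - p) ^ (S.card * (Fintype.card α - S.card)) := by
  obtain ⟨v, hv⟩ := hS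
  set K : Finset (Sym2 α) := (S ×ˢ Sᶜ).image fun x => s(x.1, x.2) with hK
  have hmemK : ∀ a b, s(a, b) ∈ K ↔ (a ∈ S ∧ b ∉ S) ∨ (b ∈ S ∧ a ∉ S) := by
    intro a b
    simp only [hK, Finset.mem_image, Finset.mem_product, Finset.mem_compl, Sym2.eq_iff,
      Prod.exists]
    constructor
    · rintro ⟨x, y, h, ⟨rfl, rfl⟩ | ⟨rfl, rfl⟩⟩
      · exact Or.inl h
      · exact Or.inr h
    · rintro (h | h)
      · exact ⟨a, b, h, Or.inl ⟨rfl, rfl⟩⟩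
      · exact ⟨b, a, h, Or.inr ⟨rfl, rfl⟩⟩
  have hKcard : K.card = S.card * (Fintype.card α - S.card) := by
    rw [hK, Finset.card_image_of_injOn, Finset.card_product, Finset.card_compl]
    rintro ⟨a, b⟩ h ⟨a', b'⟩ h' heq
    simp only [Finset.coe_product, Set.mem_prod, Finset.mem_coe, Finset.mem_compl] at h h'
    rcases Sym2.eq_iff.1 heq with ⟨h1, h2⟩ | ⟨h1, h2⟩
    · exact Prod.ext h1 h2
    · have h1 : a = b' := h1
      exact absurd (h1 ▸ h.1) h'.2
  have hunion : pairs (Finset.univ : Finset α) = pairs S ∪ (K ∪ pairs Sᶜ) := by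
    ext e
    induction e using Sym2.ind with
    | _ a b =>
      simp only [Finset.mem_union, hmemK, mk_mem_pairs, Finset.mem_univ, Finset.mem_compl]
      constructor
      · rintro ⟨-, hab⟩
        by_cases ha : a ∈ S <;> by_cases hb : b ∈ S <;> simp [ha, hb, hab]
      · rintro (⟨-, h⟩ | (h | h) | ⟨-, h⟩)
        · exact ⟨⟨trivial, trivial⟩, h⟩
        · exact ⟨⟨trivial, trivial⟩, fun h' => h.2 (h' ▸ h.1)⟩
        · exact ⟨⟨trivial, trivial⟩, fun h' => h.2 (h' ▸ h.1)⟩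
        · exact ⟨⟨trivial, trivial⟩, h⟩
  have hd2 : Disjoint K (pairs Sᶜ) := by
    rw [Finset.disjoint_left]
    intro e
    induction e using Sym2.ind with
    | _ a b =>
      rw [hmemK, mk_mem_pairs, Finset.mem_compl, Finset.mem_compl]
      tauto
  have hd1 : Disjoint (pairs S) (K ∪ pairs Sᶜ) := by
    rw [Finset.disjoint_left]
    intro e
    induction e using Sym2.ind with
    | _ a b =>
      rw [Finset.mem_union, hmemK, mk_mem_pairs, mk_mem_pairs, Finset.mem_compl, Finset.mem_compl]
      tauto
  have key : ∀ A ⊆ pairs S, ∀ B ⊆ K, ∀ C ⊆ pairs Sᶜ,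
      (IsComponent (A ∪ (B ∪ C)) S ↔ Spans A {v} S ∧ B = ∅) := by
    intro A hA B hB C hC
    rw [isComponent_iff _ _ hv]
    refine and_congr ?_ ?_
    · have hin : ∀ a ∈ S, ∀ b ∈ S, s(a, b) ∈ A ∪ (B ∪ C) ↔ s(a, b) ∈ A := by
        intro a ha b hb
        have h1 : s(a, b) ∉ B := fun h => by
          rcases (hmemK a b).1 (hB h) with h | h
          · exact h.2 hb
          · exact h.2 ha
        have h2 : s(a, b) ∉ C := fun h => by
          have := (mk_mem_pairs.1 (hC h)).1.1
          exact (Finset.mem_compl.1 this) ha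
        simp [h1, h2]
      constructor
      · intro h T h1 h2 h3
        obtain ⟨a, ha, b, hb, hbT, hab⟩ := h T h1 h2 h3
        exact ⟨a, ha, b, hb, hbT, (hin a (h2 ha) b hb).1 hab⟩
      · intro h T h1 h2 h3
        obtain ⟨a, ha, b, hb, hbT, hab⟩ := h T h1 h2 h3
        exact ⟨a, ha, b, hb, hbT, (hin a (h2 ha) b hb).2 hab⟩
    · constructor
      · intro h
        rw [Finset.eq_empty_iff_forall_notMem]
        intro e he
        induction e using Sym2.ind with
        | _ a b =>
          rcases (hmemK a b).1 (hB he) with ⟨h1, h2⟩ | ⟨h1, h2⟩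
          · exact h a h1 b h2 (by simp [he])
          · exact h b h1 a h2 (by rw [Sym2.eq_swap]; simp [he])
      · rintro rfl a ha b hb hab
        simp only [Finset.empty_union, Finset.mem_union] at hab
        rcases hab with h | h
        · exact hb (mk_mem_pairs.1 (hA h)).1.2
        · exact (Finset.mem_compl.1 (mk_mem_pairs.1 (hC h)).1.1) ha
  rw [hunion, subsetExp_union hd1]
  have e1 : ∀ A ⊆ pairs S, subsetExp p (K ∪ pairs Sᶜ)
      (fun B => if IsComponent (A ∪ B) S then (1 : ℝ) else 0) =
      (1 - p) ^ K.card * (if Spans A {v} S then 1 else 0) := by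
    intro A hA
    rw [subsetExp_union hd2]
    have e2 : ∀ B ⊆ K, subsetExp p (pairs Sᶜ)
        (fun C => if IsComponent (A ∪ (B ∪ C)) S then (1 : ℝ) else 0) =
        (if Spans A {v} S then 1 else 0) * (if B = ∅ then 1 else 0) := by
      intro B hB
      rw [subsetExp_congr fun C hC => by rw [if_congr (key A hA B hB C hC) rfl rfl],
        subsetExp_const]
      by_cases h1 : Spans A {v} S <;> by_cases h2 : B = ∅ <;> simp [h1, h2]
    rw [subsetExp_congr e2, subsetExp_const_mul, subsetExp_isEmpty_indicator, mul_comm]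
  rw [subsetExp_congr e1, subsetExp_const_mul,
    subsetExp_spans p S.card {v} S rfl (by simpa using hv), hKcard, Finset.card_singleton,
    mul_comm]

/-- The expected number of components with `k + 1` vertices. -/
noncomputable def expectedComps (n : ℕ) (p : ℝ) (k : ℕ) : ℝ :=
  n.choose (k + 1) * (spanProb p (k + 1) 1 * (1 - p) ^ ((k + 1) * (n - (k + 1))))

theorem sum_subsetExp_isComponent (p : ℝ) (w : ℕ → ℝ) :
    open scoped Classical in
    subsetExp p (pairs (Finset.univ : Finset α))
      (fun A => ∑ S : Finset α, if IsComponent A S then w S.card else 0) =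
      ∑ k ∈ Finset.range (Fintype.card α), w (k + 1) * expectedComps (Fintype.card α) p k := by
  classical
  rw [subsetExp_sum]
  set h : ℕ → ℝ := fun k => if k = 0 then 0 else
    w k * (spanProb p k 1 * (1 - p) ^ (k * (Fintype.card α - k)))
  have h1 : ∀ S : Finset α, subsetExp p (pairs (Finset.univ : Finset α))
      (fun A => if IsComponent A S then w S.card else 0) = h S.card := by
    intro S
    rcases S.eq_empty_or_nonempty with rfl | hS
    · have : ∀ A : Finset (Sym2 α), ¬ IsComponent A ∅ := fun A hA => by simpa using hA.nonempty
      simp [this, h]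
    · have hne : S.card ≠ 0 := (Finset.card_pos.2 hS).ne'
      simp only [h, hne, if_false]
      rw [← subsetExp_isComponent p S hS, ← subsetExp_const_mul]
      simp
  rw [Finset.sum_congr rfl fun S _ => h1 S, ← Finset.powerset_univ,
    Finset.sum_powerset_apply_card, Finset.card_univ, Finset.sum_range_succ']
  simp only [h, Nat.add_eq_zero_iff, one_ne_zero, and_false, if_false, if_true, smul_zero,
    add_zero, nsmul_eq_mul, expectedComps]
  exact Finset.sum_congr rfl fun k _ => by ring

theorem subsetExp_comps (p : ℝ) :
    subsetExp p (pairs (Finset.univ : Finset α)) (fun A => (comps A : ℝ)) =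
      ∑ k ∈ Finset.range (Fintype.card α), expectedComps (Fintype.card α) p k := by
  classical
  have h := sum_subsetExp_isComponent (α := α) p (fun _ => 1)
  simp only [one_mul] at h
  rw [← h]
  exact subsetExp_congr fun A _ => comps_eq_sum A

/-- The components partition the vertices. This identity gives the tail bound and the summability
used for the limit. -/
theorem sum_mul_expectedComps (α : Type) [Fintype α] (p : ℝ) :
    ∑ k ∈ Finset.range (Fintype.card α), ((k : ℝ) + 1) * expectedComps (Fintype.card α) p k =
      Fintype.card α := by
  classical
  have h := sum_subsetExp_isComponent (α := α) p (fun k => (k : ℝ))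
  simp only [sum_card_components, subsetExp_const, Nat.cast_add, Nat.cast_one] at h
  exact h.symm

end Exploration

/-! ### Limiting density of components -/

section TreeSeries

/-- The leading coefficient of `spanProb p m k` (a number of rooted forests, by Cayley). -/
noncomputable def forestCount (m k : ℕ) : ℝ :=
  if m = 0 then 1 else k * (m : ℝ) ^ ((m : ℤ) - k - 1)

/-- The recursion of `spanProb` at lowest order in p. With N = m − k it follows from the binomial
sums for (m + 1)^N and for its derivative, the factor m cancelling because k + N = m. -/
theorem forestCount_succ {m k : ℕ} (hk : k ≤ m) :
    ∑ j ∈ Finset.range (m - k + 1), ((m - k).choose j : ℝ) * forestCount m (k + j) =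
      forestCount (m + 1) (k + 1) := by
  rcases Nat.eq_zero_or_pos m with rfl | hm
  · obtain rfl : k = 0 := by omega
    simp [forestCount]
  obtain ⟨N, rfl⟩ := Nat.exists_eq_add_of_le hk
  have hm0 : ((k + N : ℕ) : ℝ) ≠ 0 := by exact_mod_cast hm.ne'
  have hm1 : ((k + N + 1 : ℕ) : ℝ) ≠ 0 := by positivity
  simp only [forestCount, hm.ne', if_false, Nat.add_sub_cancel_left, Nat.succ_ne_zero]
  set M : ℝ := ((k + N : ℕ) : ℝ) with hM
  have h1 : ∑ j ∈ Finset.range (N + 1), (N.choose j : ℝ) * M ^ (N - j) = (M + 1) ^ N := by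
    rw [add_comm M 1, add_pow]
    exact Finset.sum_congr rfl fun j _ => by rw [one_pow, one_mul, mul_comm]
  have h2 : ∑ j ∈ Finset.range (N + 1), (N.choose j : ℝ) * (j * M ^ (N - j)) * (M + 1) =
      N * (M + 1) ^ N := by
    rcases N with _ | N
    · simp
    · rw [Finset.sum_range_succ']
      have h3 : ∀ j ∈ Finset.range (N + 1), ((N + 1).choose (j + 1) : ℝ) *
          (((j + 1 : ℕ) : ℝ) * M ^ (N + 1 - (j + 1))) * (M + 1) =
          (N + 1) * (M + 1) * ((N.choose j : ℝ) * M ^ (N - j)) := by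
        intro j _
        have := Nat.add_one_mul_choose_eq N j
        have h4 : ((N : ℝ) + 1) * N.choose j = (N + 1).choose (j + 1) * ((j : ℝ) + 1) := by
          exact_mod_cast this
        rw [Nat.add_sub_add_right]
        push_cast
        linear_combination (-(M ^ (N - j) * (M + 1))) * h4
      rw [Finset.sum_congr rfl h3, ← Finset.mul_sum]
      have h1' : ∑ j ∈ Finset.range (N + 1), (N.choose j : ℝ) * M ^ (N - j) = (M + 1) ^ N := by
        rw [add_comm M 1, add_pow]
        exact Finset.sum_congr rfl fun j _ => by rw [one_pow, one_mul, mul_comm]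
      rw [h1']
      push_cast
      ring
  have h3 : ∀ j ∈ Finset.range (N + 1), (N.choose j : ℝ) *
      (((k + j : ℕ) : ℝ) * M ^ (((k + N : ℕ) : ℤ) - ((k + j : ℕ) : ℤ) - 1)) =
      M⁻¹ * (k * ((N.choose j : ℝ) * M ^ (N - j)) + (N.choose j : ℝ) * (j * M ^ (N - j))) := by
    intro j hj
    have hj' : j ≤ N := Nat.lt_succ_iff.1 (Finset.mem_range.1 hj)
    have : ((k + N : ℕ) : ℤ) - ((k + j : ℕ) : ℤ) - 1 = ((N - j : ℕ) : ℤ) - 1 := by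
      push_cast [Nat.cast_sub hj']; ring
    rw [this, zpow_sub_one₀ hm0, zpow_natCast]
    push_cast
    ring
  rw [Finset.sum_congr rfl h3, ← Finset.mul_sum, Finset.sum_add_distrib, ← Finset.mul_sum, h1]
  have h4 : ((k + N + 1 : ℕ) : ℤ) - ((k + 1 : ℕ) : ℤ) - 1 = (N : ℤ) - 1 := by push_cast; ring
  have h5 : ((k + N + 1 : ℕ) : ℝ) = M + 1 := by rw [hM]; push_cast; ring
  rw [h5] at hm1
  rw [h4, h5, zpow_sub_one₀ hm1, zpow_natCast]
  rw [← Finset.sum_mul] at h2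
  rw [eq_div_of_mul_eq hm1 h2]
  field_simp
  rw [hM]
  push_cast
  ring

/-- Reaching m vertices from k roots takes at least m − k edges. Factoring out that power leaves a
function continuous at 0, whose value there counts forests. -/
theorem exists_spanProb_eq (m k : ℕ) (hk : k ≤ m) :
    ∃ c : ℝ → ℝ, Continuous c ∧ (∀ p, spanProb p m k = p ^ (m - k) * c p) ∧
      c 0 = forestCount m k := by
  induction m generalizing k with
  | zero =>
    obtain rfl : k = 0 := by omega
    exact ⟨fun _ => 1, continuous_const, fun p => by simp [spanProb], by simp [forestCount]⟩
  | succ m ih =>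
    rcases k with _ | k
    · exact ⟨fun _ => 0, continuous_const, fun p => by simp [spanProb], by simp [forestCount]⟩
    have hk' : k ≤ m := by omega
    choose! c hc using ih
    refine ⟨fun p => ∑ j ∈ Finset.range (m - k + 1),
      (m - k).choose j * ((1 - p) ^ (m - k - j) * c (k + j) p), ?_, ?_, ?_⟩
    · refine continuous_finsetSum _ fun j hj => ?_
      rw [Finset.mem_range] at hj
      have := (hc (k + j) (by omega)).1
      fun_prop
    · intro p
      rw [spanProb, Finset.mul_sum]
      refine Finset.sum_congr rfl fun j hj => ?_
      rw [Finset.mem_range] at hj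
      rw [(hc (k + j) (by omega)).2.1 p, Nat.add_sub_add_right,
        show m - k = j + (m - (k + j)) by omega, pow_add]
      ring
    · rw [← forestCount_succ hk']
      refine Finset.sum_congr rfl fun j hj => ?_
      rw [Finset.mem_range] at hj
      rw [(hc (k + j) (by omega)).2.2]
      simp

theorem spanProb_nonneg {p : ℝ} (h0 : 0 ≤ p) (h1 : p ≤ 1) (m k : ℕ) : 0 ≤ spanProb p m k := by
  induction m generalizing k with
  | zero => simp [spanProb]
  | succ m ih =>
    rcases k with _ | k
    · simp [spanProb]
    · rw [spanProb]
      have : 0 ≤ 1 - p := by linarith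
      exact Finset.sum_nonneg fun j _ => by have := ih (k + j); positivity

theorem expectedComps_nonneg {p : ℝ} (h0 : 0 ≤ p) (h1 : p ≤ 1) (n k : ℕ) :
    0 ≤ expectedComps n p k := by
  have := spanProb_nonneg h0 h1 (k + 1) 1
  have : 0 ≤ 1 - p := by linarith
  unfold expectedComps
  positivity

theorem tendsto_one_sub_pow {ι : Type*} {l : Filter ι} {p : ι → ℝ} {M : ι → ℕ} {y : ℝ}
    (hp : Tendsto p l (𝓝 0)) (hpM : Tendsto (fun i => p i * M i) l (𝓝 y)) :
    Tendsto (fun i => (1 - p i) ^ M i) l (𝓝 (Real.exp (-y))) := by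
  have hlt : ∀ᶠ i in l, p i < 1 := hp.eventually (gt_mem_nhds one_pos)
  have hinv : Tendsto (fun i => p i * M i / (1 - p i)) l (𝓝 y) := by
    have := hpM.div (hp.const_sub 1) (by norm_num)
    rwa [sub_zero, div_one] at this
  refine tendsto_of_tendsto_of_tendsto_of_le_of_le'
    (Real.continuous_exp.tendsto _ |>.comp hinv.neg)
    (Real.continuous_exp.tendsto _ |>.comp hpM.neg) ?_ ?_
  · filter_upwards [hlt] with i hi
    have hpos : 0 < 1 - p i := by linarith
    have h1 : Real.exp (-(p i / (1 - p i))) ≤ 1 - p i := by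
      rw [Real.exp_neg, inv_le_comm₀ (Real.exp_pos _) hpos]
      have := Real.add_one_le_exp (p i / (1 - p i))
      have h2 : (1 - p i)⁻¹ = p i / (1 - p i) + 1 := by field_simp; ring
      rw [h2]; exact this
    calc Real.exp (-(p i * M i / (1 - p i))) = Real.exp (-(p i / (1 - p i))) ^ M i := by
          rw [← Real.exp_nat_mul]; congr 1; ring
      _ ≤ _ := pow_le_pow_left₀ (Real.exp_pos _).le h1 _
  · filter_upwards [hlt] with i hi
    calc (1 - p i) ^ M i ≤ Real.exp (-p i) ^ M i :=
          pow_le_pow_left₀ (by linarith) (Real.one_sub_le_exp_neg _) _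
      _ = Real.exp (-(p i * M i)) := by rw [← Real.exp_nat_mul]; congr 1; ring

/-- The limiting density of components with `k + 1` vertices. -/
noncomputable def treeDensity (x : ℝ) (k : ℕ) : ℝ :=
  x ^ k * Real.exp (-x) ^ (k + 1) * (((k : ℝ) + 1) ^ ((k : ℤ) - 1) / (Nat.factorial (k + 1) : ℝ))

section Limit

variable {ι : Type*} {l : Filter ι} {p : ι → ℝ} {N : ι → ℕ} {x : ℝ}

theorem tendsto_choose_div_pow (hN : Tendsto N l atTop) (k : ℕ) :
    Tendsto (fun i => ((N i).choose k : ℝ) / (N i : ℝ) ^ k) l (𝓝 (1 / (Nat.factorial k : ℝ))) := by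
  have h : ∀ k : ℕ, Tendsto (fun n : ℕ => (n.descFactorial k : ℝ) / (n : ℝ) ^ k) atTop (𝓝 1) := by
    intro k
    induction k with
    | zero => simp
    | succ k ih =>
      have h1 : Tendsto (fun n : ℕ => ((n - k : ℕ) : ℝ) / n) atTop (𝓝 1) := by
        have h2 : Tendsto (fun n : ℕ => 1 - (k : ℝ) / n) atTop (𝓝 (1 - 0)) :=
          (tendsto_const_div_atTop_nhds_zero_nat (k : ℝ)).const_sub 1
        rw [sub_zero] at h2
        refine h2.congr' ?_
        filter_upwards [eventually_ge_atTop (k + 1)] with n hn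
        have : (n : ℝ) ≠ 0 := by have : n ≠ 0 := by omega
                                 exact_mod_cast this
        rw [Nat.cast_sub (by omega)]
        field_simp
      have h3 := h1.mul ih
      rw [one_mul] at h3
      refine h3.congr fun n => ?_
      rw [Nat.descFactorial_succ, Nat.cast_mul, pow_succ', mul_div_mul_comm]
  have h2 := ((h k).comp hN).div_const (Nat.factorial k : ℝ)
  refine h2.congr fun i => ?_
  have := Nat.descFactorial_eq_factorial_mul_choose (N i) k
  simp only [Function.comp_apply, this, Nat.cast_mul]
  have hk : (Nat.factorial k : ℝ) ≠ 0 := by positivity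
  field_simp

theorem tendsto_zero_of_tendsto_mul (hN : Tendsto N l atTop)
    (hp : Tendsto (fun i => (N i : ℝ) * p i) l (𝓝 x)) : Tendsto p l (𝓝 0) := by
  have h1 : Tendsto (fun i => (N i : ℝ)⁻¹) l (𝓝 0) :=
    tendsto_inv_atTop_zero.comp (tendsto_natCast_atTop_atTop.comp hN)
  have h2 := h1.mul hp
  rw [zero_mul] at h2
  refine h2.congr' ?_
  filter_upwards [hN.eventually_gt_atTop 0] with i hi
  have : (N i : ℝ) ≠ 0 := by exact_mod_cast hi.ne'
  field_simp

theorem tendsto_expectedComps_div (hN : Tendsto N l atTop)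
    (hp : Tendsto (fun i => (N i : ℝ) * p i) l (𝓝 x)) (k : ℕ) :
    Tendsto (fun i => expectedComps (N i) (p i) k / N i) l (𝓝 (treeDensity x k)) := by
  obtain ⟨c, hc, hcp, hc0⟩ := exists_spanProb_eq (k + 1) 1 (by omega)
  have hp0 := tendsto_zero_of_tendsto_mul hN hp
  have t1 := tendsto_choose_div_pow hN (k + 1)
  have t2 := hp.pow k
  have t3 : Tendsto (fun i => c (p i)) l (𝓝 (c 0)) := (hc.tendsto 0).comp hp0
  have t4 : Tendsto (fun i => (1 - p i) ^ ((k + 1) * (N i - (k + 1)))) l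
      (𝓝 (Real.exp (-(((k : ℝ) + 1) * x)))) := by
    refine tendsto_one_sub_pow hp0 ?_
    have h1 : Tendsto (fun i => ((k : ℝ) + 1) * ((N i : ℝ) * p i - (k + 1) * p i)) l
        (𝓝 (((k : ℝ) + 1) * (x - (k + 1) * 0))) := (hp.sub (hp0.const_mul _)).const_mul _
    rw [mul_zero, sub_zero] at h1
    refine h1.congr' ?_
    filter_upwards [hN.eventually_ge_atTop (k + 1)] with i hi
    push_cast [Nat.cast_sub hi]
    ring
  have t := ((t1.mul t2).mul t3).mul t4
  have hlim : 1 / (Nat.factorial (k + 1) : ℝ) * x ^ k * c 0 * Real.exp (-(((k : ℝ) + 1) * x)) =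
      treeDensity x k := by
    have e1 : Real.exp (-(((k : ℝ) + 1) * x)) = Real.exp (-x) ^ (k + 1) := by
      rw [← Real.exp_nat_mul]; congr 1; push_cast; ring
    have e2 : c 0 = ((k : ℝ) + 1) ^ ((k : ℤ) - 1) := by
      rw [hc0, forestCount, if_neg (Nat.succ_ne_zero k)]
      push_cast
      rw [one_mul]
      congr 1
      ring
    rw [e1, e2, treeDensity]
    ring
  rw [hlim] at t
  refine t.congr' ?_
  filter_upwards [hN.eventually_gt_atTop 0] with i hi
  have hNi : (N i : ℝ) ≠ 0 := by exact_mod_cast hi.ne'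
  rw [expectedComps, hcp, Nat.add_sub_cancel, mul_pow, pow_succ]
  field_simp

/-- At most n/(K + 1) disjoint components can have more than `K` vertices. The bound is uniform in
`q`, which justifies the termwise limit. -/
theorem sum_expectedComps_tail_le {q : ℝ} (h0 : 0 ≤ q) (h1 : q ≤ 1) (n K : ℕ) :
    |∑ k ∈ Finset.range n, expectedComps n q k - ∑ k ∈ Finset.range K, expectedComps n q k| ≤
      n / (K + 1) := by
  have hw : ∑ k ∈ Finset.range n, ((k : ℝ) + 1) * expectedComps n q k = n := by
    simpa using sum_mul_expectedComps (Fin n) q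
  have hnn := expectedComps_nonneg h0 h1 n
  rcases le_or_gt n K with h | h
  · have hz : ∑ k ∈ Finset.range K, expectedComps n q k = ∑ k ∈ Finset.range n,
        expectedComps n q k := by
      symm
      refine Finset.sum_subset (Finset.range_mono h) fun k _ hk => ?_
      rw [Finset.mem_range, not_lt] at hk
      rw [expectedComps, Nat.choose_eq_zero_of_lt (by omega)]
      simp
    rw [hz, sub_self, abs_zero]
    positivity
  · rw [← Finset.sum_range_add_sum_Ico _ h.le, add_sub_cancel_left,
      abs_of_nonneg (Finset.sum_nonneg fun k _ => hnn k), le_div_iff₀ (by positivity),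
      Finset.sum_mul]
    calc ∑ k ∈ Finset.Ico K n, expectedComps n q k * (K + 1)
        ≤ ∑ k ∈ Finset.Ico K n, ((k : ℝ) + 1) * expectedComps n q k := by
          refine Finset.sum_le_sum fun k hk => ?_
          rw [mul_comm]
          have : (K : ℝ) ≤ k := by exact_mod_cast (Finset.mem_Ico.1 hk).1
          exact mul_le_mul_of_nonneg_right (by linarith) (hnn k)
      _ ≤ ∑ k ∈ Finset.range n, ((k : ℝ) + 1) * expectedComps n q k := by
          refine Finset.sum_le_sum_of_subset_of_nonneg ?_ fun k _ _ =>
            mul_nonneg (by positivity) (hnn k)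
          intro k hk
          rw [Finset.mem_range]
          exact (Finset.mem_Ico.1 hk).2
      _ = n := hw

/-- Partial sums are limits of expected component counts divided by n in the random graph with edge
probability x/n, hence at most 1. -/
theorem summable_treeDensity (hx : 0 < x) : Summable (treeDensity x) := by
  have hN : Tendsto (fun n : ℕ => n) atTop atTop := tendsto_id
  have hp : Tendsto (fun n : ℕ => (n : ℝ) * (x / n)) atTop (𝓝 x) := by
    refine tendsto_const_nhds.congr' ?_
    filter_upwards [eventually_gt_atTop 0] with n hn
    have : (n : ℝ) ≠ 0 := by exact_mod_cast hn.ne'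
    field_simp
  have h0 : ∀ᶠ n : ℕ in atTop, 0 ≤ x / n := Eventually.of_forall fun n => by positivity
  have h1 : ∀ᶠ n : ℕ in atTop, x / n ≤ 1 :=
    ((tendsto_zero_of_tendsto_mul hN hp).eventually (gt_mem_nhds one_pos)).mono fun _ h => h.le
  refine summable_of_sum_range_le (c := 1) (fun k => by unfold treeDensity; positivity) fun K => ?_
  have hlim : Tendsto (fun n : ℕ => ∑ k ∈ Finset.range K, expectedComps n (x / n) k / n) atTop
      (𝓝 (∑ k ∈ Finset.range K, treeDensity x k)) :=
    tendsto_finsetSum _ fun k _ => tendsto_expectedComps_div hN hp k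
  refine le_of_tendsto hlim ?_
  filter_upwards [h0, h1, eventually_gt_atTop K] with n hn0 hn1 hnK
  have hw : ∑ k ∈ Finset.range n, ((k : ℝ) + 1) * expectedComps n (x / n) k = n := by
    simpa using sum_mul_expectedComps (Fin n) (x / n)
  have hnn := expectedComps_nonneg hn0 hn1 n
  rw [← Finset.sum_div]
  refine div_le_one_of_le₀ ?_ (Nat.cast_nonneg n)
  calc _ ≤ ∑ k ∈ Finset.range n, expectedComps n (x / n) k :=
        Finset.sum_le_sum_of_subset_of_nonneg (Finset.range_mono hnK.le) fun k _ _ => hnn k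
    _ ≤ ∑ k ∈ Finset.range n, ((k : ℝ) + 1) * expectedComps n (x / n) k :=
        Finset.sum_le_sum fun k _ => by nlinarith [hnn k, (Nat.cast_nonneg k : (0 : ℝ) ≤ k)]
    _ = n := hw

theorem tendsto_sum_expectedComps_div (hx : 0 < x) (hN : Tendsto N l atTop)
    (hp : Tendsto (fun i => (N i : ℝ) * p i) l (𝓝 x)) (h0 : ∀ᶠ i in l, 0 ≤ p i) :
    Tendsto (fun i => (∑ k ∈ Finset.range (N i), expectedComps (N i) (p i) k) / N i) l
      (𝓝 (∑' k, treeDensity x k)) := by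
  have h1 : ∀ᶠ i in l, p i ≤ 1 :=
    ((tendsto_zero_of_tendsto_mul hN hp).eventually (gt_mem_nhds one_pos)).mono fun _ h => h.le
  rw [Metric.tendsto_nhds]
  intro ε hε
  have hs := (summable_treeDensity hx).hasSum.tendsto_sum_nat
  have hK : Tendsto (fun K : ℕ => 1 / ((K : ℝ) + 1)) atTop (𝓝 0) :=
    tendsto_one_div_add_atTop_nhds_zero_nat
  obtain ⟨K, hK1, hK2⟩ := (((Metric.tendsto_nhds.1 hs) (ε / 3) (by positivity)).and
    (hK.eventually (gt_mem_nhds (show (0 : ℝ) < ε / 3 by positivity)))).exists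
  have hlim : Tendsto (fun i => ∑ k ∈ Finset.range K, expectedComps (N i) (p i) k / N i) l
      (𝓝 (∑ k ∈ Finset.range K, treeDensity x k)) :=
    tendsto_finsetSum _ fun k _ => tendsto_expectedComps_div hN hp k
  filter_upwards [h0, h1, hN.eventually_gt_atTop 0,
    (Metric.tendsto_nhds.1 hlim) (ε / 3) (by positivity)] with i hi0 hi1 hi hi3
  have hNi : (0 : ℝ) < N i := by exact_mod_cast hi
  have ht := sum_expectedComps_tail_le hi0 hi1 (N i) K
  rw [← Finset.sum_div] at hi3
  have ht' : |(∑ k ∈ Finset.range (N i), expectedComps (N i) (p i) k) / N i -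
      (∑ k ∈ Finset.range K, expectedComps (N i) (p i) k) / N i| ≤ 1 / ((K : ℝ) + 1) := by
    rw [← sub_div, abs_div, abs_of_pos hNi, div_le_iff₀ hNi]
    refine ht.trans_eq ?_
    ring
  rw [Real.dist_eq] at *
  rw [abs_lt] at *
  rw [abs_le] at ht'
  constructor <;> linarith [ht'.1, ht'.2, hi3.1, hi3.2, hK1.1, hK1.2]

end Limit

/-! ### The tree series and positivity of μ -/

/-- The generating function of unrooted labelled trees. -/
noncomputable def treeSeries (y : ℝ) : ℝ :=
  ∑' k : ℕ, y ^ (k + 1) * (((k : ℝ) + 1) ^ ((k : ℤ) - 1) / (Nat.factorial (k + 1) : ℝ))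

theorem mul_treeDensity (x : ℝ) (k : ℕ) : x * treeDensity x k =
    (x * Real.exp (-x)) ^ (k + 1) *
      (((k : ℝ) + 1) ^ ((k : ℤ) - 1) / (Nat.factorial (k + 1) : ℝ)) := by
  rw [treeDensity, mul_pow]
  ring

theorem mul_tsum_treeDensity (x : ℝ) :
    x * ∑' k, treeDensity x k = treeSeries (x * Real.exp (-x)) := by
  rw [← tsum_mul_left, treeSeries]
  exact tsum_congr (mul_treeDensity x)

theorem mul_genusMu {x : ℝ} (hx : x ≠ 0) :
    x * genusMu x = x / 2 - 1 + ∑' k, treeDensity x k := by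
  have h : genusMu x = 1 / 2 - 1 / x + 1 / x ^ 2 * treeSeries (x * Real.exp (-x)) := rfl
  rw [h, ← mul_tsum_treeDensity]
  field_simp

theorem comps_empty (α : Type) [Fintype α] : comps (∅ : Finset (Sym2 α)) = Fintype.card α := by
  rw [comps, ← SimpleGraph.finrank_locallyConstant]
  have : (SimpleGraph.fromEdgeSet ((∅ : Finset (Sym2 α)) : Set (Sym2 α))).locallyConstant = ⊤ := by
    rw [eq_top_iff]
    intro g _ u w h
    simp at h
  rw [this, finrank_top, Module.finrank_fintype_fun_eq_card]

/-- A graph has at least as many components as vertices minus edges. Taking means with edge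
probability x/n gives a component density of at least 1 − x/2. -/
theorem le_treeSeries {x : ℝ} (hx : 0 < x) :
    x - x ^ 2 / 2 ≤ treeSeries (x * Real.exp (-x)) := by
  have hN : Tendsto (fun n : ℕ => n) atTop atTop := tendsto_id
  have hp : Tendsto (fun n : ℕ => (n : ℝ) * (x / n)) atTop (𝓝 x) := by
    refine tendsto_const_nhds.congr' ?_
    filter_upwards [eventually_gt_atTop 0] with n hn
    have : (n : ℝ) ≠ 0 := by exact_mod_cast hn.ne'
    field_simp
  have h0 : ∀ᶠ n : ℕ in atTop, 0 ≤ x / n := Eventually.of_forall fun n => by positivity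
  have h1 : ∀ᶠ n : ℕ in atTop, x / n ≤ 1 :=
    ((tendsto_zero_of_tendsto_mul hN hp).eventually (gt_mem_nhds one_pos)).mono fun _ h => h.le
  have hlim := tendsto_sum_expectedComps_div hx hN hp h0
  have key : 1 - x / 2 ≤ ∑' k, treeDensity x k := by
    refine ge_of_tendsto hlim ?_
    filter_upwards [h0, h1, eventually_gt_atTop 0] with n hn0 hn1 hn
    have hn' : (0 : ℝ) < n := by exact_mod_cast hn
    rw [le_div_iff₀ hn']
    have e1 := subsetExp_comps (α := Fin n) (x / n)
    rw [Fintype.card_fin] at e1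
    rw [← e1]
    have e2 := subsetExp_mono hn0 hn1 (E := pairs (Finset.univ : Finset (Fin n)))
      (f := fun A => (n : ℝ) - (A.card.choose 1 : ℝ)) (g := fun A => (comps A : ℝ)) fun A _ => by
        have := isEdgeLipschitz_comps.le_union_add (∅ : Finset (Sym2 (Fin n))) A
        rw [Finset.empty_union, comps_empty, Fintype.card_fin] at this
        rw [Nat.choose_one_right]
        linarith
    rw [subsetExp_sub, subsetExp_const, subsetExp_choose, card_pairs, Finset.card_univ,
      Fintype.card_fin, Nat.choose_one_right, Nat.cast_choose_two] at e2
    refine le_trans ?_ e2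
    rw [pow_one]
    field_simp
    nlinarith
  rw [← mul_tsum_treeDensity]
  nlinarith

theorem treeSeries_mono {t x : ℝ} (ht : 0 < t) (hx : 0 < x)
    (h : t * Real.exp (-t) ≤ x * Real.exp (-x)) :
    treeSeries (t * Real.exp (-t)) ≤ treeSeries (x * Real.exp (-x)) := by
  rw [← mul_tsum_treeDensity, ← mul_tsum_treeDensity, ← tsum_mul_left, ← tsum_mul_left]
  refine Summable.tsum_le_tsum (fun k => ?_) ((summable_treeDensity ht).mul_left t)
    ((summable_treeDensity hx).mul_left x)
  rw [mul_treeDensity, mul_treeDensity]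
  have := pow_le_pow_left₀ (by positivity) h (k + 1)
  gcongr

/-- After taking logarithms this is log(1 + s) − log(1 − s) > 2s, read off from the first two terms
of the series. -/
theorem sub_mul_exp_lt {s : ℝ} (hs : 0 < s) (hs1 : s < 1) :
    (1 - s) * Real.exp (-(1 - s)) < (1 + s) * Real.exp (-(1 + s)) := by
  have h := Real.hasSum_log_sub_log_of_abs_lt_one (x := s) (by rw [abs_of_pos hs]; exact hs1)
  have h2 : 2 * s < Real.log (1 + s) - Real.log (1 - s) := by
    have h3 := sum_le_hasSum (Finset.range 2) (fun k _ => by positivity) h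
    simp [Finset.sum_range_succ] at h3
    have : 0 < s ^ 3 := by positivity
    linarith
  have e1 : (1 - s) * Real.exp (-(1 - s)) = Real.exp (Real.log (1 - s) - (1 - s)) := by
    rw [sub_eq_add_neg (Real.log _), Real.exp_add, Real.exp_log (by linarith)]
  have e2 : (1 + s) * Real.exp (-(1 + s)) = Real.exp (Real.log (1 + s) - (1 + s)) := by
    rw [sub_eq_add_neg (Real.log _), Real.exp_add, Real.exp_log (by linarith)]
  rw [e1, e2, Real.exp_lt_exp]
  linarith

/-- Comparing the tree series at x·exp(−x) with its lower bound at t·exp(−t) gives x²μ(x) ≥ (x −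
t)(x + t − 2)/2, which is positive when 2 − x < t < 1 < x. -/
theorem genusMu_pos {x : ℝ} (hx : 1 < x) : 0 < genusMu x := by
  have hx0 : 0 < x := by linarith
  obtain ⟨t, ht0, ht1, ht2, ht⟩ : ∃ t, 0 < t ∧ t < 1 ∧ 2 - x < t ∧
      t * Real.exp (-t) ≤ x * Real.exp (-x) := by
    -- For x < 2 the point 2 − x satisfies the comparison strictly, so a slightly larger t still
    -- does. For x ≥ 2 any small positive t works.
    rcases lt_or_ge x 2 with h2 | h2
    · have hlt := sub_mul_exp_lt (s := x - 1) (by linarith) (by linarith)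
      rw [show 1 - (x - 1) = 2 - x by ring, show 1 + (x - 1) = x by ring] at hlt
      have hcont : Continuous fun t : ℝ => t * Real.exp (-t) := by fun_prop
      have hev : ∀ᶠ t in 𝓝[>] (2 - x), t * Real.exp (-t) < x * Real.exp (-x) :=
        (hcont.tendsto (2 - x)).mono_left nhdsWithin_le_nhds |>.eventually (gt_mem_nhds hlt)
      have hev2 : ∀ᶠ t in 𝓝[>] (2 - x), t < 1 :=
        nhdsWithin_le_nhds (gt_mem_nhds (by linarith))
      obtain ⟨t, ⟨h3, h4⟩, h5⟩ := ((hev.and hev2).and self_mem_nhdsWithin).exists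
      have h5 : 2 - x < t := h5
      exact ⟨t, by linarith, h4, h5, h3.le⟩
    · refine ⟨min (1 / 2) (x * Real.exp (-x)), by positivity, ?_, ?_, ?_⟩
      · exact (min_le_left _ _).trans_lt (by norm_num)
      · have : 0 < min (1 / 2) (x * Real.exp (-x)) := by positivity
        linarith
      · refine (mul_le_of_le_one_right (by positivity) ?_).trans (min_le_right _ _)
        rw [Real.exp_le_one_iff]
        have : 0 < min (1 / 2) (x * Real.exp (-x)) := by positivity
        linarith
  have h1 := (le_treeSeries ht0).trans (treeSeries_mono ht0 hx0 ht)
  have h2 : genusMu x = 1 / 2 - 1 / x + 1 / x ^ 2 * treeSeries (x * Real.exp (-x)) := rfl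
  have h3 : x ^ 2 * genusMu x = x ^ 2 / 2 - x + treeSeries (x * Real.exp (-x)) := by
    rw [h2]; field_simp
  have h4 : 0 < x ^ 2 * genusMu x := by rw [h3]; nlinarith
  exact pos_of_mul_pos_right h4 (by positivity)

end TreeSeries

/-! ### Moment bounds for core sets, multiple edges and the cyclomatic number -/

section Moments

variable {α β : Type}

section CoreSets

variable [DecidableEq α] [DecidableEq β]

theorem IsCoreSet.two_mul_card_image_le {A : Finset (α × β)} (hA : IsCoreSet A) :
    2 * (A.image Prod.fst).card ≤ A.card ∧ 2 * (A.image Prod.snd).card ≤ A.card := by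
  constructor
  · refine Finset.mul_card_image_le_card _ 2 fun a ha => ?_
    obtain ⟨i, hi, rfl⟩ := Finset.mem_image.1 ha
    obtain ⟨j, hj, hne, h⟩ := (hA i hi).1
    rw [← Finset.card_pair hne]
    refine Finset.card_le_card fun x hx => ?_
    rcases Finset.mem_insert.1 hx with rfl | hx
    · simp [hj, h]
    · simp [Finset.mem_singleton.1 hx, hi]
  · refine Finset.mul_card_image_le_card _ 2 fun a ha => ?_
    obtain ⟨i, hi, rfl⟩ := Finset.mem_image.1 ha
    obtain ⟨j, hj, hne, h⟩ := (hA i hi).2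
    rw [← Finset.card_pair hne]
    refine Finset.card_le_card fun x hx => ?_
    rcases Finset.mem_insert.1 hx with rfl | hx
    · simp [hj, h]
    · simp [Finset.mem_singleton.1 hx, hi]

variable [Fintype α] [Fintype β]

theorem exists_factor_of_card_image_le {ι γ : Type} [Fintype ι] [DecidableEq γ] (f : ι → γ)
    {h : ℕ} (hι : Nonempty ι) (hf : (Finset.univ.image f).card ≤ h) :
    ∃ (w : ι → Fin h) (u : Fin h → γ), ∀ i, u (w i) = f i := by
  classical
  obtain ⟨i₀⟩ := hι
  obtain ⟨e⟩ : Nonempty ((Finset.univ.image f : Finset γ) ↪ Fin h) :=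
    Function.Embedding.nonempty_of_card_le (by simpa using hf)
  refine ⟨fun i => e ⟨f i, by simp⟩, Function.extend e Subtype.val fun _ => f i₀, fun i => ?_⟩
  rw [e.injective.extend_apply]

/-- A core set with `m` edges has at most m/2 vertices on each side. It is encoded by a list of m/2
vertices for each side and, for each edge, the positions of its endpoints. -/
theorem card_coreSets_le {m : ℕ} (hm : 0 < m) (S : Finset (Finset (α × β)))
    (hS : ∀ A ∈ S, A.card = m ∧ IsCoreSet A) :
    S.card ≤ (m / 2) ^ (2 * m) * (Fintype.card α * Fintype.card β) ^ (m / 2) := by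
  set h := m / 2
  let Φ : ((Fin m → Fin h) × (Fin h → α)) × ((Fin m → Fin h) × (Fin h → β)) →
      Finset (α × β) := fun q => Finset.univ.image fun i => (q.1.2 (q.1.1 i), q.2.2 (q.2.1 i))
  have hsub : S ⊆ Finset.univ.image Φ := by
    intro A hA
    obtain ⟨hcard, hcore⟩ := hS A hA
    let f : Fin m → α × β := fun i => (A.equivFinOfCardEq hcard).symm i
    have hf : Finset.univ.image f = A := by
      ext x
      simp only [Finset.mem_image, Finset.mem_univ, true_and, f]
      constructor
      · rintro ⟨i, rfl⟩; exact Subtype.property _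
      · intro hx
        exact ⟨A.equivFinOfCardEq hcard ⟨x, hx⟩, by simp⟩
    obtain ⟨h1, h2⟩ := hcore.two_mul_card_image_le
    have hne : Nonempty (Fin m) := ⟨⟨0, hm⟩⟩
    obtain ⟨w, u, hu⟩ := exists_factor_of_card_image_le (h := h) (fun i => (f i).1) hne (by
      have : Finset.univ.image (fun i => (f i).1) = A.image Prod.fst := by
        rw [← hf, Finset.image_image]; rfl
      rw [this]; omega)
    obtain ⟨w', u', hu'⟩ := exists_factor_of_card_image_le (h := h) (fun i => (f i).2) hne (by
      have : Finset.univ.image (fun i => (f i).2) = A.image Prod.snd := by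
        rw [← hf, Finset.image_image]; rfl
      rw [this]; omega)
    refine Finset.mem_image.2 ⟨((w, u), (w', u')), Finset.mem_univ _, ?_⟩
    simp only [Φ, hu, hu']
    exact hf
  refine (Finset.card_le_card hsub).trans (Finset.card_image_le.trans_eq ?_)
  simp only [Finset.card_univ, Fintype.card_prod, Fintype.card_fun, Fintype.card_fin]
  ring

/-- The factor (n₁n₂)^(m/2) of the count is absorbed by p^m, so the bound does not depend on the
sizes of the classes. -/
theorem subsetExp_smallCores_le {p d : ℝ} (h0 : 0 ≤ p)
    (hd : p * Real.sqrt ((Fintype.card α : ℝ) * Fintype.card β) = d)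
    (hcard : 1 ≤ Fintype.card α * Fintype.card β) (L : ℕ) :
    subsetExp p (Finset.univ : Finset (α × β)) (fun F => ((smallCores F L).card : ℝ)) ≤
      ∑ m ∈ Finset.range (L + 1), (m : ℝ) ^ (2 * m) * d ^ m := by
  classical
  set S := (Finset.univ : Finset (Finset (α × β))).filter fun A =>
    A.Nonempty ∧ A.card ≤ L ∧ IsCoreSet A
  have e1 : ∀ F : Finset (α × β), ((smallCores F L).card : ℝ) = ∑ A ∈ S with A ⊆ F, 1 := by
    intro F
    rw [Finset.sum_const, nsmul_eq_mul, mul_one]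
    congr 2
    ext A
    simp only [smallCores, S, Finset.mem_filter, Finset.mem_powerset, Finset.mem_univ, true_and]
    tauto
  rw [subsetExp_congr fun F _ => e1 F,
    subsetExp_sum_subset S (fun B _ => Finset.subset_univ B) (fun _ => 1)]
  have e2 : ∑ B ∈ S, 1 * p ^ B.card =
      ∑ m ∈ Finset.range (L + 1), ((S.filter fun A => A.card = m).card : ℝ) * p ^ m := by
    rw [← Finset.sum_fiberwise_of_maps_to (g := Finset.card) (t := Finset.range (L + 1))]
    · refine Finset.sum_congr rfl fun m _ => ?_
      rw [Finset.sum_congr rfl fun B hB => by rw [(Finset.mem_filter.1 hB).2, one_mul]]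
      simp
    · intro A hA
      have := (Finset.mem_filter.1 hA).2.2.1
      rw [Finset.mem_range]; omega
  rw [e2]
  refine Finset.sum_le_sum fun m _ => ?_
  rcases Nat.eq_zero_or_pos m with rfl | hm
  · have : (S.filter fun A => A.card = 0) = ∅ := by
      ext A
      simp only [S, Finset.mem_filter, Finset.notMem_empty, iff_false]
      rintro ⟨⟨-, hne, -⟩, h⟩
      exact hne.ne_empty (Finset.card_eq_zero.1 h)
    rw [this]
    simp
  · have hc := card_coreSets_le hm (S.filter fun A => A.card = m) fun A hA => by
      simp only [S, Finset.mem_filter] at hA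
      exact ⟨hA.2, hA.1.2.2.2⟩
    set s := Real.sqrt ((Fintype.card α : ℝ) * Fintype.card β)
    have hcard' : (1 : ℝ) ≤ (Fintype.card α : ℝ) * Fintype.card β := by exact_mod_cast hcard
    -- Needed for odd `m`, where 2⌊m/2⌋ is smaller than m.
    have hs : 1 ≤ s := by
      rw [show (1 : ℝ) = Real.sqrt 1 by simp]
      exact Real.sqrt_le_sqrt hcard'
    have hss : (Fintype.card α : ℝ) * Fintype.card β = s ^ 2 := by
      rw [Real.sq_sqrt (by linarith)]
    calc ((S.filter fun A => A.card = m).card : ℝ) * p ^ m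
        ≤ (((m / 2) ^ (2 * m) * (Fintype.card α * Fintype.card β) ^ (m / 2) : ℕ) : ℝ) * p ^ m :=
          mul_le_mul_of_nonneg_right (by exact_mod_cast hc) (by positivity)
      _ = ((m / 2 : ℕ) : ℝ) ^ (2 * m) * s ^ (2 * (m / 2)) * p ^ m := by
          push_cast
          rw [hss, pow_mul s]
      _ ≤ (m : ℝ) ^ (2 * m) * s ^ m * p ^ m := by
          gcongr
          · exact Nat.div_le_self m 2
          · exact Nat.mul_div_le m 2
      _ = (m : ℝ) ^ (2 * m) * d ^ m := by
          rw [mul_assoc, ← mul_pow, mul_comm s, hd]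

end CoreSets

variable [Fintype α] [Fintype β]

theorem card_filter_snd_eq [DecidableEq α] [DecidableEq β] (i : α × β) :
    ((Finset.univ : Finset (α × β)).filter fun j => j ≠ i ∧ j.2 = i.2).card ≤
      Fintype.card α := by
  refine Finset.card_le_card_of_injOn Prod.fst (t := Finset.univ) (fun _ _ => by simp) ?_
  intro j hj k hk h
  simp only [Finset.coe_filter, Set.mem_ofPred_eq] at hj hk
  exact Prod.ext h (hj.2.2.trans hk.2.2.symm)

theorem subsetExp_multiEdges_le [DecidableEq α] [DecidableEq β] {p : ℝ} (h0 : 0 ≤ p)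
    (h1 : p ≤ 1) :
    subsetExp p (Finset.univ : Finset (α × β)) (fun F => ((multiEdges F).card : ℝ)) ≤
      (Fintype.card α : ℝ) ^ 2 * Fintype.card β * p ^ 2 := by
  set T : α × β → Finset (α × β) := fun i => Finset.univ.filter fun j => j ≠ i ∧ j.2 = i.2
  have e1 : ∀ F : Finset (α × β), ((multiEdges F).card : ℝ) ≤
      ∑ i, ∑ j ∈ T i, if {i, j} ⊆ F then 1 else 0 := by
    intro F
    have : ((multiEdges F).card : ℝ) = ∑ i, if i ∈ multiEdges F then 1 else 0 := by
      simp
    rw [this]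
    refine Finset.sum_le_sum fun i _ => ?_
    split_ifs with hi
    · simp only [multiEdges, Finset.mem_filter] at hi
      obtain ⟨hiF, j, hj, h⟩ := hi
      refine le_trans ?_ (Finset.single_le_sum (f := fun j => if {i, j} ⊆ F then (1 : ℝ) else 0)
        (fun j _ => by positivity) (show j ∈ T i by simpa [T] using h))
      rw [if_pos (by simp [Finset.insert_subset_iff, hiF, hj])]
    · exact Finset.sum_nonneg fun j _ => by positivity
  refine (subsetExp_mono h0 h1 fun F _ => e1 F).trans ?_
  rw [subsetExp_sum]
  have e2 : ∀ i : α × β, subsetExp p (Finset.univ : Finset (α × β))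
      (fun F => ∑ j ∈ T i, if {i, j} ⊆ F then (1 : ℝ) else 0) ≤ Fintype.card α * p ^ 2 := by
    intro i
    rw [subsetExp_sum]
    have e3 : ∀ j ∈ T i, subsetExp p (Finset.univ : Finset (α × β))
        (fun F => if {i, j} ⊆ F then (1 : ℝ) else 0) = p ^ 2 := by
      intro j hj
      simp only [T, Finset.mem_filter] at hj
      rw [subsetExp_subset_indicator (Finset.subset_univ _), Finset.card_pair hj.2.1.symm]
    rw [Finset.sum_congr rfl e3, Finset.sum_const, nsmul_eq_mul]
    have := card_filter_snd_eq i
    gcongr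
  refine (Finset.sum_le_sum fun i _ => e2 i).trans_eq ?_
  simp only [Finset.sum_const, Finset.card_univ, Fintype.card_prod, nsmul_eq_mul]
  push_cast
  ring

/-- The cyclomatic number of the bipartite graph with edge set `F`. -/
noncomputable def betti (F : Finset (α × β)) : ℝ := Module.finrank ℚ (circulations F)

/-- In Efron–Stein the increment for an edge is at most 1, and it vanishes unless another edge is
already present at the same right endpoint, which has probability at most n₁p. -/
theorem variance_betti_le [DecidableEq α] [DecidableEq β] {p : ℝ} (h0 : 0 ≤ p) (h1 : p ≤ 1) :
    subsetExp p (Finset.univ : Finset (α × β)) (fun F => betti F ^ 2) -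
      subsetExp p (Finset.univ : Finset (α × β)) betti ^ 2 ≤
      (Fintype.card α : ℝ) ^ 2 * Fintype.card β * p ^ 2 := by
  refine (subsetExp_variance_le h0 h1).trans ?_
  have e1 : ∀ i : α × β, subsetExp p (Finset.univ : Finset (α × β))
      (fun F => (betti (insert i F) - betti F) ^ 2) ≤ Fintype.card α * p := by
    intro i
    set T : Finset (α × β) := Finset.univ.filter fun j => j ≠ i ∧ j.2 = i.2
    have e2 : ∀ F : Finset (α × β), (betti (insert i F) - betti F) ^ 2 ≤
        ∑ j ∈ T, if {j} ⊆ F then 1 else 0 := by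
      intro F
      by_cases hi : i ∈ F
      · simp [Finset.insert_eq_of_mem hi]
      by_cases hF : ∀ j ∈ F, j.2 ≠ i.2
      · rw [betti, betti, circulations_insert_eq F i hF]
        simp
      · push Not at hF
        obtain ⟨j, hj, hji⟩ := hF
        have hT : j ∈ T := by
          simp only [T, Finset.mem_filter, Finset.mem_univ, true_and]
          exact ⟨fun h => hi (h ▸ hj), hji⟩
        have h2 : (1 : ℝ) ≤ ∑ j ∈ T, if {j} ⊆ F then 1 else 0 := by
          refine le_trans ?_ (Finset.single_le_sum (f := fun j => if {j} ⊆ F then (1 : ℝ) else 0)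
            (fun j _ => by positivity) hT)
          rw [if_pos (by simpa using hj)]
        have h3 : betti F ≤ betti (insert i F) := by
          unfold betti
          exact_mod_cast Submodule.finrank_mono (circulations_mono (Finset.subset_insert i F))
        have h4 : betti (insert i F) ≤ betti F + 1 := by
          unfold betti
          exact_mod_cast finrank_circulations_insert_le F i
        nlinarith
    refine (subsetExp_mono h0 h1 fun F _ => e2 F).trans ?_
    rw [subsetExp_sum]
    rw [Finset.sum_congr rfl fun j _ => subsetExp_subset_indicator (Finset.subset_univ {j})]
    simp only [Finset.card_singleton, pow_one, Finset.sum_const, nsmul_eq_mul]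
    have := card_filter_snd_eq i
    gcongr
  refine (mul_le_mul_of_nonneg_left (Finset.sum_le_sum fun i _ => e1 i) h0).trans_eq ?_
  simp only [Finset.sum_const, Finset.card_univ, Fintype.card_prod, nsmul_eq_mul]
  push_cast
  ring

theorem subsetExp_abs_betti_sub_le [DecidableEq α] [DecidableEq β] {p : ℝ} (h0 : 0 ≤ p)
    (h1 : p ≤ 1) :
    subsetExp p (Finset.univ : Finset (α × β))
      (fun F => |betti F - subsetExp p (Finset.univ : Finset (α × β)) betti|) ≤
      Real.sqrt ((Fintype.card α : ℝ) ^ 2 * Fintype.card β * p ^ 2) := by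
  set m := subsetExp p (Finset.univ : Finset (α × β)) betti
  refine Real.le_sqrt_of_sq_le ((sq_subsetExp_le h0 h1).trans (le_trans (le_of_eq ?_)
    (variance_betti_le h0 h1)))
  have : ∀ F : Finset (α × β), |betti F - m| ^ 2 = betti F ^ 2 - (2 * m) * betti F + m ^ 2 := by
    intro F
    rw [sq_abs]
    ring
  rw [subsetExp_congr fun F _ => this F, subsetExp_add, subsetExp_sub, subsetExp_const_mul,
    subsetExp_const]
  ring

theorem subsetExp_leftNbrs [DecidableEq α] [DecidableEq β] (p : ℝ) (b : β)
    (h : Finset α → ℝ) :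
    subsetExp p (Finset.univ : Finset (α × β)) (fun F => h (leftNbrs F b)) =
      subsetExp p (Finset.univ : Finset α) h := by
  have hsplit : (Finset.univ : Finset (α × β)) =
      (Finset.univ.image fun a : α => (a, b)) ∪ Finset.univ.filter fun i => i.2 ≠ b := by
    ext ⟨a, b'⟩
    simp only [Finset.mem_univ, Finset.mem_union, Finset.mem_image, Prod.mk.injEq, true_and,
      exists_eq_left, Finset.mem_filter, true_iff]
    by_cases hb : b = b'
    · exact Or.inl hb
    · exact Or.inr (Ne.symm hb)
  have hdisj : Disjoint (Finset.univ.image fun a : α => (a, b))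
      ((Finset.univ : Finset (α × β)).filter fun i => i.2 ≠ b) := by
    rw [Finset.disjoint_left]
    rintro _ hx hx'
    obtain ⟨a, -, rfl⟩ := Finset.mem_image.1 hx
    exact (Finset.mem_filter.1 hx').2 rfl
  rw [hsplit, subsetExp_union hdisj, subsetExp_image (fun a a' h => congrArg Prod.fst h)]
  refine subsetExp_congr fun I _ => ?_
  have : ∀ Y ⊆ (Finset.univ : Finset (α × β)).filter (fun i => i.2 ≠ b),
      h (leftNbrs (I.image (fun a => (a, b)) ∪ Y) b) = h I := by
    intro Y hY
    congr 1
    ext a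
    rw [mem_leftNbrs, Finset.mem_union]
    constructor
    · rintro (h | h)
      · simpa using h
      · exact absurd rfl (Finset.mem_filter.1 (hY h)).2
    · intro h
      exact Or.inl (Finset.mem_image_of_mem _ h)
  rw [subsetExp_congr this, subsetExp_const]

/-- With n − 1 ≤ C(n, 2) this replaces the truncated degree minus one by the number of pairs of
neighbours, at the cost of the number of triples. -/
theorem Nat.choose_two_le_pred_add_choose_three (n : ℕ) : n.choose 2 ≤ n - 1 + n.choose 3 := by
  induction n with
  | zero => simp
  | succ n ih =>
    rw [Nat.choose_succ_succ' n 1, Nat.choose_succ_succ' n 2, Nat.choose_one_right]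
    simp only [Nat.reduceAdd]
    rcases n with _ | n
    · simp
    · have : 1 ≤ (n + 1).choose 2 ∨ n = 0 := by
        rcases n with _ | n
        · exact Or.inr rfl
        · exact Or.inl (Nat.choose_pos (by omega))
      rcases this with h | rfl
      · omega
      · simp

theorem Nat.pred_le_choose_two (n : ℕ) : n - 1 ≤ n.choose 2 := by
  induction n with
  | zero => simp
  | succ n ih =>
    rw [Nat.choose_succ_succ' n 1, Nat.choose_one_right]
    omega

theorem abs_subsetExp_betti_sub_le [DecidableEq α] [DecidableEq β] {p : ℝ} (h0 : 0 ≤ p)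
    (h1 : p ≤ 1) :
    |subsetExp p (Finset.univ : Finset (α × β)) betti -
      (Fintype.card β * ((Fintype.card α).choose 2 * p ^ 2) - Fintype.card α +
        ∑ k ∈ Finset.range (Fintype.card α), expectedComps (Fintype.card α)
          (1 - (1 - p ^ 2) ^ Fintype.card β) k)| ≤
      Fintype.card β * ((Fintype.card α).choose 3 * p ^ 3) +
        Fintype.card β * replacementError (Fintype.card α) p := by
  have hc := abs_subsetExp_comps_projection_sub_le (α := α) (β := β) h0 h1
  rw [subsetExp_comps] at hc
  have hb : ∀ F : Finset (α × β), betti F =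
      ∑ b, (((leftNbrs F b).card - 1 : ℕ) : ℝ) - Fintype.card α + comps (projection F) := by
    intro F
    have : (Module.finrank ℚ (circulations F) : ℝ) + Fintype.card α =
      ∑ b, (((leftNbrs F b).card - 1 : ℕ) : ℝ) + comps (projection F) := by
      exact_mod_cast finrank_circulations F
    rw [betti]
    linarith
  rw [subsetExp_congr fun F _ => hb F, subsetExp_add, subsetExp_sub, subsetExp_const,
    subsetExp_sum]
  have hdeg : ∀ b : β, |subsetExp p (Finset.univ : Finset (α × β))
      (fun F => (((leftNbrs F b).card - 1 : ℕ) : ℝ)) - (Fintype.card α).choose 2 * p ^ 2| ≤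
      (Fintype.card α).choose 3 * p ^ 3 := by
    intro b
    rw [subsetExp_leftNbrs p b (fun I => ((I.card - 1 : ℕ) : ℝ)), ← Finset.card_univ,
      ← subsetExp_choose, ← subsetExp_choose, ← subsetExp_sub]
    refine abs_subsetExp_le h0 h1 fun I _ => ?_
    have e1 : (I.card.choose 2 : ℝ) ≤ ((I.card - 1 : ℕ) : ℝ) + I.card.choose 3 := by
      exact_mod_cast Nat.choose_two_le_pred_add_choose_three I.card
    have e2 : ((I.card - 1 : ℕ) : ℝ) ≤ I.card.choose 2 := by
      exact_mod_cast Nat.pred_le_choose_two I.card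
    rw [abs_le]
    constructor <;> linarith [(Nat.cast_nonneg (I.card.choose 3) : (0 : ℝ) ≤ _)]
  have hsum : |∑ b : β, subsetExp p (Finset.univ : Finset (α × β))
      (fun F => (((leftNbrs F b).card - 1 : ℕ) : ℝ)) -
        Fintype.card β * ((Fintype.card α).choose 2 * p ^ 2)| ≤
      Fintype.card β * ((Fintype.card α).choose 3 * p ^ 3) := by
    have e : (Fintype.card β : ℝ) * ((Fintype.card α).choose 2 * p ^ 2) =
        ∑ b : β, ((Fintype.card α).choose 2 : ℝ) * p ^ 2 := by simp
    rw [e, ← Finset.sum_sub_distrib]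
    refine (Finset.abs_sum_le_sum_abs _ _).trans ((Finset.sum_le_sum fun b _ => hdeg b).trans_eq ?_)
    simp
  rw [abs_le] at *
  constructor <;> linarith [hsum.1, hsum.2, hc.1, hc.2]

end Moments

/-! ### The random graph measure as a finite sum -/

section Law

open scoped Classical in
theorem SimpleGraph.bipartiteRandom_real_apply (a b : ℕ) (p : unitInterval)
    (S : Set (SimpleGraph (Fin a ⊕ Fin b))) :
    (SimpleGraph.bipartiteRandom a b p).real S =
      subsetExp (p : ℝ) (Finset.univ : Finset (Fin a × Fin b))
        (fun F => if bipGraph F ∈ S then 1 else 0) := by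
  set u := (completeBipartiteGraph (Fin a) (Fin b)).edgeSet with hu
  let φ : Fin a × Fin b → Sym2 (Fin a ⊕ Fin b) := fun i => s(Sum.inl i.1, Sum.inr i.2)
  have hφ : Function.Injective φ := by
    rintro ⟨x, y⟩ ⟨x', y'⟩ h
    simpa [φ] using h
  have hrange : Set.range φ = u := by
    ext e
    induction e using Sym2.ind with
    | _ v w => rcases v with v | v <;> rcases w with w | w <;> simp [φ, hu]
  -- Every set of graphs is measurable, since its image under `edgeSet` is a finite set.
  have hmeas : MeasurableSet S := by
    have h := SimpleGraph.measurableEmbedding_edgeSet (V := Fin a ⊕ Fin b)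
    rw [← h.measurableSet_image]
    exact (Set.toFinite _).measurableSet
  rw [SimpleGraph.bipartiteRandom, map_measureReal_apply SimpleGraph.measurable_fromEdgeSet hmeas]
  set μ := setBernoulli u p
  set T := (SimpleGraph.fromEdgeSet : Set (Sym2 (Fin a ⊕ Fin b)) → _) ⁻¹' S
  have h1 : μ.real T = ∑ s : Set (Sym2 (Fin a ⊕ Fin b)), if s ∈ T then μ.real {s} else 0 := by
    rw [← Finset.sum_filter, sum_measureReal_singleton]
    congr 1
    ext s
    simp
  have hcard : ∀ F : Finset (Fin a × Fin b), (φ '' F).ncard = F.card := fun F => by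
    rw [Set.ncard_image_of_injective _ hφ, Set.ncard_coe_finset]
  have hucard : u.ncard = Fintype.card (Fin a × Fin b) := by
    rw [← hrange, ← Set.image_univ, Set.ncard_image_of_injective _ hφ, Set.ncard_univ,
      Nat.card_eq_fintype_card]
  rw [h1, subsetExp]
  symm
  refine Finset.sum_of_injOn (fun F : Finset (Fin a × Fin b) => φ '' (F : Set (Fin a × Fin b)))
    ?_ ?_ ?_ ?_
  · intro F _ F' _ h
    exact Finset.coe_injective (hφ.image_injective h)
  · intro F _
    simp
  · intro s _ hs
    have hsu : ¬ s ⊆ u := by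
      intro hsu
      apply hs
      refine ⟨Finset.univ.filter fun i => φ i ∈ s, by simp, ?_⟩
      ext e
      constructor
      · rintro ⟨i, hi, rfl⟩
        simpa using hi
      · intro he
        obtain ⟨i, rfl⟩ := hrange.symm.subset (hsu he)
        exact ⟨i, by simpa using he, rfl⟩
    have : μ.real {s} = 0 := by
      rw [measureReal_def, setBernoulli_singleton_of_not_subset p hsu]
      rfl
    simp [this]
  · intro F _
    have hsub : φ '' (F : Set (Fin a × Fin b)) ⊆ u := by
      rw [← hrange]
      exact Set.image_subset_range _ _
    have hmem : φ '' (F : Set (Fin a × Fin b)) ∈ T ↔ bipGraph F ∈ S := Iff.rfl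
    simp only [hmem]
    by_cases h : bipGraph F ∈ S
    · rw [if_pos h, if_pos h, mul_one, setBernoulli_real_singleton p hsub (Set.toFinite _),
        Set.ncard_sdiff hsub, hcard, hucard, Finset.card_univ]
    · rw [if_neg h, if_neg h, mul_zero]

end Law

/-! ### The genus against half the cyclomatic number -/

section Concentration

theorem betti_sub_two_mul_genus_le {a b : ℕ} (hab : 2 ≤ a + b) (F : Finset (Fin a × Fin b))
    (L : ℕ) : 0 ≤ betti F - 2 * (bipGraph F).genus ∧
      betti F - 2 * (bipGraph F).genus ≤
        1 + 2 * (smallCores F L).card + 2 / ((L : ℝ) + 1) * (multiEdges F).card := by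
  have hnt : Nontrivial (Fin a ⊕ Fin b) := by
    rw [← Fintype.one_lt_card_iff_nontrivial, Fintype.card_sum, Fintype.card_fin, Fintype.card_fin]
    omega
  constructor
  · have := two_mul_genus_le F
    rw [betti, sub_nonneg]
    exact_mod_cast this
  · have h := finrank_circulations_le_of_embedsInGenus F (bipGraph F).embedsInGenus_genus L
    have h' : ((L : ℝ) + 1) * betti F ≤ (L + 1) * (2 * (bipGraph F).genus + 1 +
        2 * (smallCores F L).card) + 2 * (multiEdges F).card := by
      rw [betti]
      exact_mod_cast h
    have hL : (0 : ℝ) < (L : ℝ) + 1 := by positivity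
    rw [← mul_le_mul_iff_of_pos_left hL]
    have e : ((L : ℝ) + 1) * (2 / ((L : ℝ) + 1) * (multiEdges F).card) =
        2 * (multiEdges F).card := by field_simp
    rw [mul_add, e]
    linarith

/-- Triangle inequality through `betti` and its mean. Only the term with 2/(L + 1) and the bias of
the mean can be of order `a` when `L` is fixed. -/
theorem subsetExp_abs_genus_sub_le {a b : ℕ} {p d t : ℝ} (ha : 1 ≤ a) (hb : 1 ≤ b)
    (h0 : 0 ≤ p) (h1 : p ≤ 1) (hd : p * Real.sqrt ((a : ℝ) * b) = d) (L : ℕ) :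
    subsetExp p (Finset.univ : Finset (Fin a × Fin b))
      (fun F => |2 * ((bipGraph F).genus : ℝ) - t|) ≤
      1 + 2 * ∑ m ∈ Finset.range (L + 1), (m : ℝ) ^ (2 * m) * d ^ m +
        2 / ((L : ℝ) + 1) * (d ^ 2 * a) + Real.sqrt (d ^ 2 * a) +
        |subsetExp p (Finset.univ : Finset (Fin a × Fin b)) betti - t| := by
  set m := subsetExp p (Finset.univ : Finset (Fin a × Fin b)) betti
  have hd2 : (a : ℝ) ^ 2 * b * p ^ 2 = d ^ 2 * a := by
    rw [← hd, mul_pow, Real.sq_sqrt (by positivity)]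
    ring
  have e1 : ∀ F : Finset (Fin a × Fin b), |2 * ((bipGraph F).genus : ℝ) - t| ≤
      1 + 2 * (smallCores F L).card + 2 / ((L : ℝ) + 1) * (multiEdges F).card +
        |betti F - m| + |m - t| := by
    intro F
    obtain ⟨h2, h3⟩ := betti_sub_two_mul_genus_le (by omega) F L
    have h4 : 2 * ((bipGraph F).genus : ℝ) - t =
      -(betti F - 2 * (bipGraph F).genus) + (betti F - m) + (m - t) := by ring
    rw [h4]
    refine (abs_add_three _ _ _).trans ?_
    rw [abs_neg, abs_of_nonneg h2]
    linarith
  refine (subsetExp_mono h0 h1 fun F _ => e1 F).trans ?_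
  rw [subsetExp_add, subsetExp_add, subsetExp_add, subsetExp_add, subsetExp_const,
    subsetExp_const, subsetExp_const_mul, subsetExp_const_mul]
  have b1 := subsetExp_smallCores_le (α := Fin a) (β := Fin b) (d := d) h0
    (by simpa only [Fintype.card_fin] using hd)
    (by simpa only [Fintype.card_fin] using Nat.mul_le_mul ha hb) L
  have b2 := subsetExp_multiEdges_le (α := Fin a) (β := Fin b) h0 h1
  have b3 := subsetExp_abs_betti_sub_le (α := Fin a) (β := Fin b) h0 h1
  rw [Fintype.card_fin, Fintype.card_fin, hd2] at b2 b3
  have b4 := mul_le_mul_of_nonneg_left b2 (show 0 ≤ 2 / ((L : ℝ) + 1) by positivity)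
  gcongr

end Concentration

/-! ### Asymptotics and conclusion -/

section Asymptotic

variable {n₁ n₂ : ℕ → ℕ} {p : ℕ → unitInterval} {d : ℝ}

theorem eventually_parameters (hn₁ : Tendsto n₁ atTop atTop)
    (hn₁₂ : (fun n => (n₁ n : ℝ)) =o[atTop] (fun n => (n₂ n : ℝ)))
    (hp : ∀ᶠ n in atTop, (p n : ℝ) = d / Real.sqrt ((n₁ n : ℝ) * (n₂ n : ℝ))) :
    ∀ᶠ n in atTop, 1 ≤ n₁ n ∧ 1 ≤ n₂ n ∧ (p n : ℝ) * Real.sqrt ((n₁ n : ℝ) * n₂ n) = d ∧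
      (n₁ n : ℝ) * n₂ n * (p n : ℝ) ^ 2 = d ^ 2 := by
  filter_upwards [hn₁.eventually_ge_atTop 1, hn₁₂.def one_pos, hp] with n h1 h2 h3
  rw [one_mul, Real.norm_natCast, Real.norm_natCast, Nat.cast_le] at h2
  have h2 : 1 ≤ n₂ n := h1.trans h2
  have e1 : (0 : ℝ) < n₁ n := by exact_mod_cast h1
  have e2 : (0 : ℝ) < n₂ n := by exact_mod_cast h2
  have hs : Real.sqrt ((n₁ n : ℝ) * n₂ n) ≠ 0 := (Real.sqrt_pos.2 (by positivity)).ne'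
  have h4 : (p n : ℝ) * Real.sqrt ((n₁ n : ℝ) * n₂ n) = d := by
    rw [h3]; field_simp
  refine ⟨h1, h2, h4, ?_⟩
  rw [← h4, mul_pow, Real.sq_sqrt (by positivity)]
  ring

/-- n₁p = d√(n₁/n₂). This limit makes the replacement of cliques by pairs negligible. -/
theorem tendsto_left_mul (hd : 0 < d) (hn₁ : Tendsto n₁ atTop atTop)
    (hn₁₂ : (fun n => (n₁ n : ℝ)) =o[atTop] (fun n => (n₂ n : ℝ)))
    (hp : ∀ᶠ n in atTop, (p n : ℝ) = d / Real.sqrt ((n₁ n : ℝ) * (n₂ n : ℝ))) :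
    Tendsto (fun n => (n₁ n : ℝ) * (p n : ℝ)) atTop (𝓝 0) := by
  have h1 := (Real.continuous_sqrt.tendsto _).comp
    (hn₁₂.tendsto_div_nhds_zero.const_mul (d ^ 2))
  rw [mul_zero, Real.sqrt_zero] at h1
  refine h1.congr' ?_
  filter_upwards [eventually_parameters hn₁ hn₁₂ hp] with n hn
  obtain ⟨h1, h2, -, h4⟩ := hn
  have e1 : (0 : ℝ) < n₁ n := by exact_mod_cast h1
  have e2 : (0 : ℝ) < n₂ n := by exact_mod_cast h2
  rw [Function.comp_apply, Real.sqrt_eq_iff_mul_self_eq (by positivity)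
    (mul_nonneg e1.le (p n).2.1), ← h4]
  field_simp

/-- With y = n₂p² = d²/n₁ the edge probability lies between y/(1 + y) and y, by exp(−y) ≤ 1/(1 + y)
and Bernoulli's inequality. -/
theorem tendsto_left_mul_edgeProb (hn₁ : Tendsto n₁ atTop atTop)
    (hn₁₂ : (fun n => (n₁ n : ℝ)) =o[atTop] (fun n => (n₂ n : ℝ)))
    (hp : ∀ᶠ n in atTop, (p n : ℝ) = d / Real.sqrt ((n₁ n : ℝ) * (n₂ n : ℝ))) :
    Tendsto (fun n => (n₁ n : ℝ) * (1 - (1 - (p n : ℝ) ^ 2) ^ n₂ n)) atTop (𝓝 (d ^ 2)) := by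
  have hlow : Tendsto (fun n => d ^ 2 / (1 + d ^ 2 / (n₁ n : ℝ))) atTop (𝓝 (d ^ 2)) := by
    have h1 : Tendsto (fun n => d ^ 2 / (n₁ n : ℝ)) atTop (𝓝 0) :=
      tendsto_const_nhds.div_atTop (tendsto_natCast_atTop_atTop.comp hn₁)
    have h2 := (tendsto_const_nhds (x := d ^ 2)).div (h1.const_add 1) (by norm_num)
    rwa [add_zero, div_one] at h2
  refine tendsto_of_tendsto_of_tendsto_of_le_of_le' hlow tendsto_const_nhds ?_ ?_
  · filter_upwards [eventually_parameters hn₁ hn₁₂ hp] with n hn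
    obtain ⟨h1, h2, -, h4⟩ := hn
    have e1 : (0 : ℝ) < n₁ n := by exact_mod_cast h1
    set y := (n₂ n : ℝ) * (p n : ℝ) ^ 2 with hy
    have hy0 : 0 ≤ y := by positivity
    have hdy : d ^ 2 = n₁ n * y := by rw [← h4, hy]; ring
    have hp1 : (p n : ℝ) ^ 2 ≤ 1 := pow_le_one₀ (p n).2.1 (p n).2.2
    have h5 : (1 - (p n : ℝ) ^ 2) ^ n₂ n ≤ Real.exp (-y) := by
      calc (1 - (p n : ℝ) ^ 2) ^ n₂ n ≤ Real.exp (-(p n : ℝ) ^ 2) ^ n₂ n :=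
            pow_le_pow_left₀ (by linarith) (Real.one_sub_le_exp_neg _) _
        _ = Real.exp (-y) := by rw [← Real.exp_nat_mul, hy]; congr 1; ring
    have h6 : Real.exp (-y) ≤ 1 / (1 + y) := by
      rw [Real.exp_neg, one_div]
      exact inv_anti₀ (by positivity) (by linarith [Real.add_one_le_exp y])
    have h7 : d ^ 2 / (1 + d ^ 2 / (n₁ n : ℝ)) = n₁ n * (1 - 1 / (1 + y)) := by
      rw [hdy]; field_simp; ring
    rw [h7]
    exact mul_le_mul_of_nonneg_left (by linarith) e1.le
  · filter_upwards [eventually_parameters hn₁ hn₁₂ hp] with n hn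
    obtain ⟨h1, h2, -, h4⟩ := hn
    have hp1 : (p n : ℝ) ^ 2 ≤ 1 := pow_le_one₀ (p n).2.1 (p n).2.2
    have h5 := one_add_mul_le_pow (a := -(p n : ℝ) ^ 2) (by linarith) (n₂ n)
    rw [← sub_eq_add_neg] at h5
    calc (n₁ n : ℝ) * (1 - (1 - (p n : ℝ) ^ 2) ^ n₂ n)
        ≤ n₁ n * (n₂ n * (p n : ℝ) ^ 2) :=
          mul_le_mul_of_nonneg_left (by linarith) (Nat.cast_nonneg _)
      _ = d ^ 2 := by rw [← h4]; ring

theorem replacementError_le {a : ℕ} {q : ℝ} (hq : 0 ≤ q) :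
    replacementError a q ≤ 3 * ((a : ℝ) ^ 3 * q ^ 3) + 2 * ((a : ℝ) ^ 4 * q ^ 4) := by
  have h3 : (a.choose 3 : ℝ) ≤ (a : ℝ) ^ 3 := by exact_mod_cast Nat.choose_le_pow a 3
  have h4 : ((a.choose 2).choose 2 : ℝ) ≤ (a : ℝ) ^ 4 := by
    have : (a.choose 2).choose 2 ≤ a ^ 4 := (Nat.choose_le_pow _ 2).trans (by
      rw [show a ^ 4 = (a ^ 2) ^ 2 by ring]
      exact Nat.pow_le_pow_left (Nat.choose_le_pow a 2) 2)
    exact_mod_cast this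
  rw [replacementError, ← pow_mul]
  gcongr

theorem tendsto_subsetExp_betti_div (hd : 0 < d) (hn₁ : Tendsto n₁ atTop atTop)
    (hn₁₂ : (fun n => (n₁ n : ℝ)) =o[atTop] (fun n => (n₂ n : ℝ)))
    (hp : ∀ᶠ n in atTop, (p n : ℝ) = d / Real.sqrt ((n₁ n : ℝ) * (n₂ n : ℝ))) :
    Tendsto (fun n => subsetExp (p n : ℝ) (Finset.univ : Finset (Fin (n₁ n) × Fin (n₂ n))) betti /
      n₁ n) atTop (𝓝 (d ^ 2 * genusMu (d ^ 2))) := by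
  set q : ℕ → ℝ := fun n => 1 - (1 - (p n : ℝ) ^ 2) ^ n₂ n
  have hq0 : ∀ᶠ n in atTop, 0 ≤ q n := Eventually.of_forall fun n => by
    have hp1 : (p n : ℝ) ^ 2 ≤ 1 := pow_le_one₀ (p n).2.1 (p n).2.2
    have : (1 - (p n : ℝ) ^ 2) ^ n₂ n ≤ 1 :=
      pow_le_one₀ (by linarith) (by linarith [sq_nonneg (p n : ℝ)])
    simp only [q]
    linarith
  have t1 := tendsto_sum_expectedComps_div (by positivity) hn₁
    (tendsto_left_mul_edgeProb hn₁ hn₁₂ hp) hq0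
  have t2 : Tendsto (fun n => d ^ 2 / 2 - d ^ 2 / 2 / (n₁ n : ℝ)) atTop (𝓝 (d ^ 2 / 2 - 0)) :=
    (tendsto_const_nhds.div_atTop (tendsto_natCast_atTop_atTop.comp hn₁)).const_sub _
  have t3 := (t2.sub_const 1).add t1
  rw [sub_zero, ← mul_genusMu (by positivity)] at t3
  have hs := tendsto_left_mul hd hn₁ hn₁₂ hp
  -- The errors divided by n₁, using n₁n₂p² = d²: the triples contribute 1 + 3 times d²n₁p (degree
  -- sum and cliques), the pairs of added pairs 2d²(n₁p)².
  have t4 : Tendsto (fun n => 4 * (d ^ 2 * ((n₁ n : ℝ) * (p n : ℝ))) +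
      2 * (d ^ 2 * ((n₁ n : ℝ) * (p n : ℝ)) ^ 2)) atTop (𝓝 0) := by
    have := ((hs.const_mul (d ^ 2)).const_mul 4).add (((hs.pow 2).const_mul (d ^ 2)).const_mul 2)
    simpa using this
  refine (tendsto_iff_of_dist ?_).1 t3
  refine squeeze_zero' (Eventually.of_forall fun n => dist_nonneg) ?_ t4
  filter_upwards [eventually_parameters hn₁ hn₁₂ hp] with n hn
  obtain ⟨h1, h2, -, h4⟩ := hn
  have e1 : (0 : ℝ) < n₁ n := by exact_mod_cast h1
  have hp0 : 0 ≤ (p n : ℝ) := (p n).2.1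
  have hb := abs_subsetExp_betti_sub_le (α := Fin (n₁ n)) (β := Fin (n₂ n)) hp0 (p n).2.2
  rw [Fintype.card_fin, Fintype.card_fin] at hb
  have hmain : d ^ 2 / 2 - d ^ 2 / 2 / (n₁ n : ℝ) - 1 +
      (∑ k ∈ Finset.range (n₁ n), expectedComps (n₁ n) (q n) k) / n₁ n =
      ((n₂ n : ℝ) * ((n₁ n).choose 2 * (p n : ℝ) ^ 2) - n₁ n +
        ∑ k ∈ Finset.range (n₁ n), expectedComps (n₁ n) (q n) k) / n₁ n := by
    rw [Nat.cast_choose_two, ← h4]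
    field_simp
  rw [Real.dist_eq, abs_sub_comm, hmain, ← sub_div, abs_div, abs_of_pos e1, div_le_iff₀ e1]
  refine hb.trans ?_
  have hr := replacementError_le (a := n₁ n) hp0
  have h3 : ((n₁ n).choose 3 : ℝ) ≤ (n₁ n : ℝ) ^ 3 := by
    exact_mod_cast Nat.choose_le_pow (n₁ n) 3
  have h5 : ((n₁ n).choose 3 : ℝ) * (p n : ℝ) ^ 3 ≤ (n₁ n : ℝ) ^ 3 * (p n : ℝ) ^ 3 :=
    mul_le_mul_of_nonneg_right h3 (by positivity)
  have h6 := mul_le_mul_of_nonneg_left (add_le_add h5 hr) (Nat.cast_nonneg (α := ℝ) (n₂ n))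
  rw [mul_add] at h6
  refine h6.trans_eq ?_
  rw [← h4]
  ring

theorem tendsto_subsetExp_abs_genus_sub_div (hd : 0 < d) (hn₁ : Tendsto n₁ atTop atTop)
    (hn₁₂ : (fun n => (n₁ n : ℝ)) =o[atTop] (fun n => (n₂ n : ℝ)))
    (hp : ∀ᶠ n in atTop, (p n : ℝ) = d / Real.sqrt ((n₁ n : ℝ) * (n₂ n : ℝ))) :
    Tendsto (fun n => subsetExp (p n : ℝ) (Finset.univ : Finset (Fin (n₁ n) × Fin (n₂ n)))
      (fun F => |2 * ((bipGraph F).genus : ℝ) - d ^ 2 * genusMu (d ^ 2) * n₁ n|) / n₁ n)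
      atTop (𝓝 0) := by
  rw [Metric.tendsto_nhds]
  intro δ hδ
  have hL : Tendsto (fun L : ℕ => 2 * d ^ 2 * (1 / ((L : ℝ) + 1))) atTop (𝓝 (2 * d ^ 2 * 0)) :=
    tendsto_one_div_add_atTop_nhds_zero_nat.const_mul _
  rw [mul_zero] at hL
  -- `L` is fixed before n grows, so the core set term `C` is a constant and vanishes after division
  -- by n₁.
  obtain ⟨L, hL⟩ := (hL.eventually (gt_mem_nhds (show (0 : ℝ) < δ / 2 by positivity))).exists
  set C := 1 + 2 * ∑ m ∈ Finset.range (L + 1), (m : ℝ) ^ (2 * m) * d ^ m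
  have hcast : Tendsto (fun n => (n₁ n : ℝ)) atTop atTop := tendsto_natCast_atTop_atTop.comp hn₁
  have t1 : Tendsto (fun n => C / (n₁ n : ℝ)) atTop (𝓝 0) := tendsto_const_nhds.div_atTop hcast
  have t2 : Tendsto (fun n => d / Real.sqrt (n₁ n : ℝ)) atTop (𝓝 0) :=
    tendsto_const_nhds.div_atTop (Real.tendsto_sqrt_atTop.comp hcast)
  have t3 := ((tendsto_subsetExp_betti_div hd hn₁ hn₁₂ hp).sub_const
    (d ^ 2 * genusMu (d ^ 2))).abs
  rw [sub_self, abs_zero] at t3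
  have t := (t1.add t2).add t3
  rw [add_zero, add_zero] at t
  filter_upwards [eventually_parameters hn₁ hn₁₂ hp,
    t.eventually (gt_mem_nhds (show (0 : ℝ) < δ / 2 by positivity))] with n hn ht
  obtain ⟨h1, h2, h3, -⟩ := hn
  have e1 : (0 : ℝ) < n₁ n := by exact_mod_cast h1
  have hb := subsetExp_abs_genus_sub_le (t := d ^ 2 * genusMu (d ^ 2) * n₁ n) h1 h2 (p n).2.1
    (p n).2.2 h3 L
  have hnn : 0 ≤ subsetExp (p n : ℝ) (Finset.univ : Finset (Fin (n₁ n) × Fin (n₂ n)))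
      (fun F => |2 * ((bipGraph F).genus : ℝ) - d ^ 2 * genusMu (d ^ 2) * n₁ n|) :=
    subsetExp_nonneg (p n).2.1 (p n).2.2 fun F _ => abs_nonneg _
  rw [Real.dist_eq, sub_zero, abs_of_nonneg (by positivity), div_lt_iff₀ e1]
  refine hb.trans_lt ?_
  set m := subsetExp (p n : ℝ) (Finset.univ : Finset (Fin (n₁ n) × Fin (n₂ n))) betti
  have e2 : |m / n₁ n - d ^ 2 * genusMu (d ^ 2)| * n₁ n =
      |m - d ^ 2 * genusMu (d ^ 2) * n₁ n| := by
    rw [← abs_of_pos e1, ← abs_mul, abs_of_pos e1]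
    congr 1
    field_simp
  have e3 : d / Real.sqrt (n₁ n : ℝ) * n₁ n = Real.sqrt (d ^ 2 * n₁ n) := by
    rw [Real.sqrt_mul (by positivity), Real.sqrt_sq hd.le]
    have hs : Real.sqrt (n₁ n : ℝ) ≠ 0 := (Real.sqrt_pos.2 e1).ne'
    rw [div_mul_eq_mul_div, div_eq_iff hs, mul_assoc, Real.mul_self_sqrt e1.le]
  have e4 : C / (n₁ n : ℝ) * n₁ n = C := by field_simp
  have h5 := mul_lt_mul_of_pos_right ht e1
  have h6 := mul_lt_mul_of_pos_right hL e1
  rw [add_mul, add_mul, e2, e3, e4] at h5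
  have e5 : 2 * d ^ 2 * (1 / ((L : ℝ) + 1)) * n₁ n = 2 / ((L : ℝ) + 1) * (d ^ 2 * n₁ n) := by
    ring
  rw [e5] at h6
  linarith

end Asymptotic

theorem theorem1p6 (n₁ n₂ : ℕ → ℕ) (p : ℕ → unitInterval) (d : ℝ) (hd : 1 < d)
    (hn₁ : Tendsto n₁ atTop atTop)
    (hn₁₂ : (fun n => (n₁ n : ℝ)) =o[atTop] (fun n => (n₂ n : ℝ)))
    (hp : ∀ᶠ n in atTop, (p n : ℝ) = d / Real.sqrt ((n₁ n : ℝ) * (n₂ n : ℝ)))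
    (ε : ℝ) (hε : 0 < ε) :
    Tendsto
      (fun n => (SimpleGraph.bipartiteRandom (n₁ n) (n₂ n) (p n)).real
        {G | |(G.genus : ℝ) - genusMu (d ^ 2) * (d ^ 2 * (n₁ n : ℝ) / 2)| ≤
          ε * (genusMu (d ^ 2) * (d ^ 2 * (n₁ n : ℝ) / 2))})
      atTop (𝓝 1) := by
  classical
  have hd0 : 0 < d := by linarith
  have hμ : 0 < genusMu (d ^ 2) := genusMu_pos (by nlinarith)
  have ht := tendsto_subsetExp_abs_genus_sub_div hd0 hn₁ hn₁₂ hp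
  have ht' := (ht.const_mul (1 / (ε * (d ^ 2 * genusMu (d ^ 2))))).const_sub 1
  rw [mul_zero, sub_zero] at ht'
  simp_rw [SimpleGraph.bipartiteRandom_real_apply]
  refine tendsto_of_tendsto_of_tendsto_of_le_of_le' ht' tendsto_const_nhds ?_ ?_
  · filter_upwards [hn₁.eventually_ge_atTop 1] with n hn
    have e1 : (0 : ℝ) < n₁ n := by exact_mod_cast hn
    set t := d ^ 2 * genusMu (d ^ 2) * n₁ n with htd
    have ht0 : 0 < t := by positivity
    have hc : ∀ y : ℝ, 1 / (ε * (d ^ 2 * genusMu (d ^ 2))) * (y / n₁ n) = 1 / (ε * t) * y := by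
      intro y
      rw [htd]
      field_simp
    rw [hc, ← subsetExp_const_mul,
      ← subsetExp_const (p := (p n : ℝ)) (E := (Finset.univ : Finset (Fin (n₁ n) × Fin (n₂ n)))) 1,
      ← subsetExp_sub]
    -- Markov's inequality in pointwise form: the indicator of the event is at least 1 − |2g −
    -- t|/(εt), where t is twice the target value.
    refine subsetExp_mono (p n).2.1 (p n).2.2 fun F _ => ?_
    rw [subsetExp_const]
    split_ifs with h
    · have : 0 ≤ 1 / (ε * t) * |2 * ((bipGraph F).genus : ℝ) - t| := by positivity
      linarith
    · rw [not_le] at h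
      have h1 : genusMu (d ^ 2) * (d ^ 2 * (n₁ n : ℝ) / 2) = t / 2 := by rw [htd]; ring
      have h2 : |2 * ((bipGraph F).genus : ℝ) - t| = 2 * |((bipGraph F).genus : ℝ) - t / 2| := by
        rw [show 2 * ((bipGraph F).genus : ℝ) - t = 2 * ((bipGraph F).genus - t / 2) by ring,
          abs_mul, abs_two]
      rw [h1] at h
      rw [h2, one_div_mul_eq_div, sub_nonpos, one_le_div (by positivity)]
      linarith
  · refine Eventually.of_forall fun n => ?_
    refine (subsetExp_mono (p n).2.1 (p n).2.2 (g := fun _ => 1) fun F _ => ?_).trans_eq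
      (subsetExp_const 1)
    split_ifs <;> norm_num
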